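/- **Model.** For each $n$ let $\Theta=\Theta_n=(\rho,\theta,\alpha_1,\dots,\alpha_n,\beta_1,\dots,\beta_n)$ be real parameters with $\sum_i\alpha_i=0=\sum_j\beta_j$ (they may all depend on $n$), and let $X=(X_{ij})$ be the adjacency matrix ($X_{ii}=0$) of a random directed graph on $[n]$ distributed according to the $p_1$ model, i.e. $P(X=x)\propto\exp\{\rho\sum_{i<j}x_{ij}x_{ji}+\theta\sum_{i,j}x_{ij}+\sum_i\alpha_i\sum_jx_{ij}+\sum_j\beta_j\sum_ix_{ij}\}$. For $i\ne j$ and $a,b\in\{0,1\}$ put $I_{ij}^{ab}=\mathbf 1\{X_{ij}=a,X_{ji}=b\}$ and $$p_{ij}^{ab}=\frac{e^{a(\theta+\alpha_i+\beta_j)+b(\theta+\alpha_j+\beta_i)+ab\rho}}{k_{ij}},\qquad k_{ij}=1+e^{\theta+\alpha_i+\beta_j}+e^{\theta+\alpha_j+\beta_i}+e^{\rho+2\theta+\alpha_i+\alpha_j+\beta_i+\beta_j}.$$ **Estimators.** All sums below run over distinct nodes different from the displayed ones. $$\hat\theta=\frac1n\sum_{t=1}^n\log\frac{\sum_{i,j\ne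 t}I_{it}^{01}I_{ij}^{00}I_{tj}^{01}}{\sum_{i,j\ne t}I_{it}^{00}I_{ij}^{01}I_{tj}^{00}},\qquad \hat\rho=\frac1n\sum_{t=1}^n\log\frac{\sum_{i,j\ne t}I_{it}^{11}I_{ij}^{10}I_{tj}^{11}}{\sum_{i,j\ne t}I_{it}^{10}I_{ij}^{11}I_{tj}^{10}}-\hat\theta,$$ $$\hat\alpha_i=\frac1n\sum_{t=1}^n\log\frac{\sum_{k,l\ne i,t}I_{ki}^{01}I_{kl}^{00}I_{tl}^{01}}{\sum_{k,l\ne i,t}I_{ki}^{00}I_{kl}^{01}I_{tl}^{00}}-\hat\theta,\qquad \hat\beta_j=\frac1n\sum_{t=1}^n\log\frac{\sum_{k,l\ne j,t}I_{kt}^{01}I_{kl}^{00}I_{jl}^{01}}{\sum_{k,l\ne j,t}I_{kt}^{00}I_{kl}^{01}I_{jl}^{00}}-\hat\theta,$$ and $\hat\Theta=(\hat\rho,\hat\theta,\hat\alpha_1,\dots,\hat\beta_n)$. (These are defined whenever all the counts are positive; by convention $\log 0=0$ and $x/0=0$ otherwise.) **Variance and bias.** Put $\mu_t^{(abc)}=n^{-2}\sum_{i,j\ne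 t}p_{it}^{ca}p_{ij}^{cb}p_{tj}^{ca}$ and, for $i\ne t$, $$\eta_{it}^{(abc)}=\frac1n\sum_{j\ne i,t}\Big(\frac{p_{tj}^{ca}p_{ij}^{cb}}{\mu_t^{(abc)}}+\frac{p_{ji}^{ca}p_{jt}^{cb}}{\mu_i^{(abc)}}-\frac{p_{ij}^{cb}p_{jt}^{cb}}{\mu_j^{(bac)}}\Big),$$ $$\zeta_{it,1}^{(abc)}=\frac1{2n^3}\Big[\Big(\frac1{\mu_t^{(abc)}}\sum_{j\ne i,t}p_{tj}^{ca}p_{ij}^{cb}\Big)^2+\Big(\frac1{\mu_i^{(abc)}}\sum_{j\ne i,t}p_{ji}^{ca}p_{jt}^{cb}\Big)^2\Big],$$ $$\zeta_{it,2}^{(abc)}=\frac1{n^3}\Big(\frac1{\mu_t^{(abc)}}\sum_{j\ne i,t}p_{tj}^{ca}p_{ij}^{cb}\Big)\Big(\frac1{\mu_t^{(abc)}}\sum_{j\ne i,t}p_{jt}^{ca}p_{ji}^{cb}\Big).$$ With $g_4(x;y)=\sum_{k=1}^4x_k^2y_k-(\sum_{k=1}^4x_ky_k)^2$ let $$\sigma_\rho^2=\frac1{n^4}\sum_{t<i}g_4\big(-(\eta_{it}^{(100)}+\eta_{ti}^{(011)}),\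 \eta_{it}^{(010)}+\eta_{ti}^{(010)},\ \eta_{it}^{(101)}+\eta_{ti}^{(101)},\ -(\eta_{it}^{(011)}+\eta_{ti}^{(100)});\ p_{it}^{01},p_{it}^{00},p_{it}^{11},p_{it}^{10}\big)$$ and $$\begin{aligned}\rho^*=\frac1{n^2}\sum_{t<i}\Big[&(\zeta_{it,1}^{(100)}+\zeta_{ti,1}^{(011)})p_{it}^{01}(1-p_{it}^{01})+(\zeta_{ti,1}^{(100)}+\zeta_{it,1}^{(011)})p_{it}^{10}(1-p_{it}^{10})\\&-(\zeta_{it,1}^{(101)}+\zeta_{ti,1}^{(101)}+\zeta_{it,2}^{(101)}+\zeta_{ti,2}^{(101)})p_{it}^{11}(1-p_{it}^{11})\\&-(\zeta_{it,1}^{(010)}+\zeta_{ti,1}^{(010)}+\zeta_{it,2}^{(010)}+\zeta_{ti,2}^{(010)})p_{it}^{00}(1-p_{it}^{00})\\&-(\zeta_{it,2}^{(100)}+\zeta_{ti,2}^{(100)}+\zeta_{it,2}^{(011)}+\zeta_{ti,2}^{(011)})p_{it}^{01}p_{it}^{10}\Big].\end{aligned}$$ Let $\hat\rho^*$ and $\hat\sigma_\rho^2$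 be the plug-in estimates of $\rho^*$ and $\sigma_\rho^2$, obtained by replacing $\Theta$ by $\hat\Theta$ throughout. **Corollary.** Suppose that $\|\Theta_n\|_\infty\le C$ for all $n$, with a constant $C$ independent of $n$. Then, as $n\to\infty$, $$\frac{\hat\rho-\rho-\hat\rho^*}{\hat\sigma_\rho}\ \xrightarrow{\ d\ }\ \mathcal N(0,1).$$ Consequently, the test of $H_0:\rho=0$ that rejects when $|\hat\rho-\hat\rho^*|>z_{1-a/2}\,\hat\sigma_\rho$ has asymptotic level $a$ for every $a\in(0,1)$: if $\rho=0$ for all $n$, then $P(|\hat\rho-\hat\rho^*|>z_{1-a/2}\hat\sigma_\rho)\to a$, where $z_q$ is the $q$-quantile of $\mathcal N(0,1)$. -/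

import Mathlib

open Filter Topology MeasureTheory ProbabilityTheory

noncomputable section

namespace P1

/-- The parameter vector `Θ = (ρ, θ, α₁, …, αₙ, β₁, …, βₙ)` of the `p₁` model on `n` nodes. -/
structure Param (n : ℕ) where
  rho : ℝ
  theta : ℝ
  alpha : Fin n → ℝ
  beta : Fin n → ℝ

/-- The identification constraint `∑ αᵢ = 0`, `∑ βⱼ = 0`. -/
def Param.Identified {n : ℕ} (Θ : Param n) : Prop :=
  ∑ i, Θ.alpha i = 0 ∧ ∑ j, Θ.beta j = 0

/-- `‖Θ‖_∞ ≤ C`. -/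
def Param.BoundedBy {n : ℕ} (Θ : Param n) (C : ℝ) : Prop :=
  |Θ.rho| ≤ C ∧ |Θ.theta| ≤ C ∧ (∀ i, |Θ.alpha i| ≤ C) ∧ (∀ j, |Θ.beta j| ≤ C)

/-- Arrays `g = (g i j)` with entries `0`, `1`. The adjacency matrices of directed graphs without
loops are those with `g i i = 0` for all `i`. -/
abbrev AdjArray (n : ℕ) : Type := Fin n → Fin n → Fin 2

/-! ### The model -/

/-- The unnormalised `p₁` weight
`exp (ρ m + θ x₊₊ + ∑ᵢ αᵢ xᵢ₊ + ∑ⱼ βⱼ x₊ⱼ)` of a directed graph. -/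
def weight {n : ℕ} (Θ : Param n) (g : AdjArray n) : ℝ :=
  Real.exp
    (Θ.rho * (∑ i, ∑ j ∈ Finset.Ioi i, ((g i j : ℕ) : ℝ) * ((g j i : ℕ) : ℝ))
      + Θ.theta * (∑ i, ∑ j, ((g i j : ℕ) : ℝ))
      + ∑ i, Θ.alpha i * (∑ j, ((g i j : ℕ) : ℝ))
      + ∑ j, Θ.beta j * (∑ i, ((g i j : ℕ) : ℝ)))

/-- The adjacency matrices of the loopless directed graphs on `n` labelled nodes. -/
def graphs (n : ℕ) : Finset (AdjArray n) :=
  Finset.univ.filter fun g => ∀ i, g i i = 0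

/-- The law of the `p₁` model: each loopless directed graph `g` has probability proportional
to `weight Θ g`. -/
def law {n : ℕ} (Θ : Param n) : Measure (AdjArray n) :=
  ∑ g ∈ graphs n,
    ENNReal.ofReal (weight Θ g / ∑ g' ∈ graphs n, weight Θ g') • Measure.dirac g

/-- The normalising constant `k_ij` of the law of a dyad. -/
def dyadNorm {n : ℕ} (Θ : Param n) (i j : Fin n) : ℝ :=
  1 + Real.exp (Θ.theta + Θ.alpha i + Θ.beta j) + Real.exp (Θ.theta + Θ.alpha j + Θ.beta i)
    + Real.exp (Θ.rho + 2 * Θ.theta + Θ.alpha i + Θ.alpha j + Θ.beta i + Θ.beta j)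

/-- The dyad probability `p_ij^{ab}`, for `i ≠ j`. -/
def dyadProb {n : ℕ} (Θ : Param n) (i j : Fin n) (a b : Fin 2) : ℝ :=
  1 / dyadNorm Θ i j *
    Real.exp (((a : ℕ) : ℝ) * (Θ.theta + Θ.alpha i + Θ.beta j)
      + ((b : ℕ) : ℝ) * (Θ.theta + Θ.alpha j + Θ.beta i)
      + ((a : ℕ) : ℝ) * ((b : ℕ) : ℝ) * Θ.rho)

/-- The dyad indicator `I_ij^{ab}`, for `i ≠ j`. -/
def ind {n : ℕ} (g : AdjArray n) (i j : Fin n) (a b : Fin 2) : ℝ :=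
  if g i j = a ∧ g j i = b then 1 else 0

/-! ### Triple-dyad sums and the triple-dyad ratio estimator -/

/-- `∑_{i, j ≠ t} F_it^{ca} F_ij^{cb} F_tj^{ca}`, over ordered pairs of distinct nodes `i`, `j`
different from `t`. -/
def tripleSum {n : ℕ} (F : Fin n → Fin n → Fin 2 → Fin 2 → ℝ) (a b c : Fin 2) (t : Fin n) : ℝ :=
  ∑ i ∈ ({t}ᶜ : Finset (Fin n)), ∑ j ∈ ({t, i}ᶜ : Finset (Fin n)),
    F i t c a * F i j c b * F t j c a

/-- `∑_{k, l ≠ i, t} F_ki^{ca} F_kl^{cb} F_tl^{ca}`, over ordered pairs of distinct nodes `k`, `l`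
different from `i` and `t` (the case `i = t` is allowed). -/
def pathSum {n : ℕ} (F : Fin n → Fin n → Fin 2 → Fin 2 → ℝ) (a b c : Fin 2) (i t : Fin n) : ℝ :=
  ∑ k ∈ ({i, t}ᶜ : Finset (Fin n)), ∑ l ∈ ({i, t, k}ᶜ : Finset (Fin n)),
    F k i c a * F k l c b * F t l c a

def thetaHat {n : ℕ} (g : AdjArray n) : ℝ :=
  1 / (n : ℝ) * ∑ t, Real.log (tripleSum (ind g) 1 0 0 t / tripleSum (ind g) 0 1 0 t)

def rhoHat {n : ℕ} (g : AdjArray n) : ℝ :=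
  1 / (n : ℝ) * ∑ t, Real.log (tripleSum (ind g) 1 0 1 t / tripleSum (ind g) 0 1 1 t) - thetaHat g

def alphaHat {n : ℕ} (g : AdjArray n) (i : Fin n) : ℝ :=
  1 / (n : ℝ) * ∑ t, Real.log (pathSum (ind g) 1 0 0 i t / pathSum (ind g) 0 1 0 i t) - thetaHat g

def betaHat {n : ℕ} (g : AdjArray n) (j : Fin n) : ℝ :=
  1 / (n : ℝ) * ∑ t, Real.log (pathSum (ind g) 1 0 0 t j / pathSum (ind g) 0 1 0 t j) - thetaHat g

/-- The triple-dyad ratio estimator of `Θ`. -/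
def estimator {n : ℕ} (g : AdjArray n) : Param n where
  rho := rhoHat g
  theta := thetaHat g
  alpha := alphaHat g
  beta := betaHat g

/-! ### Asymptotic variance and bias, as functions of `Θ` -/

/-- `μ_t^{(abc)}`. -/
def mu {n : ℕ} (Θ : Param n) (a b c : Fin 2) (t : Fin n) : ℝ :=
  1 / (n : ℝ) ^ 2 * tripleSum (dyadProb Θ) a b c t

/-- `η_it^{(abc)}`. -/
def eta {n : ℕ} (Θ : Param n) (a b c : Fin 2) (i t : Fin n) : ℝ :=
  1 / (n : ℝ) * ∑ j ∈ ({i, t}ᶜ : Finset (Fin n)),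
    (1 / mu Θ a b c t * dyadProb Θ t j c a * dyadProb Θ i j c b
      + 1 / mu Θ a b c i * dyadProb Θ j i c a * dyadProb Θ j t c b
      - 1 / mu Θ b a c j * dyadProb Θ i j c b * dyadProb Θ j t c b)

/-- `ζ_{it,1}^{(abc)}`. -/
def zeta1 {n : ℕ} (Θ : Param n) (a b c : Fin 2) (i t : Fin n) : ℝ :=
  1 / (2 * (n : ℝ) ^ 3) *
    ((1 / mu Θ a b c t *
        ∑ j ∈ ({i, t}ᶜ : Finset (Fin n)), dyadProb Θ t j c a * dyadProb Θ i j c b) ^ 2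
      + (1 / mu Θ a b c i *
        ∑ j ∈ ({i, t}ᶜ : Finset (Fin n)), dyadProb Θ j i c a * dyadProb Θ j t c b) ^ 2)

/-- `ζ_{it,2}^{(abc)}`. -/
def zeta2 {n : ℕ} (Θ : Param n) (a b c : Fin 2) (i t : Fin n) : ℝ :=
  1 / (n : ℝ) ^ 3 *
    (1 / mu Θ a b c t *
      ∑ j ∈ ({i, t}ᶜ : Finset (Fin n)), dyadProb Θ t j c a * dyadProb Θ i j c b) *
    (1 / mu Θ a b c t *
      ∑ j ∈ ({i, t}ᶜ : Finset (Fin n)), dyadProb Θ j t c a * dyadProb Θ j i c b)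

/-- `g_m(x; y) = ∑ x_k² y_k - (∑ x_k y_k)²`. -/
def gFun {m : ℕ} (x y : Fin m → ℝ) : ℝ :=
  ∑ k, x k ^ 2 * y k - (∑ k, x k * y k) ^ 2

/-- The asymptotic variance `σ_ρ²`. -/
def sigmaRhoSq {n : ℕ} (Θ : Param n) : ℝ :=
  1 / (n : ℝ) ^ 4 * ∑ t, ∑ i ∈ Finset.Ioi t,
    gFun
      ![-(eta Θ 1 0 0 i t + eta Θ 0 1 1 t i),
        eta Θ 0 1 0 i t + eta Θ 0 1 0 t i,
        eta Θ 1 0 1 i t + eta Θ 1 0 1 t i,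
        -(eta Θ 0 1 1 i t + eta Θ 1 0 0 t i)]
      ![dyadProb Θ i t 0 1, dyadProb Θ i t 0 0, dyadProb Θ i t 1 1, dyadProb Θ i t 1 0]

/-- The asymptotic bias `ρ*`. In the last line all four `ζ_{·,2}` terms carry the same sign, since
`Cov (I_it^{01}, I_it^{10}) = - p_it^{01} p_it^{10}` enters the `(100)` and `(011)` sums alike. -/
def rhoStar {n : ℕ} (Θ : Param n) : ℝ :=
  1 / (n : ℝ) ^ 2 * ∑ t, ∑ i ∈ Finset.Ioi t,
    ((zeta1 Θ 1 0 0 i t + zeta1 Θ 0 1 1 t i) * dyadProb Θ i t 0 1 * (1 - dyadProb Θ i t 0 1)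
      + (zeta1 Θ 1 0 0 t i + zeta1 Θ 0 1 1 i t) * dyadProb Θ i t 1 0 * (1 - dyadProb Θ i t 1 0)
      - (zeta1 Θ 1 0 1 i t + zeta1 Θ 1 0 1 t i + zeta2 Θ 1 0 1 i t + zeta2 Θ 1 0 1 t i)
        * dyadProb Θ i t 1 1 * (1 - dyadProb Θ i t 1 1)
      - (zeta1 Θ 0 1 0 i t + zeta1 Θ 0 1 0 t i + zeta2 Θ 0 1 0 i t + zeta2 Θ 0 1 0 t i)
        * dyadProb Θ i t 0 0 * (1 - dyadProb Θ i t 0 0)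
      - (zeta2 Θ 1 0 0 i t + zeta2 Θ 1 0 0 t i + zeta2 Θ 0 1 1 i t + zeta2 Θ 0 1 1 t i)
        * dyadProb Θ i t 0 1 * dyadProb Θ i t 1 0)

/-! ### Plug-in estimates -/

/-- `ρ̂*`, the plug-in estimate of the bias. -/
def rhoStarHat {n : ℕ} (g : AdjArray n) : ℝ := rhoStar (estimator g)

/-- `σ̂_ρ`, the square root of the plug-in estimate of `σ_ρ²`. -/
def sigmaRhoHat {n : ℕ} (g : AdjArray n) : ℝ := Real.sqrt (sigmaRhoSq (estimator g))

end P1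

end

noncomputable section

namespace P1

/-! The weight factors over dyads, so the dyads are independent with laws `dyadProb`. Along a path
of nodes i, k, l, t the product of dyad probabilities for the pattern (1,0,c) equals exp(θ + α_i +
β_t + cρ) times the product for (0,1,c), whatever the inner nodes k and l (`dyadProb_path_ratio`).
Ratios of expected counts are therefore exact exponentials, and averaging their logarithms over t
removes α and β by the identification constraint. Where all counts are near their means, n(ρ̂ - ρ)
is thus a signed sum over t of four terms log(1 + `relErr`).

The expansion log(1 + x) = x - x²/2 + O(x³) separates three effects. The linear one is, up to a
negligible remainder, `linPart`: a sum of independent centred functions of single dyads, with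
coefficients built from η and variance n²σ_ρ²; it is asymptotically normal
(`norm_charFun_linPart_sub_le`). In the quadratic one only the dyads at t matter (`starSum`, of size
n^(-1/2)); the fluctuations of its square average out over t, and the mean that is left is nρ*
(`rhoStar_eq`). The remaining linear and quadratic errors are O(n^(-1/2)) in mean, by second moment
bounds that count shared nodes (`expect_sq_sum_le`, `expect_abs_contrast_sub_le`). The cubic effect
is handled by a bounded differences inequality (`expect_indicator_le`): all path averages lie within
δ of their means, except on an event of probability at most 16 n² exp(-nδ²/80).

On that event the estimator is within O(δ) of Θ, and n²σ_ρ² and nρ* are Lipschitz in the parameter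
uniformly in n, so plugging in costs O(δ). Dividing by σ̂_ρ requires a lower bound on n²σ_ρ². It
comes from a Cramér–Rao type argument: by the exact ratio identity the linear part has derivative
one along ρ, and Cauchy–Schwarz turns this into n²σ_ρ² ≥ 1 (`one_le_sq_mul_sigmaRhoSq`).

With δ = n^(-2/5) every error vanishes, so the characteristic function of the studentized statistic
tends to exp(-u²/2). Lévy's continuity theorem gives the limit law and the portmanteau theorem the
level of the test. -/

/-! ### Dyads, resampling a dyad, and the expectation functional -/

/-- The set of dyads, each represented by its increasing pair of nodes. -/
def dyads (n : ℕ) : Finset (Fin n × Fin n) := Finset.univ.filter fun p => p.1 < p.2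

lemma mem_dyads {n : ℕ} {p : Fin n × Fin n} : p ∈ dyads n ↔ p.1 < p.2 := by simp [dyads]

lemma sum_dyads {n : ℕ} {V : Type*} [AddCommMonoid V] (f : Fin n → Fin n → V) :
    ∑ p ∈ dyads n, f p.1 p.2 = ∑ i, ∑ j ∈ Finset.Ioi i, f i j := by
  rw [dyads, Finset.sum_filter, ← Finset.univ_product_univ, Finset.sum_product]
  refine Finset.sum_congr rfl fun i _ => ?_
  rw [← Finset.sum_filter]
  refine Finset.sum_congr ?_ fun _ _ => rfl
  ext j; simp

lemma sum_sum_compl_singleton {n : ℕ} {V : Type*} [AddCommMonoid V] (f : Fin n → Fin n → V) :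
    ∑ i, ∑ j ∈ ({i}ᶜ : Finset (Fin n)), f i j = ∑ p ∈ dyads n, (f p.1 p.2 + f p.2 p.1) := by
  have h : ∀ i : Fin n, ∑ j ∈ ({i}ᶜ : Finset (Fin n)), f i j
      = ∑ j ∈ Finset.Ioi i, f i j + ∑ j ∈ Finset.Iio i, f i j := by
    intro i
    rw [← Finset.sum_union]
    · refine Finset.sum_congr ?_ fun _ _ => rfl
      ext j; simp [eq_comm, lt_or_lt_iff_ne]
    · rw [Finset.disjoint_left]
      intro j; simp only [Finset.mem_Ioi, Finset.mem_Iio]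
      exact fun h h' => lt_asymm h h'
  simp_rw [h, Finset.sum_add_distrib]
  rw [sum_dyads, sum_dyads (fun i j => f j i)]
  congr 1
  exact Finset.sum_comm' (by simp)

lemma sum_sum_eq_diag_add {n : ℕ} {V : Type*} [AddCommMonoid V] (f : Fin n → Fin n → V) :
    ∑ i, ∑ j, f i j = ∑ i, f i i + ∑ p ∈ dyads n, (f p.1 p.2 + f p.2 p.1) := by
  rw [← sum_sum_compl_singleton, ← Finset.sum_add_distrib]
  refine Finset.sum_congr rfl fun i _ => ?_
  rw [← Finset.sum_compl_add_sum {i} (fun j => f i j), Finset.sum_singleton, add_comm]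

/-- Set the dyad of `i` and `t` to `(a, b)`. -/
def setDyad {n : ℕ} (g : AdjArray n) (i t : Fin n) (a b : Fin 2) : AdjArray n :=
  fun k l => if k = i ∧ l = t then a else if k = t ∧ l = i then b else g k l

lemma setDyad_comm {n : ℕ} (g : AdjArray n) {i t : Fin n} (h : i ≠ t) (a b : Fin 2) :
    setDyad g i t a b = setDyad g t i b a := by
  funext k l
  simp only [setDyad]
  split_ifs <;> grind

lemma setDyad_mem_graphs {n : ℕ} {g : AdjArray n} (hg : g ∈ graphs n) {i t : Fin n} (h : i ≠ t)
    (a b : Fin 2) : setDyad g i t a b ∈ graphs n := by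
  simp only [graphs, Finset.mem_filter, Finset.mem_univ, true_and, setDyad] at hg ⊢
  intro k
  rw [if_neg (by rintro ⟨rfl, rfl⟩; exact h rfl), if_neg (by rintro ⟨rfl, rfl⟩; exact h rfl)]
  exact hg k

lemma setDyad_setDyad {n : ℕ} (g : AdjArray n) (i t : Fin n) (a b a' b' : Fin 2) :
    setDyad (setDyad g i t a b) i t a' b' = setDyad g i t a' b' := by
  funext k l
  simp only [setDyad]
  split_ifs <;> rfl

lemma setDyad_self {n : ℕ} (g : AdjArray n) (i t : Fin n) :
    setDyad g i t (g i t) (g t i) = g := by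
  funext k l
  simp only [setDyad]
  split_ifs <;> grind

lemma setDyad_apply_left {n : ℕ} (g : AdjArray n) (i t : Fin n) (a b : Fin 2) :
    setDyad g i t a b i t = a := by simp [setDyad]

lemma setDyad_apply_right {n : ℕ} (g : AdjArray n) {i t : Fin n} (h : i ≠ t) (a b : Fin 2) :
    setDyad g i t a b t i = b := by simp [setDyad, h.symm]

/-- The exponent in the dyad probability. -/
def dyadExponent {n : ℕ} (Θ : Param n) (i j : Fin n) (a b : Fin 2) : ℝ :=
  ((a : ℕ) : ℝ) * (Θ.theta + Θ.alpha i + Θ.beta j)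
      + ((b : ℕ) : ℝ) * (Θ.theta + Θ.alpha j + Θ.beta i)
      + ((a : ℕ) : ℝ) * ((b : ℕ) : ℝ) * Θ.rho

lemma dyadNorm_pos {n : ℕ} (Θ : Param n) (i j : Fin n) : 0 < dyadNorm Θ i j := by
  unfold dyadNorm; positivity

lemma dyadNorm_comm {n : ℕ} (Θ : Param n) (i j : Fin n) : dyadNorm Θ i j = dyadNorm Θ j i := by
  unfold dyadNorm
  rw [show Θ.rho + 2 * Θ.theta + Θ.alpha i + Θ.alpha j + Θ.beta i + Θ.beta j
    = Θ.rho + 2 * Θ.theta + Θ.alpha j + Θ.alpha i + Θ.beta j + Θ.beta i by ring]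
  ring

lemma dyadProb_eq {n : ℕ} (Θ : Param n) (i j : Fin n) (a b : Fin 2) :
    dyadProb Θ i j a b = 1 / dyadNorm Θ i j * Real.exp (dyadExponent Θ i j a b) := rfl

lemma dyadProb_pos {n : ℕ} (Θ : Param n) (i j : Fin n) (a b : Fin 2) :
    0 < dyadProb Θ i j a b := by
  have := dyadNorm_pos Θ i j
  unfold dyadProb; positivity

lemma dyadProb_comm {n : ℕ} (Θ : Param n) (i j : Fin n) (a b : Fin 2) :
    dyadProb Θ i j a b = dyadProb Θ j i b a := by
  unfold dyadProb
  rw [dyadNorm_comm]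
  congr 2; ring

lemma sum_dyadProb {n : ℕ} (Θ : Param n) (i j : Fin n) :
    ∑ a, ∑ b, dyadProb Θ i j a b = 1 := by
  have h := (dyadNorm_pos Θ i j).ne'
  simp only [dyadProb, Fin.sum_univ_two, ← mul_add]
  rw [one_div_mul_eq_div, div_eq_one_iff_eq h]
  simp only [dyadNorm, Fin.val_zero, Fin.val_one, Nat.cast_zero, Nat.cast_one, zero_mul, one_mul,
    add_zero, zero_add, Real.exp_zero]
  rw [show Θ.theta + Θ.alpha i + Θ.beta j + (Θ.theta + Θ.alpha j + Θ.beta i) + Θ.rho =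
    Θ.rho + 2 * Θ.theta + Θ.alpha i + Θ.alpha j + Θ.beta i + Θ.beta j by ring]
  ring

lemma dyadProb_le_one {n : ℕ} (Θ : Param n) (i j : Fin n) (a b : Fin 2) :
    dyadProb Θ i j a b ≤ 1 := by
  rw [← sum_dyadProb Θ i j]
  refine le_trans ?_ (Finset.single_le_sum (f := fun a => ∑ b, dyadProb Θ i j a b)
    (fun a _ => Finset.sum_nonneg fun b _ => (dyadProb_pos Θ i j a b).le) (Finset.mem_univ a))
  exact Finset.single_le_sum (f := fun b => dyadProb Θ i j a b)
    (fun b _ => (dyadProb_pos Θ i j a b).le) (Finset.mem_univ b)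

/-- Without loops the exponent is additive over dyads. This product form is the source of all
independence below. -/
lemma weight_eq_prod {n : ℕ} (Θ : Param n) {g : AdjArray n} (hg : g ∈ graphs n) :
    weight Θ g = ∏ p ∈ dyads n, Real.exp (dyadExponent Θ p.1 p.2 (g p.1 p.2) (g p.2 p.1)) := by
  have h0 : ∀ i, g i i = 0 := by simpa [graphs] using hg
  rw [← Real.exp_sum, weight]
  congr 1
  have h1 : ∑ i, Θ.alpha i * ∑ j, ((g i j : ℕ) : ℝ) = ∑ p ∈ dyads n,
      (Θ.alpha p.1 * ((g p.1 p.2 : ℕ) : ℝ) + Θ.alpha p.2 * ((g p.2 p.1 : ℕ) : ℝ)) := by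
    simp_rw [Finset.mul_sum]
    rw [sum_sum_eq_diag_add]
    simp [h0]
  have h2 : ∑ j, Θ.beta j * ∑ i, ((g i j : ℕ) : ℝ) = ∑ p ∈ dyads n,
      (Θ.beta p.2 * ((g p.1 p.2 : ℕ) : ℝ) + Θ.beta p.1 * ((g p.2 p.1 : ℕ) : ℝ)) := by
    simp_rw [Finset.mul_sum]
    rw [sum_sum_eq_diag_add]
    simp [h0, add_comm]
  rw [h1, h2, ← sum_dyads (fun i j => ((g i j : ℕ) : ℝ) * ((g j i : ℕ) : ℝ)),
    sum_sum_eq_diag_add (fun i j => ((g i j : ℕ) : ℝ))]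
  simp only [h0, Fin.val_zero, Nat.cast_zero, Finset.sum_const_zero, zero_add, Finset.mul_sum]
  rw [← Finset.sum_add_distrib, ← Finset.sum_add_distrib, ← Finset.sum_add_distrib]
  refine Finset.sum_congr rfl fun p _ => ?_
  unfold dyadExponent; ring

/-- Detailed balance for resampling one dyad: a single factor of `weight_eq_prod` changes, and the
normaliser of the dyad law cancels. -/
lemma weight_setDyad_mul {n : ℕ} (Θ : Param n) {g : AdjArray n} (hg : g ∈ graphs n) {i t : Fin n}
    (h : i ≠ t) (a b : Fin 2) :
    weight Θ (setDyad g i t a b) * dyadProb Θ i t (g i t) (g t i)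
      = weight Θ g * dyadProb Θ i t a b := by
  wlog hit : i < t generalizing i t a b
  · rw [setDyad_comm g h, dyadProb_comm, dyadProb_comm Θ i t a b]
    exact this h.symm b a (lt_of_le_of_ne (not_lt.mp hit) h.symm)
  have hm : (i, t) ∈ dyads n := mem_dyads.2 hit
  rw [weight_eq_prod Θ hg, weight_eq_prod Θ (setDyad_mem_graphs hg h a b),
    ← Finset.mul_prod_erase _ _ hm, ← Finset.mul_prod_erase _ _ hm]
  simp only [setDyad_apply_left, setDyad_apply_right g h]
  rw [Finset.prod_congr rfl (g := fun p : Fin n × Fin n =>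
    Real.exp (dyadExponent Θ p.1 p.2 (g p.1 p.2) (g p.2 p.1)))]
  · simp only [dyadProb_eq]; ring
  · rintro ⟨k, l⟩ hp
    rw [Finset.mem_erase, mem_dyads] at hp
    obtain ⟨hne, hkl⟩ := hp
    simp only at hkl
    have e1 : setDyad g i t a b k l = g k l := by
      unfold setDyad
      rw [if_neg (by rintro ⟨rfl, rfl⟩; exact hne rfl),
        if_neg (by rintro ⟨rfl, rfl⟩; exact lt_asymm hit hkl)]
    have e2 : setDyad g i t a b l k = g l k := by
      unfold setDyad
      rw [if_neg (by rintro ⟨rfl, rfl⟩; exact lt_asymm hit hkl),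
        if_neg (by rintro ⟨rfl, rfl⟩; exact hne rfl)]
    simp only [e1, e2]

section Expect

variable {n : ℕ} {V : Type*} [AddCommGroup V] [Module ℝ V]

/-- Expectation of a statistic under the `p₁` model. -/
def expect (Θ : Param n) (f : AdjArray n → V) : V :=
  ∑ g ∈ graphs n, (weight Θ g / ∑ g' ∈ graphs n, weight Θ g') • f g

/-- Average a statistic over the dyad of `i` and `t`. -/
def resample (Θ : Param n) (i t : Fin n) (f : AdjArray n → V) (g : AdjArray n) : V :=
  ∑ a, ∑ b, dyadProb Θ i t a b • f (setDyad g i t a b)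

/-- The statistic `f` does not depend on the dyad of `i` and `t`. -/
def Free {W : Type*} (f : AdjArray n → W) (i t : Fin n) : Prop :=
  ∀ g a b, f (setDyad g i t a b) = f g

lemma zero_mem_graphs : (0 : AdjArray n) ∈ graphs n := by simp [graphs]

lemma weight_pos (Θ : Param n) (g : AdjArray n) : 0 < weight Θ g := Real.exp_pos _

lemma sum_weight_pos (Θ : Param n) : 0 < ∑ g ∈ graphs n, weight Θ g :=
  Finset.sum_pos (fun g _ => weight_pos Θ g) ⟨_, zero_mem_graphs⟩

lemma expect_add (Θ : Param n) (f h : AdjArray n → V) :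
    expect Θ (fun g => f g + h g) = expect Θ f + expect Θ h := by
  simp [expect, Finset.sum_add_distrib]

lemma expect_sub (Θ : Param n) (f h : AdjArray n → V) :
    expect Θ (fun g => f g - h g) = expect Θ f - expect Θ h := by
  simp [expect, smul_sub]

lemma expect_sum (Θ : Param n) {ι : Type*} (s : Finset ι) (f : ι → AdjArray n → V) :
    expect Θ (fun g => ∑ i ∈ s, f i g) = ∑ i ∈ s, expect Θ (f i) := by
  simp only [expect, Finset.smul_sum]
  exact Finset.sum_comm

lemma expect_const (Θ : Param n) (c : V) : expect Θ (fun _ => c) = c := by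
  simp only [expect, ← Finset.sum_smul, ← Finset.sum_div]
  rw [div_self (sum_weight_pos Θ).ne', one_smul]

lemma expect_mul_left {A : Type*} [Ring A] [Algebra ℝ A] (Θ : Param n) (c : A)
    (f : AdjArray n → A) : expect Θ (fun g => c * f g) = c * expect Θ f := by
  simp [expect, Finset.mul_sum]

lemma expect_mul_right {A : Type*} [Ring A] [Algebra ℝ A] (Θ : Param n) (c : A)
    (f : AdjArray n → A) : expect Θ (fun g => f g * c) = expect Θ f * c := by
  simp [expect, Finset.sum_mul]

lemma prob_nonneg (Θ : Param n) (g : AdjArray n) :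
    0 ≤ weight Θ g / ∑ g' ∈ graphs n, weight Θ g' :=
  div_nonneg (weight_pos Θ g).le (sum_weight_pos Θ).le

lemma expect_mono (Θ : Param n) {f h : AdjArray n → ℝ} (hfh : ∀ g ∈ graphs n, f g ≤ h g) :
    expect Θ f ≤ expect Θ h := by
  simp only [expect, smul_eq_mul]
  exact Finset.sum_le_sum fun g hg => mul_le_mul_of_nonneg_left (hfh g hg) (prob_nonneg Θ g)

lemma expect_nonneg (Θ : Param n) {f : AdjArray n → ℝ} (hf : ∀ g, 0 ≤ f g) :
    0 ≤ expect Θ f := by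
  simpa [expect_const] using expect_mono Θ (f := fun _ => (0 : ℝ)) (fun g _ => hf g)

lemma expect_congr (Θ : Param n) {f h : AdjArray n → V} (hfh : ∀ g ∈ graphs n, f g = h g) :
    expect Θ f = expect Θ h :=
  Finset.sum_congr rfl fun g hg => by rw [hfh g hg]

lemma norm_expect_le {W : Type*} [NormedAddCommGroup W] [NormedSpace ℝ W] (Θ : Param n)
    (f : AdjArray n → W) : ‖expect Θ f‖ ≤ expect Θ (fun g => ‖f g‖) := by
  simp only [expect, smul_eq_mul]
  refine (norm_sum_le _ _).trans (Finset.sum_le_sum fun g _ => ?_)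
  rw [norm_smul, Real.norm_of_nonneg (prob_nonneg Θ g)]

/-- The tower property: `resample` is conditional expectation given all other dyads. -/
lemma expect_resample (Θ : Param n) {i t : Fin n} (h : i ≠ t) (f : AdjArray n → V) :
    expect Θ (resample Θ i t f) = expect Θ f := by
  have hf : ∀ g, f g = ∑ s : Fin 2 × Fin 2, dyadProb Θ i t s.1 s.2 • f g := by
    intro g
    rw [← Finset.sum_smul, Fintype.sum_prod_type, sum_dyadProb, one_smul]
  have hr : ∀ g, resample Θ i t f g
      = ∑ s : Fin 2 × Fin 2, dyadProb Θ i t s.1 s.2 • f (setDyad g i t s.1 s.2) := by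
    intro g; rw [resample, Fintype.sum_prod_type]
  simp only [expect]
  simp_rw [hr, Finset.smul_sum]
  conv_rhs => enter [2, g]; rw [hf g, Finset.smul_sum]
  rw [← Finset.sum_product', ← Finset.sum_product']
  -- Exchanging the fresh dyad value with the present one is an involution on pairs (graph, value),
  -- and it preserves the joint weight by detailed balance.
  refine Finset.sum_nbij' (fun x => (setDyad x.1 i t x.2.1 x.2.2, (x.1 i t, x.1 t i)))
    (fun x => (setDyad x.1 i t x.2.1 x.2.2, (x.1 i t, x.1 t i))) ?_ ?_ ?_ ?_ ?_
  · rintro ⟨g, s⟩ hg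
    simp only [Finset.mem_product, Finset.mem_univ, and_true] at hg ⊢
    exact setDyad_mem_graphs hg h _ _
  · rintro ⟨g, s⟩ hg
    simp only [Finset.mem_product, Finset.mem_univ, and_true] at hg ⊢
    exact setDyad_mem_graphs hg h _ _
  · rintro ⟨g, s⟩ _
    simp [setDyad_setDyad, setDyad_self, setDyad_apply_left, setDyad_apply_right g h]
  · rintro ⟨g, s⟩ _
    simp [setDyad_setDyad, setDyad_self, setDyad_apply_left, setDyad_apply_right g h]
  · rintro ⟨g, s⟩ hg
    simp only [Finset.mem_product, Finset.mem_univ, and_true] at hg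
    simp only [smul_smul]
    congr 1
    rw [div_mul_eq_mul_div, div_mul_eq_mul_div, weight_setDyad_mul Θ hg h]

lemma resample_comm_nodes (Θ : Param n) {i t : Fin n} (h : i ≠ t) (f : AdjArray n → V) :
    resample Θ i t f = resample Θ t i f := by
  funext g
  simp only [resample]
  rw [Finset.sum_comm]
  refine Finset.sum_congr rfl fun b _ => Finset.sum_congr rfl fun a _ => ?_
  rw [dyadProb_comm, setDyad_comm g h]

lemma free_resample (Θ : Param n) (i t : Fin n) (f : AdjArray n → V) :
    Free (resample Θ i t f) i t := by
  intro g a b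
  simp only [resample, setDyad_setDyad]

lemma resample_mul_free {A : Type*} [Ring A] [Algebra ℝ A] (Θ : Param n) {i t : Fin n}
    {h : AdjArray n → A} (hh : Free h i t) (f : AdjArray n → A) :
    resample Θ i t (fun g => f g * h g) = fun g => resample Θ i t f g * h g := by
  funext g
  simp only [resample, hh g, Finset.sum_mul, smul_mul_assoc]

lemma free_const {W : Type*} (c : W) (i t : Fin n) : Free (fun _ : AdjArray n => c) i t :=
  fun _ _ _ => rfl

lemma Free.comp {W W' : Type*} {f : AdjArray n → W} {i t : Fin n} (F : W → W')
    (hf : Free f i t) : Free (fun g => F (f g)) i t :=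
  fun g a b => by simp only [hf g a b]

lemma Free.comp₂ {W W' W'' : Type*} {f : AdjArray n → W} {h : AdjArray n → W'} {i t : Fin n}
    (F : W → W' → W'') (hf : Free f i t) (hh : Free h i t) : Free (fun g => F (f g) (h g)) i t :=
  fun g a b => by simp only [hf g a b, hh g a b]

lemma Free.prod {ι W : Type*} [CommMonoid W] {s : Finset ι} {f : ι → AdjArray n → W}
    {i t : Fin n} (hf : ∀ k ∈ s, Free (f k) i t) : Free (fun g => ∏ k ∈ s, f k g) i t :=
  fun g a b => Finset.prod_congr rfl fun k hk => hf k hk g a b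

/-- The orthogonality behind every second moment bound: averaging over one dyad first kills `f`
while `h` acts as a constant. -/
lemma expect_mul_eq_zero (Θ : Param n) {i t : Fin n} (hit : i ≠ t) {f h : AdjArray n → ℝ}
    (hf : resample Θ i t f = 0) (hh : Free h i t) : expect Θ (fun g => f g * h g) = 0 := by
  rw [← expect_resample Θ hit, resample_mul_free Θ hh, hf]
  simpa using expect_const Θ (0 : ℝ)

/-! ### Functions of a single dyad -/

lemma free_apply {W : Type*} (F : Fin 2 → Fin 2 → W) {i t k l : Fin n}
    (h : ¬ (k = i ∧ l = t)) (h' : ¬ (k = t ∧ l = i)) : Free (fun g => F (g k l) (g l k)) i t := by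
  intro g a b
  simp only [setDyad]
  rw [if_neg h, if_neg h', if_neg (fun e => h' ⟨e.2, e.1⟩), if_neg (fun e => h ⟨e.2, e.1⟩)]

lemma resample_apply (Θ : Param n) (F : Fin 2 → Fin 2 → V) {i t : Fin n} (h : i ≠ t) :
    resample Θ i t (fun g => F (g i t) (g t i))
      = fun _ => ∑ a, ∑ b, dyadProb Θ i t a b • F a b := by
  funext g
  simp only [resample, setDyad_apply_left, setDyad_apply_right g h]

lemma expect_apply (Θ : Param n) (F : Fin 2 → Fin 2 → V) {i t : Fin n} (h : i ≠ t) :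
    expect Θ (fun g => F (g i t) (g t i)) = ∑ a, ∑ b, dyadProb Θ i t a b • F a b := by
  rw [← expect_resample Θ h, resample_apply Θ F h, expect_const]

/-- Distinct dyads are independent. -/
lemma expect_prod_dyads {A : Type*} [CommRing A] [Algebra ℝ A] (Θ : Param n)
    (F : Fin n × Fin n → Fin 2 → Fin 2 → A) {s : Finset (Fin n × Fin n)} (hs : s ⊆ dyads n) :
    expect Θ (fun g => ∏ p ∈ s, F p (g p.1 p.2) (g p.2 p.1))
      = ∏ p ∈ s, ∑ a, ∑ b, dyadProb Θ p.1 p.2 a b • F p a b := by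
  induction s using Finset.induction_on with
  | empty => simpa using expect_const Θ (1 : A)
  | insert p s hp ih =>
    have hpd : p.1 < p.2 := mem_dyads.1 (hs (Finset.mem_insert_self p s))
    simp only [Finset.prod_insert hp]
    rw [← ih (fun q hq => hs (Finset.mem_insert_of_mem hq)), ← expect_resample Θ hpd.ne,
      resample_mul_free, resample_apply Θ _ hpd.ne, expect_mul_left]
    refine Free.prod fun q hq => free_apply (F q) ?_ ?_
    · rintro ⟨h1, h2⟩; exact hp ((Prod.ext h1 h2 : q = p) ▸ hq)
    · rintro ⟨h1, h2⟩
      have : q.1 < q.2 := mem_dyads.1 (hs (Finset.mem_insert_of_mem hq))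
      rw [h1, h2] at this
      exact lt_asymm this hpd

end Expect

/-! ### Second moments of sums of centred monomials -/

/-- Expand the square. If some node w of τ' lies neither in `F` nor among the nodes of τ, then M τ'
is centred on a dyad at w which M τ does not see, and the cross term vanishes. So each τ has at most
`K` partners. The nodes in `F` are held fixed throughout the sum and need no match. -/
lemma expect_sq_sum_le {n : ℕ} (Θ : Param n) {T : Type*} [Fintype T] (M : T → AdjArray n → ℝ)
    (nodes : T → Finset (Fin n)) (F : Finset (Fin n)) {c : ℝ} (hc : 0 ≤ c) {K : ℕ}
    (hfree : ∀ τ u v, u ≠ v → u ∉ nodes τ → u ∉ F → Free (M τ) u v)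
    (hzero : ∀ τ, M τ = 0 ∨ ∀ w ∈ nodes τ, w ∉ F → ∃ v, v ≠ w ∧ resample Θ w v (M τ) = 0)
    (hbound : ∀ τ g, |M τ g| ≤ c)
    (hcount : ∀ τ, (Finset.univ.filter fun τ' => nodes τ' ⊆ nodes τ ∪ F).card ≤ K) :
    expect Θ (fun g => (∑ τ, M τ g) ^ 2) ≤ K * c ^ 2 * Fintype.card T := by
  classical
  have hcov : ∀ τ τ', expect Θ (fun g => M τ g * M τ' g)
      ≤ if nodes τ' ⊆ nodes τ ∪ F then c ^ 2 else 0 := by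
    intro τ τ'
    split_ifs with h
    · rw [← expect_const Θ (c ^ 2)]
      refine expect_mono Θ fun g _ => (le_abs_self _).trans ?_
      rw [abs_mul, sq]
      exact mul_le_mul (hbound τ g) (hbound τ' g) (abs_nonneg _) hc
    · rcases hzero τ' with h0 | h0
      · simp [h0, expect_const Θ (0 : ℝ)]
      · obtain ⟨w, hw, hw'⟩ := Finset.not_subset.1 h
        simp only [Finset.mem_union, not_or] at hw'
        obtain ⟨v, hv, hres⟩ := h0 w hw hw'.2
        have := expect_mul_eq_zero Θ hv.symm hres (hfree τ w v hv.symm hw'.1 hw'.2)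
        simp only [mul_comm] at this ⊢
        exact this.le
  calc expect Θ (fun g => (∑ τ, M τ g) ^ 2)
      = ∑ τ, ∑ τ', expect Θ (fun g => M τ g * M τ' g) := by
        simp_rw [sq, Finset.sum_mul_sum, expect_sum]
    _ ≤ ∑ τ : T, ∑ τ', if nodes τ' ⊆ nodes τ ∪ F then c ^ 2 else 0 :=
        Finset.sum_le_sum fun τ _ => Finset.sum_le_sum fun τ' _ => hcov τ τ'
    _ ≤ ∑ τ : T, K * c ^ 2 := by
        refine Finset.sum_le_sum fun τ _ => ?_
        rw [← Finset.sum_filter, Finset.sum_const, nsmul_eq_mul]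
        exact mul_le_mul_of_nonneg_right (by exact_mod_cast hcount τ) (sq_nonneg c)
    _ = K * c ^ 2 * Fintype.card T := by
        rw [Finset.sum_const, nsmul_eq_mul, Finset.card_univ]; ring

/-! ### The bounded differences inequality -/

/-- Hoeffding's lemma: on [-c, c] the exponential lies below its chord, whose mean under a centred
law is cosh c ≤ exp(c²/2). The slope of the chord divides by c, so c = 0 is treated apart. -/
lemma sum_mul_exp_le {ι : Type*} (s : Finset ι) (w y : ι → ℝ) (hw : ∀ k ∈ s, 0 ≤ w k)
    (hw1 : ∑ k ∈ s, w k = 1) (hy0 : ∑ k ∈ s, w k * y k = 0) {c : ℝ}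
    (hy : ∀ k ∈ s, |y k| ≤ c) : ∑ k ∈ s, w k * Real.exp (y k) ≤ Real.exp (c ^ 2 / 2) := by
  have hc : 0 ≤ c := by
    by_contra hneg
    have : s = ∅ := Finset.eq_empty_of_forall_notMem fun k hk =>
      hneg ((abs_nonneg _).trans (hy k hk))
    simp [this] at hw1
  rcases hc.eq_or_lt with rfl | hc
  · refine le_of_eq ?_
    rw [show Real.exp ((0 : ℝ) ^ 2 / 2) = 1 by simp, ← hw1]
    refine Finset.sum_congr rfl fun k hk => ?_
    rw [abs_nonpos_iff.1 (hy k hk), Real.exp_zero, mul_one]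
  · have key : ∀ k ∈ s, Real.exp (y k) ≤ Real.cosh c + y k * (Real.sinh c / c) := by
      intro k hk
      have h := abs_le.1 (hy k hk)
      have h1 : -1 ≤ y k / c := by rw [le_div_iff₀ hc]; linarith
      have h2 : y k / c ≤ 1 := by rw [div_le_iff₀ hc]; linarith
      have hconv := convexOn_exp.2
      have hconv := @hconv c (Set.mem_univ c) (-c) (Set.mem_univ (-c)) ((1 + y k / c) / 2)
        ((1 - y k / c) / 2) (by linarith) (by linarith) (by ring)
      simp only [smul_eq_mul] at hconv
      rw [show (1 + y k / c) / 2 * c + (1 - y k / c) / 2 * -c = y k by field_simp; ring] at hconv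
      refine hconv.trans (le_of_eq ?_)
      rw [Real.cosh_eq, Real.sinh_eq]
      field_simp; ring
    calc ∑ k ∈ s, w k * Real.exp (y k)
        ≤ ∑ k ∈ s, w k * (Real.cosh c + y k * (Real.sinh c / c)) :=
          Finset.sum_le_sum fun k hk => mul_le_mul_of_nonneg_left (key k hk) (hw k hk)
      _ = (∑ k ∈ s, w k) * Real.cosh c + (∑ k ∈ s, w k * y k) * (Real.sinh c / c) := by
          rw [Finset.sum_mul, Finset.sum_mul, ← Finset.sum_add_distrib]
          exact Finset.sum_congr rfl fun k _ => by ring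
      _ = Real.cosh c := by rw [hw1, hy0]; ring
      _ ≤ _ := Real.cosh_le_exp_half_sq c

section McDiarmid

variable {n : ℕ} (Θ : Param n)

/-- Hoeffding's lemma conditionally on all other dyads. An oscillation of at most c is used only
through |f - m| ≤ c, which is where the optimal constant is lost. -/
lemma resample_exp_le {i t : Fin n} {f : AdjArray n → ℝ} {c l : ℝ} (g : AdjArray n)
    (hf : ∀ a b a' b', |f (setDyad g i t a b) - f (setDyad g i t a' b')| ≤ c) :
    resample Θ i t (fun g => Real.exp (l * f g)) g
      ≤ Real.exp (l ^ 2 * c ^ 2 / 2) * Real.exp (l * resample Θ i t f g) := by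
  set m := resample Θ i t f g with hm
  have hmean : m = ∑ s : Fin 2 × Fin 2, dyadProb Θ i t s.1 s.2 * f (setDyad g i t s.1 s.2) := by
    rw [hm, resample, Fintype.sum_prod_type]; rfl
  have h1 : ∑ s : Fin 2 × Fin 2, dyadProb Θ i t s.1 s.2 = 1 := by
    rw [Fintype.sum_prod_type, sum_dyadProb]
  have key := sum_mul_exp_le Finset.univ (fun s : Fin 2 × Fin 2 => dyadProb Θ i t s.1 s.2)
    (fun s => l * (f (setDyad g i t s.1 s.2) - m)) (c := |l| * c)
    (fun s _ => (dyadProb_pos Θ i t s.1 s.2).le) h1 ?_ ?_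
  · rw [mul_pow, sq_abs] at key
    calc resample Θ i t (fun g => Real.exp (l * f g)) g
        = (∑ s : Fin 2 × Fin 2, dyadProb Θ i t s.1 s.2 *
            Real.exp (l * (f (setDyad g i t s.1 s.2) - m))) * Real.exp (l * m) := by
          rw [resample, Finset.sum_mul, Fintype.sum_prod_type]
          refine Finset.sum_congr rfl fun a _ => Finset.sum_congr rfl fun b _ => ?_
          rw [mul_assoc, ← Real.exp_add, smul_eq_mul]
          congr 2; ring
      _ ≤ _ := mul_le_mul_of_nonneg_right key (Real.exp_pos _).le
  · have : ∀ s : Fin 2 × Fin 2, dyadProb Θ i t s.1 s.2 * (l * (f (setDyad g i t s.1 s.2) - m))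
        = l * (dyadProb Θ i t s.1 s.2 * f (setDyad g i t s.1 s.2))
          - l * (dyadProb Θ i t s.1 s.2 * m) := fun s => by ring
    simp_rw [this]
    rw [Finset.sum_sub_distrib, ← Finset.mul_sum, ← Finset.mul_sum, ← Finset.sum_mul, ← hmean, h1]
    ring
  · intro s _
    rw [abs_mul]
    refine mul_le_mul_of_nonneg_left ?_ (abs_nonneg _)
    have : f (setDyad g i t s.1 s.2) - m = ∑ s' : Fin 2 × Fin 2, dyadProb Θ i t s'.1 s'.2 *
        (f (setDyad g i t s.1 s.2) - f (setDyad g i t s'.1 s'.2)) := by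
      simp_rw [mul_sub]
      rw [Finset.sum_sub_distrib, ← Finset.sum_mul, h1, ← hmean, one_mul]
    rw [this]
    refine (Finset.abs_sum_le_sum_abs _ _).trans ?_
    calc _ ≤ ∑ s' : Fin 2 × Fin 2, dyadProb Θ i t s'.1 s'.2 * c := by
          refine Finset.sum_le_sum fun s' _ => ?_
          rw [abs_mul, abs_of_pos (dyadProb_pos Θ i t s'.1 s'.2)]
          exact mul_le_mul_of_nonneg_left (hf _ _ _ _) (dyadProb_pos Θ i t s'.1 s'.2).le
      _ = c := by rw [← Finset.sum_mul, h1, one_mul]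

/-- The dyads of g are replaced by those of h one at a time. With s = `dyads n` this makes a
statistic that is free of every dyad constant on `graphs n`. -/
lemma eq_of_free {W : Type*} {f : AdjArray n → W} (s : Finset (Fin n × Fin n))
    (hs : s ⊆ dyads n) (hf : ∀ p ∈ s, Free f p.1 p.2) {g h : AdjArray n} (hg : g ∈ graphs n)
    (hh : h ∈ graphs n)
    (hgh : ∀ p ∈ dyads n, p ∉ s → g p.1 p.2 = h p.1 p.2 ∧ g p.2 p.1 = h p.2 p.1) : f g = f h := by
  classical
  induction s using Finset.induction_on generalizing g with
  | empty =>
    congr 1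
    funext i j
    simp only [graphs, Finset.mem_filter, Finset.mem_univ, true_and] at hg hh
    rcases lt_trichotomy i j with hij | rfl | hij
    · exact (hgh (i, j) (mem_dyads.2 hij) (by simp)).1
    · rw [hg, hh]
    · exact (hgh (j, i) (mem_dyads.2 hij) (by simp)).2
  | insert p s hp ih =>
    have hpd : p.1 < p.2 := mem_dyads.1 (hs (Finset.mem_insert_self p s))
    rw [← hf p (Finset.mem_insert_self p s) g (h p.1 p.2) (h p.2 p.1)]
    refine ih (fun q hq => hs (Finset.mem_insert_of_mem hq))
      (fun q hq => hf q (Finset.mem_insert_of_mem hq)) (setDyad_mem_graphs hg hpd.ne _ _) ?_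
    intro q hq hqs
    by_cases hqp : q = p
    · subst hqp
      exact ⟨setDyad_apply_left _ _ _ _ _, setDyad_apply_right _ hpd.ne _ _⟩
    · have hqd := mem_dyads.1 hq
      have := hgh q hq (by simp [hqp, hqs])
      have hfree := free_apply (n := n) (fun a b => (a, b)) (i := p.1) (t := p.2) (k := q.1)
        (l := q.2) (fun e => hqp (Prod.ext e.1 e.2))
        (fun e => by rw [e.1, e.2] at hqd; exact lt_asymm hqd hpd) g (h p.1 p.2) (h p.2 p.1)
      rw [Prod.mk.injEq] at hfree
      exact ⟨hfree.1.trans this.1, hfree.2.trans this.2⟩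

lemma free_resample_of_free {W : Type*} [AddCommGroup W] [Module ℝ W] {f : AdjArray n → W}
    {p q : Fin n × Fin n} (hp : p.1 < p.2) (hq : q.1 < q.2) (hf : Free f q.1 q.2) :
    Free (resample Θ p.1 p.2 f) q.1 q.2 := by
  by_cases h : p = q
  · subst h; exact free_resample Θ _ _ f
  · intro g a b
    simp only [resample]
    refine Finset.sum_congr rfl fun a' _ => Finset.sum_congr rfl fun b' _ => ?_
    have : setDyad (setDyad g q.1 q.2 a b) p.1 p.2 a' b'
        = setDyad (setDyad g p.1 p.2 a' b') q.1 q.2 a b := by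
      have hne : ¬ (p.1 = q.1 ∧ p.2 = q.2) := fun e => h (Prod.ext e.1 e.2)
      funext k l
      simp only [setDyad]
      split_ifs <;> first | rfl | (exfalso; grind)
    rw [this, hf]

/-- The martingale argument, as an induction on the set `s` of dyads on which f may still depend.
Replacing f by its average over one dyad keeps the mean and all difference bounds, removes that dyad
from `s`, and costs one Hoeffding factor. -/
lemma expect_exp_le {c : Fin n × Fin n → ℝ} (l : ℝ) (s : Finset (Fin n × Fin n))
    (hs : s ⊆ dyads n) {f : AdjArray n → ℝ}
    (hf : ∀ p ∈ dyads n, ∀ g a b, |f (setDyad g p.1 p.2 a b) - f g| ≤ c p)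
    (hfree : ∀ p ∈ dyads n, p ∉ s → Free f p.1 p.2) :
    expect Θ (fun g => Real.exp (l * f g))
      ≤ Real.exp (l ^ 2 * (∑ p ∈ s, c p ^ 2) / 2) * Real.exp (l * expect Θ f) := by
  classical
  induction s using Finset.induction_on generalizing f with
  | empty =>
    have hconst : ∀ g ∈ graphs n, f g = f 0 := fun g hg =>
      eq_of_free (dyads n) subset_rfl (fun p hp => hfree p hp (by simp)) hg zero_mem_graphs
        (fun p hp hp' => absurd hp hp')
    rw [expect_congr Θ hconst, expect_const, expect_congr Θ (f := fun g => Real.exp (l * f g))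
      (h := fun _ => Real.exp (l * f 0)) (fun g hg => by rw [hconst g hg]), expect_const]
    simp
  | insert p s hp ih =>
    have hpm := hs (Finset.mem_insert_self p s)
    have hpd : p.1 < p.2 := mem_dyads.1 hpm
    have ih' := ih (f := resample Θ p.1 p.2 f) (fun q hq => hs (Finset.mem_insert_of_mem hq)) ?_ ?_
    · rw [expect_resample Θ hpd.ne] at ih'
      rw [← expect_resample Θ hpd.ne]
      calc expect Θ (resample Θ p.1 p.2 fun g => Real.exp (l * f g))
          ≤ expect Θ (fun g => Real.exp (l ^ 2 * c p ^ 2 / 2) *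
              Real.exp (l * resample Θ p.1 p.2 f g)) := by
            refine expect_mono Θ fun g _ => resample_exp_le Θ g ?_
            intro a b a' b'
            have := hf p hpm (setDyad g p.1 p.2 a' b') a b
            rwa [setDyad_setDyad] at this
        _ ≤ Real.exp (l ^ 2 * c p ^ 2 / 2) * (Real.exp (l ^ 2 * (∑ p ∈ s, c p ^ 2) / 2) *
              Real.exp (l * expect Θ f)) := by
            rw [expect_mul_left]
            exact mul_le_mul_of_nonneg_left ih' (Real.exp_pos _).le
        _ = _ := by
            rw [← mul_assoc, ← Real.exp_add, Finset.sum_insert hp]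
            congr 2; ring
    · intro q hq g a b
      by_cases hqp : q = p
      · subst hqp
        rw [free_resample Θ _ _ f g a b, sub_self, abs_zero]
        exact (abs_nonneg _).trans (hf q hq g a b)
      · have hqd := mem_dyads.1 hq
        have hcomm : ∀ a' b', setDyad (setDyad g q.1 q.2 a b) p.1 p.2 a' b'
            = setDyad (setDyad g p.1 p.2 a' b') q.1 q.2 a b := by
          intro a' b'
          have hne : ¬ (q.1 = p.1 ∧ q.2 = p.2) := fun e => hqp (Prod.ext e.1 e.2)
          funext k l
          simp only [setDyad]
          split_ifs <;> first | rfl | (exfalso; grind)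
        simp only [resample, hcomm]
        rw [← Finset.sum_sub_distrib]
        simp only [← Finset.sum_sub_distrib, smul_eq_mul]
        refine (Finset.abs_sum_le_sum_abs _ _).trans ?_
        calc _ ≤ ∑ a', ∑ b', dyadProb Θ p.1 p.2 a' b' * c q := by
              refine Finset.sum_le_sum fun a' _ => (Finset.abs_sum_le_sum_abs _ _).trans ?_
              refine Finset.sum_le_sum fun b' _ => ?_
              rw [← mul_sub, abs_mul, abs_of_pos (dyadProb_pos Θ _ _ _ _)]
              exact mul_le_mul_of_nonneg_left (hf q hq _ _ _) (dyadProb_pos Θ _ _ _ _).le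
          _ = c q := by
              simp_rw [← Finset.sum_mul]
              rw [sum_dyadProb, one_mul]
    · intro q hq hqs
      by_cases hqp : q = p
      · subst hqp; exact free_resample Θ _ _ f
      · exact free_resample_of_free Θ hpd (mem_dyads.1 hq) (hfree q hq (by simp [hqp, hqs]))

/-- McDiarmid's inequality for the `p₁` model (with a non-optimal constant). -/
lemma expect_indicator_le {c : Fin n × Fin n → ℝ} {f : AdjArray n → ℝ} {v δ : ℝ} (hv : 0 < v)
    (hδ : 0 ≤ δ) (hf : ∀ p ∈ dyads n, ∀ g a b, |f (setDyad g p.1 p.2 a b) - f g| ≤ c p)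
    (hcv : ∑ p ∈ dyads n, c p ^ 2 ≤ v) :
    expect Θ (fun g => if δ ≤ |f g - expect Θ f| then 1 else 0)
      ≤ 2 * Real.exp (-(δ ^ 2 / (2 * v))) := by
  set m := expect Θ f with hm
  have h1 : ∀ l : ℝ, expect Θ (fun g => Real.exp (l * f g)) * Real.exp (-(l * m))
      ≤ Real.exp (l ^ 2 * v / 2) := by
    intro l
    have h := expect_exp_le Θ l (dyads n) subset_rfl hf (fun p hp hp' => absurd hp hp')
    calc _ ≤ Real.exp (l ^ 2 * (∑ p ∈ dyads n, c p ^ 2) / 2) * Real.exp (l * m)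
            * Real.exp (-(l * m)) := mul_le_mul_of_nonneg_right h (Real.exp_pos _).le
      _ = Real.exp (l ^ 2 * (∑ p ∈ dyads n, c p ^ 2) / 2) := by
          rw [mul_assoc, ← Real.exp_add, add_neg_cancel, Real.exp_zero, mul_one]
      _ ≤ _ := by
          refine Real.exp_le_exp.2 ?_
          have := mul_le_mul_of_nonneg_left hcv (sq_nonneg l)
          linarith
  -- The minimiser of l²v/2 - lδ in the Chernoff bound.
  set L := δ / v with hL
  have hL0 : 0 ≤ L := div_nonneg hδ hv.le
  have key : ∀ g, (if δ ≤ |f g - m| then (1 : ℝ) else 0)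
      ≤ Real.exp (L * f g) * Real.exp (-(L * m)) * Real.exp (-(L * δ))
        + Real.exp ((-L) * f g) * Real.exp (-((-L) * m)) * Real.exp (-(L * δ)) := by
    intro g
    split_ifs with h
    · rw [← Real.exp_add, ← Real.exp_add, ← Real.exp_add, ← Real.exp_add]
      rcases le_abs.1 h with h | h
      · have : (1 : ℝ) ≤ Real.exp (L * f g + -(L * m) + -(L * δ)) := by
          rw [Real.one_le_exp_iff]
          nlinarith
        linarith [Real.exp_pos (-L * f g + -(-L * m) + -(L * δ))]
      · have : (1 : ℝ) ≤ Real.exp (-L * f g + -(-L * m) + -(L * δ)) := by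
          rw [Real.one_le_exp_iff]
          nlinarith
        linarith [Real.exp_pos (L * f g + -(L * m) + -(L * δ))]
    · positivity
  refine (expect_mono Θ fun g _ => key g).trans ?_
  rw [expect_add, expect_mul_right, expect_mul_right, expect_mul_right, expect_mul_right]
  have e : Real.exp (L ^ 2 * v / 2) * Real.exp (-(L * δ)) = Real.exp (-(δ ^ 2 / (2 * v))) := by
    rw [← Real.exp_add]; congr 1; rw [hL]; field_simp; ring
  have h2 := mul_le_mul_of_nonneg_right (h1 L) (Real.exp_pos (-(L * δ))).le
  have h3 := mul_le_mul_of_nonneg_right (h1 (-L)) (Real.exp_pos (-(L * δ))).le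
  rw [neg_sq] at h3
  rw [e] at h2 h3
  linarith

end McDiarmid

/-! ### Dyad indicators and triple-dyad averages -/

section Indicators

variable {n : ℕ}

lemma ind_comm (g : AdjArray n) (i j : Fin n) (a b : Fin 2) : ind g i j a b = ind g j i b a := by
  simp [ind, and_comm]

lemma ind_nonneg (g : AdjArray n) (i j : Fin n) (a b : Fin 2) : 0 ≤ ind g i j a b := by
  unfold ind; split_ifs <;> norm_num

lemma ind_le_one (g : AdjArray n) (i j : Fin n) (a b : Fin 2) : ind g i j a b ≤ 1 := by
  unfold ind; split_ifs <;> norm_num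

lemma free_ind (a b : Fin 2) {i t k l : Fin n}
    (h : ¬ (k = i ∧ l = t)) (h' : ¬ (k = t ∧ l = i)) : Free (fun g => ind g k l a b) i t :=
  free_apply (fun x y => if x = a ∧ y = b then (1 : ℝ) else 0) h h'

lemma resample_ind (Θ : Param n) {i t : Fin n} (h : i ≠ t) (a b : Fin 2) :
    resample Θ i t (fun g => ind g i t a b) = fun _ => dyadProb Θ i t a b := by
  have := resample_apply Θ (fun x y => if x = a ∧ y = b then (1 : ℝ) else 0) h
  refine this.trans ?_
  funext _
  rw [Finset.sum_eq_single a, Finset.sum_eq_single b]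
  · simp
  · intro b' _ hb; simp [hb]
  · simp
  · intro a' _ ha; simp [ha]
  · simp

lemma expect_ind_mul (Θ : Param n) {i t : Fin n} (h : i ≠ t) (a b : Fin 2) {f : AdjArray n → ℝ}
    (hf : Free f i t) :
    expect Θ (fun g => ind g i t a b * f g) = dyadProb Θ i t a b * expect Θ f := by
  rw [← expect_resample Θ h, resample_mul_free Θ hf, resample_ind Θ h, expect_mul_left]

lemma expect_ind (Θ : Param n) {i t : Fin n} (h : i ≠ t) (a b : Fin 2) :
    expect Θ (fun g => ind g i t a b) = dyadProb Θ i t a b := by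
  rw [← expect_resample Θ h, resample_ind Θ h, expect_const]

/-- The triangle counts in θ̂ and ρ̂ are closed paths, so a single concentration event for path
averages serves all four estimators. -/
lemma pathSum_self (F : Fin n → Fin n → Fin 2 → Fin 2 → ℝ) (a b c : Fin 2) (t : Fin n) :
    pathSum F a b c t t = tripleSum F a b c t := by
  simp [pathSum, tripleSum]

/-- The normalised path sum. -/
def pathAvg (F : Fin n → Fin n → Fin 2 → Fin 2 → ℝ) (a b c : Fin 2) (i t : Fin n) : ℝ :=
  1 / (n : ℝ) ^ 2 * pathSum F a b c i t

lemma mu_eq_pathAvg (Θ : Param n) (a b c : Fin 2) (t : Fin n) :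
    mu Θ a b c t = pathAvg (dyadProb Θ) a b c t t := by
  rw [mu, pathAvg, pathSum_self]

/-- The dyads {k,i}, {k,l}, {t,l} are distinct even when i = t, so the three indicators are
independent. -/
lemma expect_pathAvg (Θ : Param n) (a b c : Fin 2) (i t : Fin n) :
    expect Θ (fun g => pathAvg (ind g) a b c i t) = pathAvg (dyadProb Θ) a b c i t := by
  simp only [pathAvg, pathSum]
  rw [expect_mul_left, expect_sum]
  congr 1
  refine Finset.sum_congr rfl fun k hk => ?_
  rw [expect_sum]
  refine Finset.sum_congr rfl fun l hl => ?_
  simp only [Finset.mem_compl, Finset.mem_insert, Finset.mem_singleton, not_or] at hk hl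
  obtain ⟨hki, hkt⟩ := hk
  obtain ⟨hli, hlt, hlk⟩ := hl
  simp only [mul_assoc]
  rw [expect_ind_mul Θ hki, expect_ind_mul Θ (Ne.symm hlk), expect_ind Θ (Ne.symm hlt)]
  · exact free_ind _ _ (fun e => hkt e.1.symm) (fun e => hlk e.2)
  · exact (free_ind _ _ (fun e => hli e.2) (fun e => hki e.1)).comp₂ (· * ·)
      (free_ind _ _ (fun e => hli e.2) (fun e => hlk e.2))

lemma card_compl_insert_le (s : Finset (Fin n)) : (n : ℝ) - s.card ≤ (sᶜ).card := by
  have := Finset.card_add_card_compl s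
  rw [Fintype.card_fin] at this
  have h : ((s.card : ℝ) + (sᶜ).card) = n := by exact_mod_cast this
  linarith

lemma le_pathAvg {m : ℝ} (hm : 0 < m) (hn : 4 ≤ n) {F : Fin n → Fin n → Fin 2 → Fin 2 → ℝ}
    (hF : ∀ i j a b, m ≤ F i j a b) (a b c : Fin 2) (i t : Fin n) :
    m ^ 3 / 8 ≤ pathAvg F a b c i t := by
  have hn' : (4 : ℝ) ≤ n := by exact_mod_cast hn
  have h1 : ((n : ℝ) - 2) * (((n : ℝ) - 3) * m ^ 3) ≤ pathSum F a b c i t := by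
    have hin : ∀ k, ((n : ℝ) - 3) * m ^ 3
        ≤ ∑ l ∈ ({i, t, k}ᶜ : Finset (Fin n)), F k i c a * F k l c b * F t l c a := by
      intro k
      calc ((n : ℝ) - 3) * m ^ 3 ≤ (({i, t, k}ᶜ : Finset (Fin n)).card : ℝ) * m ^ 3 := by
            refine mul_le_mul_of_nonneg_right ?_ (by positivity)
            have h3 : (({i, t, k} : Finset (Fin n)).card : ℝ) ≤ 3 := by
              exact_mod_cast Finset.card_le_three
            linarith [card_compl_insert_le ({i, t, k} : Finset (Fin n))]
        _ ≤ _ := by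
            rw [← nsmul_eq_mul]
            refine Finset.card_nsmul_le_sum _ _ _ fun l _ => ?_
            calc m ^ 3 = m * m * m := by ring
              _ ≤ _ := by
                have h1 := fun i j a b => hm.le.trans (hF i j a b)
                exact mul_le_mul (mul_le_mul (hF _ _ _ _) (hF _ _ _ _) hm.le (h1 _ _ _ _))
                  (hF _ _ _ _) hm.le (mul_nonneg (h1 _ _ _ _) (h1 _ _ _ _))
    calc ((n : ℝ) - 2) * (((n : ℝ) - 3) * m ^ 3)
        ≤ (({i, t}ᶜ : Finset (Fin n)).card : ℝ) * (((n : ℝ) - 3) * m ^ 3) := by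
          refine mul_le_mul_of_nonneg_right ?_ (mul_nonneg (by linarith) (by positivity))
          have h3 : (({i, t} : Finset (Fin n)).card : ℝ) ≤ 2 := by
            exact_mod_cast Finset.card_le_two
          linarith [card_compl_insert_le ({i, t} : Finset (Fin n))]
      _ ≤ _ := by
          rw [← nsmul_eq_mul]
          exact Finset.card_nsmul_le_sum _ _ _ fun k _ => hin k
  rw [pathAvg, one_div_mul_eq_div, le_div_iff₀ (by positivity)]
  refine le_trans ?_ h1
  -- This is an equality at n = 4, which fixes the constant 1/8.
  have h2 : (n : ℝ) ^ 2 / 8 ≤ ((n : ℝ) - 2) * (n - 3) := by nlinarith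
  have := mul_le_mul_of_nonneg_right h2 (by positivity : 0 ≤ m ^ 3)
  linarith

lemma abs_sum_le_mul {ι : Type*} [Fintype ι] (s : Finset ι) (f : ι → ℝ) {c : ℝ} (hc : 0 ≤ c)
    (h : ∀ i ∈ s, |f i| ≤ c) : |∑ i ∈ s, f i| ≤ Fintype.card ι * c := by
  refine (Finset.abs_sum_le_sum_abs _ _).trans ((Finset.sum_le_card_nsmul s _ c h).trans ?_)
  rw [nsmul_eq_mul]
  exact mul_le_mul_of_nonneg_right (by exact_mod_cast Finset.card_le_univ s) hc

/-- The maximal effect of a dyad on a path average. -/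
def pathInfluence (n : ℕ) (i t : Fin n) (p : Fin n × Fin n) : ℝ :=
  1 / (n : ℝ) ^ 2 * (n * (if p.1 = i then 1 else 0) + n * (if p.2 = i then 1 else 0) + 2
    + n * (if p.1 = t then 1 else 0) + n * (if p.2 = t then 1 else 0))

lemma abs_ind_setDyad_sub_le (g : AdjArray n) (u v k l : Fin n) (a b x y : Fin 2) :
    |ind (setDyad g u v x y) k l a b - ind g k l a b|
      ≤ (if k = u then if l = v then 1 else 0 else 0)
        + (if k = v then if l = u then 1 else 0 else 0) := by
  by_cases h : (k = u ∧ l = v) ∨ (k = v ∧ l = u)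
  · have h1 : |ind (setDyad g u v x y) k l a b - ind g k l a b| ≤ 1 := by
      rw [abs_le]
      constructor <;>
        linarith [ind_nonneg g k l a b, ind_le_one g k l a b,
          ind_nonneg (setDyad g u v x y) k l a b, ind_le_one (setDyad g u v x y) k l a b]
    refine h1.trans ?_
    rcases h with ⟨rfl, rfl⟩ | ⟨rfl, rfl⟩
    · simp; split_ifs <;> norm_num
    · simp; split_ifs <;> norm_num
  · rw [not_or] at h
    have := free_ind a b h.1 h.2 g x y
    simp only at this
    rw [this, sub_self, abs_zero]
    positivity

lemma abs_mul_mul_sub_le {x y z x' y' z' : ℝ} (hx : |x'| ≤ 1) (hy : |y| ≤ 1) (hy' : |y'| ≤ 1)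
    (hz : |z| ≤ 1) : |x * y * z - x' * y' * z'| ≤ |x - x'| + |y - y'| + |z - z'| := by
  have e : x * y * z - x' * y' * z' = (x - x') * (y * z) + (y - y') * (x' * z)
    + (z - z') * (x' * y') := by ring
  rw [e]
  refine (abs_add_three _ _ _).trans ?_
  simp only [abs_mul]
  gcongr
  · exact mul_le_of_le_one_right (abs_nonneg _) (mul_le_one₀ hy (abs_nonneg _) hz)
  · exact mul_le_of_le_one_right (abs_nonneg _) (mul_le_one₀ hx (abs_nonneg _) hz)
  · exact mul_le_of_le_one_right (abs_nonneg _) (mul_le_one₀ hx (abs_nonneg _) hy')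

lemma abs_ind_le_one (g : AdjArray n) (i j : Fin n) (a b : Fin 2) : |ind g i j a b| ≤ 1 :=
  abs_le.2 ⟨by linarith [ind_nonneg g i j a b], ind_le_one g i j a b⟩

/-- A dyad can be the first edge {k,i} only if it ends at i, and then for up to n values of l;
likewise for the last edge and t. It is the middle edge {k,l} for at most two ordered pairs. These
are the five terms of `pathInfluence`. -/
lemma abs_pathAvg_setDyad_sub_le (g : AdjArray n) {p : Fin n × Fin n} (a b c : Fin 2)
    (i t : Fin n) (x y : Fin 2) :
    |pathAvg (ind (setDyad g p.1 p.2 x y)) a b c i t - pathAvg (ind g) a b c i t|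
      ≤ pathInfluence n i t p := by
  obtain ⟨u, v⟩ := p
  simp only
  rw [pathAvg, pathAvg, ← mul_sub, abs_mul, abs_of_nonneg (by positivity), pathInfluence]
  refine mul_le_mul_of_nonneg_left ?_ (by positivity)
  let D : Fin n → Fin n → ℝ := fun k l => (if k = u then if l = v then 1 else 0 else 0)
        + (if k = v then if l = u then 1 else 0 else 0)
  have hD : ∀ k l, 0 ≤ D k l := fun k l => by simp only [D]; positivity
  have hD' : ∀ k l a b, |ind (setDyad g u v x y) k l a b - ind g k l a b| ≤ D k l :=
    fun k l a b => abs_ind_setDyad_sub_le g u v k l a b x y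
  have h1 : |pathSum (ind (setDyad g u v x y)) a b c i t - pathSum (ind g) a b c i t|
      ≤ ∑ k, ∑ l, (D k i + D k l + D t l) := by
    rw [pathSum, pathSum, ← Finset.sum_sub_distrib]
    refine (Finset.abs_sum_le_sum_abs _ _).trans ?_
    refine (Finset.sum_le_sum fun k _ => ?_).trans (Finset.sum_le_sum_of_subset_of_nonneg
      (Finset.subset_univ _) fun k _ _ => Finset.sum_nonneg fun l _ =>
        add_nonneg (add_nonneg (hD _ _) (hD _ _)) (hD _ _))
    rw [← Finset.sum_sub_distrib]
    refine (Finset.abs_sum_le_sum_abs _ _).trans ?_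
    refine (Finset.sum_le_sum fun l _ => ?_).trans (Finset.sum_le_sum_of_subset_of_nonneg
      (Finset.subset_univ _) fun l _ _ => add_nonneg (add_nonneg (hD _ _) (hD _ _)) (hD _ _))
    refine (abs_mul_mul_sub_le (abs_ind_le_one _ _ _ _ _) (abs_ind_le_one _ _ _ _ _)
      (abs_ind_le_one _ _ _ _ _) (abs_ind_le_one _ _ _ _ _)).trans ?_
    exact add_le_add (add_le_add (hD' _ _ _ _) (hD' _ _ _ _)) (hD' _ _ _ _)
  refine h1.trans (le_of_eq ?_)
  simp only [D, Finset.sum_add_distrib, Finset.sum_ite_eq', Finset.mem_univ, if_true,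
    Finset.sum_const, Finset.card_univ, Fintype.card_fin, nsmul_eq_mul, ← Finset.mul_sum,
    Finset.sum_ite_irrel, mul_zero]
  simp only [eq_comm (a := i), eq_comm (a := t)]
  split_ifs <;> ring

/-- The influence is O(1/n) for the O(n) dyads at i or t and O(1/n²) for the O(n²) others, so the
squares sum to O(1/n). -/
lemma sum_pathInfluence_sq_le (hn : 0 < n) (i t : Fin n) :
    ∑ p ∈ dyads n, pathInfluence n i t p ^ 2 ≤ 40 / n := by
  have hn' : (1 : ℝ) ≤ n := by exact_mod_cast hn
  have h1 : ∀ p : Fin n × Fin n, pathInfluence n i t p ^ 2 ≤ 5 / (n : ℝ) ^ 4 *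
      ((n : ℝ) ^ 2 * (if p.1 = i then 1 else 0) + (n : ℝ) ^ 2 * (if p.2 = i then 1 else 0) + 4
    + (n : ℝ) ^ 2 * (if p.1 = t then 1 else 0) + (n : ℝ) ^ 2 * (if p.2 = t then 1 else 0)) := by
    intro p
    have key : ∀ x y z u w : ℝ, (x + y + z + u + w) ^ 2
        ≤ 5 * (x ^ 2 + y ^ 2 + z ^ 2 + u ^ 2 + w ^ 2) := by
      intro x y z u w
      nlinarith [sq_nonneg (x - y), sq_nonneg (x - z), sq_nonneg (x - u), sq_nonneg (x - w),
        sq_nonneg (y - z), sq_nonneg (y - u), sq_nonneg (y - w), sq_nonneg (z - u),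
        sq_nonneg (z - w), sq_nonneg (u - w)]
    rw [pathInfluence, mul_pow]
    refine (mul_le_mul_of_nonneg_left (key _ _ _ _ _) (by positivity)).trans (le_of_eq ?_)
    simp only [mul_pow, ite_pow, one_pow, zero_pow two_ne_zero]
    ring
  calc ∑ p ∈ dyads n, pathInfluence n i t p ^ 2
      ≤ ∑ p : Fin n × Fin n, pathInfluence n i t p ^ 2 :=
        Finset.sum_le_sum_of_subset_of_nonneg (Finset.subset_univ _) fun _ _ _ => sq_nonneg _
    _ ≤ _ := Finset.sum_le_sum fun p _ => h1 p
    _ = 5 / (n : ℝ) ^ 4 * (4 * (n : ℝ) ^ 3 + 4 * (n : ℝ) ^ 2) := by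
        have h2 : ∀ i : Fin n, ∑ p : Fin n × Fin n, (if p.1 = i then (1 : ℝ) else 0) = n := by
          intro i; rw [Fintype.sum_prod_type_right]; simp
        have h3 : ∀ i : Fin n, ∑ p : Fin n × Fin n, (if p.2 = i then (1 : ℝ) else 0) = n := by
          intro i; rw [Fintype.sum_prod_type]; simp
        rw [← Finset.mul_sum]
        congr 1
        simp only [Finset.sum_add_distrib, Finset.sum_const, Finset.card_univ, Fintype.card_prod,
          Fintype.card_fin, nsmul_eq_mul, ← Finset.mul_sum, h2, h3]
        push_cast
        ring
    _ ≤ 40 / n := by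
        rw [div_mul_eq_mul_div, div_le_div_iff₀ (by positivity) (by positivity)]
        have : (n : ℝ) ^ 3 ≤ (n : ℝ) ^ 4 := pow_le_pow_right₀ hn' (by norm_num)
        nlinarith

/-- Exponential concentration of the path averages. -/
lemma expect_pathAvg_deviation_le (Θ : Param n) (hn : 0 < n) (a b c : Fin 2) (i t : Fin n)
    {δ : ℝ} (hδ : 0 ≤ δ) :
    expect Θ (fun g => if δ ≤ |pathAvg (ind g) a b c i t - pathAvg (dyadProb Θ) a b c i t|
        then 1 else 0) ≤ 2 * Real.exp (-(n * δ ^ 2 / 80)) := by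
  have hn' : (0 : ℝ) < n := by exact_mod_cast hn
  have h := expect_indicator_le Θ (c := pathInfluence n i t)
    (f := fun g => pathAvg (ind g) a b c i t) (v := 40 / n) (by positivity) hδ
    (fun p _ g x y => abs_pathAvg_setDyad_sub_le g a b c i t x y) (sum_pathInfluence_sq_le hn i t)
  rw [expect_pathAvg] at h
  refine h.trans (le_of_eq ?_)
  congr 3
  field_simp
  ring

/-- All path averages are within `δ` of their expectations. -/
def Concentrated (Θ : Param n) (δ : ℝ) (g : AdjArray n) : Prop :=
  ∀ a b c i t, |pathAvg (ind g) a b c i t - pathAvg (dyadProb Θ) a b c i t| < δ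

-- A union bound over eight patterns (a,b,c) and n² pairs of end nodes; the sixteen is eight times
-- the two of the two-sided tail.
open Classical in
lemma expect_not_concentrated_le (Θ : Param n) (hn : 0 < n) {δ : ℝ} (hδ : 0 ≤ δ) :
    expect Θ (fun g => if Concentrated Θ δ g then (0 : ℝ) else 1)
      ≤ 16 * (n : ℝ) ^ 2 * Real.exp (-(n * δ ^ 2 / 80)) := by
  have h1 : ∀ g, (if Concentrated Θ δ g then (0 : ℝ) else 1) ≤ ∑ a, ∑ b, ∑ c, ∑ i, ∑ t,
      if δ ≤ |pathAvg (ind g) a b c i t - pathAvg (dyadProb Θ) a b c i t| then (1 : ℝ) else 0 := by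
    intro g
    split_ifs with h
    · positivity
    · simp only [Concentrated, not_forall, not_lt] at h
      obtain ⟨a, b, c, i, t, h⟩ := h
      calc (1 : ℝ) = if δ ≤ |pathAvg (ind g) a b c i t - pathAvg (dyadProb Θ) a b c i t|
            then (1 : ℝ) else 0 := by rw [if_pos h]
        _ ≤ _ := Finset.single_le_sum (f := fun t =>
            if δ ≤ |pathAvg (ind g) a b c i t - pathAvg (dyadProb Θ) a b c i t|
            then (1 : ℝ) else 0) (fun _ _ => by positivity) (Finset.mem_univ t)
        _ ≤ _ := Finset.single_le_sum (f := fun i => ∑ t,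
            if δ ≤ |pathAvg (ind g) a b c i t - pathAvg (dyadProb Θ) a b c i t|
            then (1 : ℝ) else 0) (fun _ _ => by positivity) (Finset.mem_univ i)
        _ ≤ _ := Finset.single_le_sum (f := fun c => ∑ i, ∑ t,
            if δ ≤ |pathAvg (ind g) a b c i t - pathAvg (dyadProb Θ) a b c i t|
            then (1 : ℝ) else 0) (fun _ _ => by positivity) (Finset.mem_univ c)
        _ ≤ _ := Finset.single_le_sum (f := fun b => ∑ c, ∑ i, ∑ t,
            if δ ≤ |pathAvg (ind g) a b c i t - pathAvg (dyadProb Θ) a b c i t|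
            then (1 : ℝ) else 0) (fun _ _ => by positivity) (Finset.mem_univ b)
        _ ≤ _ := Finset.single_le_sum (f := fun a => ∑ b, ∑ c, ∑ i, ∑ t,
            if δ ≤ |pathAvg (ind g) a b c i t - pathAvg (dyadProb Θ) a b c i t|
            then (1 : ℝ) else 0) (fun _ _ => by positivity) (Finset.mem_univ a)
  refine (expect_mono Θ fun g _ => h1 g).trans ?_
  simp only [expect_sum]
  calc _ ≤ ∑ a : Fin 2, ∑ b : Fin 2, ∑ c : Fin 2, ∑ i : Fin n, ∑ t : Fin n,
        2 * Real.exp (-(n * δ ^ 2 / 80)) := by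
        refine Finset.sum_le_sum fun a _ => Finset.sum_le_sum fun b _ => Finset.sum_le_sum
          fun c _ => Finset.sum_le_sum fun i _ => Finset.sum_le_sum fun t _ => ?_
        exact expect_pathAvg_deviation_le Θ hn a b c i t hδ
    _ = _ := by
        simp only [Finset.sum_const, Finset.card_univ, Fintype.card_fin, nsmul_eq_mul]
        push_cast; ring

/-! ### Bounds on the dyad probabilities -/

/-- A lower bound for the dyad probabilities when the parameters are bounded by `C`. -/
def minProb (C : ℝ) : ℝ := Real.exp (-(14 * C)) / 4

lemma minProb_pos (C : ℝ) : 0 < minProb C := by unfold minProb; positivity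

/-- In the worst case a = b = 1 the exponent has seven terms: θ twice, four node effects, and ρ. -/
lemma abs_dyadExponent_le {Θ : Param n} {C : ℝ} (h : Θ.BoundedBy C) (i j : Fin n) (a b : Fin 2) :
    |dyadExponent Θ i j a b| ≤ 7 * C := by
  obtain ⟨h1, h2, h3, h4⟩ := h
  have h1 := abs_le.1 h1
  have h2 := abs_le.1 h2
  have a1 := abs_le.1 (h3 i)
  have a2 := abs_le.1 (h3 j)
  have b1 := abs_le.1 (h4 i)
  have b2 := abs_le.1 (h4 j)
  unfold dyadExponent
  rw [abs_le]
  fin_cases a <;> fin_cases b <;> simp <;> (try constructor) <;> linarith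

lemma minProb_le_dyadProb {Θ : Param n} {C : ℝ} (h : Θ.BoundedBy C) (i j : Fin n) (a b : Fin 2) :
    minProb C ≤ dyadProb Θ i j a b := by
  have hk : dyadNorm Θ i j = ∑ a, ∑ b, Real.exp (dyadExponent Θ i j a b) := by
    have h1 := sum_dyadProb Θ i j
    simp only [dyadProb_eq, ← Finset.mul_sum] at h1
    rw [one_div_mul_eq_div, div_eq_one_iff_eq (dyadNorm_pos Θ i j).ne'] at h1
    exact h1.symm
  have hk' : dyadNorm Θ i j ≤ 4 * Real.exp (7 * C) := by
    rw [hk]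
    calc _ ≤ ∑ a : Fin 2, ∑ b : Fin 2, Real.exp (7 * C) :=
          Finset.sum_le_sum fun a _ => Finset.sum_le_sum fun b _ =>
            Real.exp_le_exp.2 (le_of_abs_le (abs_dyadExponent_le h i j a b))
      _ = _ := by simp; ring
  rw [dyadProb_eq, minProb, one_div_mul_eq_div, div_le_div_iff₀ (by norm_num) (dyadNorm_pos _ _ _)]
  calc Real.exp (-(14 * C)) * dyadNorm Θ i j ≤ Real.exp (-(14 * C)) * (4 * Real.exp (7 * C)) :=
        mul_le_mul_of_nonneg_left hk' (Real.exp_pos _).le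
    _ = Real.exp (-(7 * C)) * 4 := by
        rw [mul_comm 4, ← mul_assoc, ← Real.exp_add]; ring_nf
    _ ≤ _ := by
        refine mul_le_mul_of_nonneg_right (Real.exp_le_exp.2 ?_) (by norm_num)
        linarith [neg_le_of_abs_le (abs_dyadExponent_le h i j a b)]

/-- A lower bound for the expected path averages when the parameters are bounded by `C`. -/
def minAvg (C : ℝ) : ℝ := minProb C ^ 3 / 8

lemma minAvg_pos (C : ℝ) : 0 < minAvg C := by
  have := minProb_pos C
  unfold minAvg; positivity

lemma minAvg_le_pathAvg {Θ : Param n} {C : ℝ} (h : Θ.BoundedBy C) (hn : 4 ≤ n) (a b c : Fin 2)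
    (i t : Fin n) : minAvg C ≤ pathAvg (dyadProb Θ) a b c i t :=
  le_pathAvg (minProb_pos C) hn (minProb_le_dyadProb h) a b c i t

lemma minAvg_le_mu {Θ : Param n} {C : ℝ} (h : Θ.BoundedBy C) (hn : 4 ≤ n) (a b c : Fin 2)
    (t : Fin n) : minAvg C ≤ mu Θ a b c t := by
  rw [mu_eq_pathAvg]; exact minAvg_le_pathAvg h hn a b c t t

end Indicators

section Algebra

variable {n : ℕ}

/-! ### Sums over triples of distinct nodes -/

/-- Sum over ordered triples of distinct nodes. -/
def sumTriples (f : Fin n → Fin n → Fin n → ℝ) : ℝ :=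
  ∑ t, ∑ i ∈ ({t}ᶜ : Finset (Fin n)), ∑ j ∈ ({t, i}ᶜ : Finset (Fin n)), f t i j

lemma sumTriples_swap_left (f : Fin n → Fin n → Fin n → ℝ) :
    sumTriples f = sumTriples fun t i j => f i t j := by
  unfold sumTriples
  rw [Finset.sum_comm' (t' := Finset.univ) (s' := fun i => ({i}ᶜ : Finset (Fin n)))
    (by simp [eq_comm])]
  simp only [Finset.pair_comm]

lemma sumTriples_swap_right (f : Fin n → Fin n → Fin n → ℝ) :
    sumTriples f = sumTriples fun t i j => f t j i := by
  unfold sumTriples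
  refine Finset.sum_congr rfl fun t _ => ?_
  refine Finset.sum_comm' ?_
  intro i j
  simp only [Finset.mem_compl, Finset.mem_insert, Finset.mem_singleton, not_or]
  grind

/-! ### The parameters as averaged log-ratios -/

/-- The product of the three dyad probabilities along the path `i, k, l, t`. -/
lemma dyadProb_path_ratio (Θ : Param n) (c : Fin 2) (i t k l : Fin n) :
    dyadProb Θ k i c 1 * dyadProb Θ k l c 0 * dyadProb Θ t l c 1
      = Real.exp (Θ.theta + Θ.alpha i + Θ.beta t + ((c : ℕ) : ℝ) * Θ.rho)
        * (dyadProb Θ k i c 0 * dyadProb Θ k l c 1 * dyadProb Θ t l c 0) := by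
  simp only [dyadProb_eq]
  -- The terms of the form c(θ + α + β) agree on both sides, and α_l and β_k cancel. What is left is
  -- θ + α_i + β_t and one net cρ, since the left pattern has two edges of type (c,1) and the right
  -- one has one.
  have h : Real.exp (dyadExponent Θ k i c 1) * Real.exp (dyadExponent Θ k l c 0)
      * Real.exp (dyadExponent Θ t l c 1)
      = Real.exp (Θ.theta + Θ.alpha i + Θ.beta t + ((c : ℕ) : ℝ) * Θ.rho)
        * (Real.exp (dyadExponent Θ k i c 0) * Real.exp (dyadExponent Θ k l c 1)
          * Real.exp (dyadExponent Θ t l c 0)) := by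
    simp only [← Real.exp_add]
    congr 1
    simp only [dyadExponent, Fin.val_zero, Fin.val_one, Nat.cast_zero, Nat.cast_one]
    ring
  linear_combination (1 / dyadNorm Θ k i * (1 / dyadNorm Θ k l) * (1 / dyadNorm Θ t l)) * h

/-- The exponential does not involve the summed nodes, so the ratio survives summation exactly. -/
lemma pathAvg_ratio (Θ : Param n) (c : Fin 2) (i t : Fin n) :
    pathAvg (dyadProb Θ) 1 0 c i t
      = Real.exp (Θ.theta + Θ.alpha i + Θ.beta t + ((c : ℕ) : ℝ) * Θ.rho)
        * pathAvg (dyadProb Θ) 0 1 c i t := by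
  simp only [pathAvg, pathSum, Finset.mul_sum, dyadProb_path_ratio Θ c i t]
  refine Finset.sum_congr rfl fun k _ => Finset.sum_congr rfl fun l _ => ?_
  ring

/-! ### The linear part of the expansion -/

/-- The derivative of `μ_t^{(abc)}` in the direction `J`, divided by `μ_t^{(abc)}`. -/
def linForm (Θ : Param n) (J : Fin n → Fin n → Fin 2 → Fin 2 → ℝ) (a b c : Fin 2) (t : Fin n) :
    ℝ :=
  1 / mu Θ a b c t * (1 / (n : ℝ) ^ 2 *
    ∑ i ∈ ({t}ᶜ : Finset (Fin n)), ∑ j ∈ ({t, i}ᶜ : Finset (Fin n)),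
      (J i t c a * dyadProb Θ i j c b * dyadProb Θ t j c a
        + dyadProb Θ i t c a * J i j c b * dyadProb Θ t j c a
        + dyadProb Θ i t c a * dyadProb Θ i j c b * J t j c a))

/-- Collecting the coefficient of J i t: the pair is the first edge of triangles at t, the last edge
of triangles at i, or the middle edge of triangles at the third node j. These are the three summands
of `eta`; the middle edge carries b instead of a, so its term comes from the form with a and b
exchanged, hence with a minus sign and μ^(bac). -/
lemma sum_linForm_sub (Θ : Param n) (J : Fin n → Fin n → Fin 2 → Fin 2 → ℝ) (a b c : Fin 2) :
    ∑ t, (linForm Θ J a b c t - linForm Θ J b a c t)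
      = 1 / (n : ℝ) * ∑ i, ∑ t ∈ ({i}ᶜ : Finset (Fin n)),
        (eta Θ a b c i t * J i t c a - eta Θ b a c i t * J i t c b) := by
  have key : ∀ a b : Fin 2, ∑ t, linForm Θ J a b c t
      = 1 / (n : ℝ) ^ 2 * (sumTriples (fun i t j => (1 / mu Θ a b c t * dyadProb Θ t j c a
          * dyadProb Θ i j c b + 1 / mu Θ a b c i * dyadProb Θ j i c a * dyadProb Θ j t c b)
          * J i t c a)
        + sumTriples (fun i t j => 1 / mu Θ a b c j * dyadProb Θ i j c a * dyadProb Θ j t c a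
          * J i t c b)) := by
    intro a b
    have h0 : ∑ t, linForm Θ J a b c t = 1 / (n : ℝ) ^ 2 *
        (sumTriples (fun t i j => 1 / mu Θ a b c t * (J i t c a * dyadProb Θ i j c b
            * dyadProb Θ t j c a))
        + sumTriples (fun t i j => 1 / mu Θ a b c t * (dyadProb Θ i t c a * J i j c b
            * dyadProb Θ t j c a))
        + sumTriples (fun t i j => 1 / mu Θ a b c t * (dyadProb Θ i t c a * dyadProb Θ i j c b
            * J t j c a))) := by
      simp only [linForm, sumTriples, ← Finset.sum_add_distrib, Finset.mul_sum]
      refine Finset.sum_congr rfl fun t _ => Finset.sum_congr rfl fun i _ =>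
        Finset.sum_congr rfl fun j _ => ?_
      ring
    rw [h0]
    congr 1
    -- The nodes are relabelled in each of the three sums so that J is always evaluated at (i, t).
    rw [sumTriples_swap_left (fun t i j => 1 / mu Θ a b c t * (J i t c a * dyadProb Θ i j c b
            * dyadProb Θ t j c a)),
      sumTriples_swap_right (fun t i j => 1 / mu Θ a b c t * (dyadProb Θ i t c a
            * dyadProb Θ i j c b * J t j c a)),
      sumTriples_swap_left (fun t i j => 1 / mu Θ a b c t * (dyadProb Θ i t c a * J i j c b
            * dyadProb Θ t j c a)), sumTriples_swap_right (fun t i j => 1 / mu Θ a b c i *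
            (dyadProb Θ t i c a * J t j c b * dyadProb Θ i j c a))]
    have e : ∀ f g h f' h' : Fin n → Fin n → Fin n → ℝ, (∀ t i j, f t i j + h t i j = f' t i j) →
        (∀ t i j, g t i j = h' t i j) →
        sumTriples f + sumTriples g + sumTriples h = sumTriples f' + sumTriples h' := by
      intro f g h f' h' h1 h2
      simp only [sumTriples, ← h1, ← h2, Finset.sum_add_distrib]
      ring
    refine e _ _ _ _ _ ?_ ?_
    · intro i t j; ring
    · intro i t j
      rw [dyadProb_comm Θ j t c a, dyadProb_comm Θ t j a c]; ring
  rw [Finset.sum_sub_distrib, key, key]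
  simp only [eta, sumTriples, Finset.sum_mul, Finset.mul_sum, ← Finset.sum_add_distrib,
    ← Finset.sum_sub_distrib]
  refine Finset.sum_congr rfl fun i _ => Finset.sum_congr rfl fun t _ =>
    Finset.sum_congr rfl fun j _ => ?_
  ring

/-- The coefficient of `1{X_it = a, X_ti = b}` in the linear part of `n² (ρ̂ - ρ)`. -/
def coef (Θ : Param n) (i t : Fin n) : Fin 2 → Fin 2 → ℝ :=
  ![![eta Θ 0 1 0 i t + eta Θ 0 1 0 t i, -(eta Θ 1 0 0 i t + eta Θ 0 1 1 t i)],
    ![-(eta Θ 0 1 1 i t + eta Θ 1 0 0 t i), eta Θ 1 0 1 i t + eta Θ 1 0 1 t i]]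

/-- The linear form of the estimation error of `ρ̂`. -/
lemma sum_linForm_eq_coef (Θ : Param n) (J : Fin n → Fin n → Fin 2 → Fin 2 → ℝ)
    (hJ : ∀ i j a b, J i j a b = J j i b a) :
    ∑ t, ((linForm Θ J 1 0 1 t - linForm Θ J 0 1 1 t) - (linForm Θ J 1 0 0 t - linForm Θ J 0 1 0 t))
      = 1 / (n : ℝ) * ∑ p ∈ dyads n, ∑ a, ∑ b, coef Θ p.2 p.1 a b * J p.2 p.1 a b := by
  rw [Finset.sum_sub_distrib, sum_linForm_sub, sum_linForm_sub, ← mul_sub,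
    sum_sum_compl_singleton, sum_sum_compl_singleton, ← Finset.sum_sub_distrib]
  congr 1
  refine Finset.sum_congr rfl fun p _ => ?_
  simp only [Fin.sum_univ_two, coef, Matrix.cons_val_zero, Matrix.cons_val_one]
  rw [hJ p.1 p.2 1 1, hJ p.1 p.2 1 0, hJ p.1 p.2 0 1, hJ p.1 p.2 0 0]
  ring

/-- The variance of `F` under the law of the dyad of `i` and `t`. -/
def dyadVar (Θ : Param n) (i t : Fin n) (F : Fin 2 → Fin 2 → ℝ) : ℝ :=
  ∑ a, ∑ b, dyadProb Θ i t a b * F a b ^ 2 - (∑ a, ∑ b, dyadProb Θ i t a b * F a b) ^ 2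

lemma dyadVar_eq (Θ : Param n) (i t : Fin n) (F : Fin 2 → Fin 2 → ℝ) :
    dyadVar Θ i t F = ∑ a, ∑ b, dyadProb Θ i t a b *
      (F a b - ∑ a, ∑ b, dyadProb Θ i t a b * F a b) ^ 2 := by
  have h := sum_dyadProb Θ i t
  simp only [dyadVar, Fin.sum_univ_two] at h ⊢
  linear_combination (-(dyadProb Θ i t 0 0 * F 0 0 + dyadProb Θ i t 0 1 * F 0 1 +
    (dyadProb Θ i t 1 0 * F 1 0 + dyadProb Θ i t 1 1 * F 1 1)) ^ 2) * h

/-- A dyad is stored as (t, i) with t < i, while variance and bias are written for the pair (i, t);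
hence the order `p.2`, `p.1` here and below. -/
lemma sigmaRhoSq_eq (Θ : Param n) :
    sigmaRhoSq Θ = 1 / (n : ℝ) ^ 4 * ∑ p ∈ dyads n, dyadVar Θ p.2 p.1 (coef Θ p.2 p.1) := by
  rw [sigmaRhoSq, sum_dyads (fun t i => dyadVar Θ i t (coef Θ i t))]
  congr 1
  refine Finset.sum_congr rfl fun t _ => Finset.sum_congr rfl fun i _ => ?_
  simp only [gFun, dyadVar, coef, Fin.sum_univ_two, Fin.sum_univ_four, Matrix.cons_val_zero,
    Matrix.cons_val_one, Matrix.cons_val]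
  ring

/-! ### A lower bound for the asymptotic variance -/

/-- The derivative of the dyad probabilities with respect to `ρ`. -/
def rhoDeriv (Θ : Param n) (i j : Fin n) (a b : Fin 2) : ℝ :=
  dyadProb Θ i j a b * (((a : ℕ) : ℝ) * ((b : ℕ) : ℝ) - dyadProb Θ i j 1 1)

lemma rhoDeriv_comm (Θ : Param n) (i j : Fin n) (a b : Fin 2) :
    rhoDeriv Θ i j a b = rhoDeriv Θ j i b a := by
  simp only [rhoDeriv]
  rw [dyadProb_comm Θ i j a b, dyadProb_comm Θ i j 1 1]; ring

lemma sum_rhoDeriv (Θ : Param n) (i j : Fin n) : ∑ a, ∑ b, rhoDeriv Θ i j a b = 0 := by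
  have h := sum_dyadProb Θ i j
  simp only [rhoDeriv, Fin.sum_univ_two, Fin.val_zero, Fin.val_one, Nat.cast_zero,
    Nat.cast_one] at h ⊢
  linear_combination (-dyadProb Θ i j 1 1) * h

/-- This is the logarithmic derivative in ρ of the identity μ^(10c) = exp(θ + α_t + β_t + cρ)
μ^(01c). It is checked algebraically: the monomials of the two averages contain 2c and c mutual
edges, and their other contributions to the derivative coincide. -/
lemma linForm_rhoDeriv_sub (Θ : Param n) (c : Fin 2) (t : Fin n) (h0 : mu Θ 0 1 c t ≠ 0) :
    linForm Θ (rhoDeriv Θ) 1 0 c t - linForm Θ (rhoDeriv Θ) 0 1 c t = ((c : ℕ) : ℝ) := by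
  set r := Real.exp (Θ.theta + Θ.alpha t + Θ.beta t + ((c : ℕ) : ℝ) * Θ.rho) with hr
  have hr0 : r ≠ 0 := (Real.exp_pos _).ne'
  have hmu : mu Θ 1 0 c t = r * mu Θ 0 1 c t := by
    rw [mu_eq_pathAvg, mu_eq_pathAvg, pathAvg_ratio]
  have hprod := fun i j => dyadProb_path_ratio Θ c t t i j
  rw [← hr] at hprod
  have e1 : linForm Θ (rhoDeriv Θ) 1 0 c t = 1 / mu Θ 0 1 c t * (1 / (n : ℝ) ^ 2 *
      ∑ i ∈ ({t}ᶜ : Finset (Fin n)), ∑ j ∈ ({t, i}ᶜ : Finset (Fin n)),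
        dyadProb Θ i t c 0 * dyadProb Θ i j c 1 * dyadProb Θ t j c 0 * (2 * ((c : ℕ) : ℝ)
          - dyadProb Θ i t 1 1 - dyadProb Θ i j 1 1 - dyadProb Θ t j 1 1)) := by
    rw [linForm, hmu]
    simp only [Finset.mul_sum]
    refine Finset.sum_congr rfl fun i _ => Finset.sum_congr rfl fun j _ => ?_
    simp only [rhoDeriv, Fin.val_zero, Fin.val_one, Nat.cast_zero, Nat.cast_one]
    have h := hprod i j
    field_simp
    linear_combination (1 / (n : ℝ) ^ 2) * (2 * ((c : ℕ) : ℝ)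
          - dyadProb Θ i t 1 1 - dyadProb Θ i j 1 1 - dyadProb Θ t j 1 1) * h
  have e2 : linForm Θ (rhoDeriv Θ) 0 1 c t = 1 / mu Θ 0 1 c t * (1 / (n : ℝ) ^ 2 *
      ∑ i ∈ ({t}ᶜ : Finset (Fin n)), ∑ j ∈ ({t, i}ᶜ : Finset (Fin n)),
        dyadProb Θ i t c 0 * dyadProb Θ i j c 1 * dyadProb Θ t j c 0 * (((c : ℕ) : ℝ)
          - dyadProb Θ i t 1 1 - dyadProb Θ i j 1 1 - dyadProb Θ t j 1 1)) := by
    rw [linForm]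
    simp only [Finset.mul_sum]
    refine Finset.sum_congr rfl fun i _ => Finset.sum_congr rfl fun j _ => ?_
    simp only [rhoDeriv, Fin.val_zero, Fin.val_one, Nat.cast_zero, Nat.cast_one]
    ring
  have e3 : mu Θ 0 1 c t = 1 / (n : ℝ) ^ 2 *
      ∑ i ∈ ({t}ᶜ : Finset (Fin n)), ∑ j ∈ ({t, i}ᶜ : Finset (Fin n)),
        dyadProb Θ i t c 0 * dyadProb Θ i j c 1 * dyadProb Θ t j c 0 := rfl
  have e4 : linForm Θ (rhoDeriv Θ) 1 0 c t - linForm Θ (rhoDeriv Θ) 0 1 c t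
      = 1 / mu Θ 0 1 c t * (mu Θ 0 1 c t * ((c : ℕ) : ℝ)) := by
    rw [e1, e2, ← mul_sub, ← mul_sub]
    congr 1
    rw [e3, mul_assoc]
    congr 1
    simp only [Finset.sum_mul, ← Finset.sum_sub_distrib]
    refine Finset.sum_congr rfl fun i _ => Finset.sum_congr rfl fun j _ => ?_
    ring
  rw [e4]
  field_simp

/-- The contrast between c = 1 and c = 0 has derivative 1 - 0 at each of the n nodes. In estimation
terms, the linear part is locally unbiased for ρ. -/
lemma sum_coef_mul_rhoDeriv (Θ : Param n) (hn : 0 < n) (h0 : ∀ c t, mu Θ 0 1 c t ≠ 0) :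
    ∑ p ∈ dyads n, ∑ a, ∑ b, coef Θ p.2 p.1 a b * rhoDeriv Θ p.2 p.1 a b = (n : ℝ) ^ 2 := by
  have hn' : (n : ℝ) ≠ 0 := by exact_mod_cast hn.ne'
  have h := sum_linForm_eq_coef Θ (rhoDeriv Θ) (rhoDeriv_comm Θ)
  simp only [linForm_rhoDeriv_sub Θ _ _ (h0 _ _), Fin.val_zero, Fin.val_one, Nat.cast_zero,
    Nat.cast_one, sub_zero, Finset.sum_const, Finset.card_univ, Fintype.card_fin, nsmul_eq_mul,
    mul_one] at h
  rw [one_div_mul_eq_div, eq_div_iff hn'] at h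
  rw [← h, sq]

/-- The left side is the squared covariance of F with the indicator of a mutual dyad, which is
centred at p^11 and bounded by one after centring; Cauchy–Schwarz applies. -/
lemma sq_sum_mul_rhoDeriv_le (Θ : Param n) (i t : Fin n) (F : Fin 2 → Fin 2 → ℝ) :
    (∑ a, ∑ b, F a b * rhoDeriv Θ i t a b) ^ 2 ≤ dyadVar Θ i t F := by
  set m := ∑ a, ∑ b, dyadProb Θ i t a b * F a b with hm
  have h1 : ∑ a, ∑ b, F a b * rhoDeriv Θ i t a b
      = ∑ s : Fin 2 × Fin 2, (F s.1 s.2 - m) * rhoDeriv Θ i t s.1 s.2 := by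
    have h0 := sum_rhoDeriv Θ i t
    rw [Fintype.sum_prod_type]
    simp only [Fin.sum_univ_two] at h0 ⊢
    linear_combination m * h0
  have h2 : ∀ a b, |((a : Fin 2) : ℕ) * (((b : Fin 2) : ℕ) : ℝ) - dyadProb Θ i t 1 1| ≤ 1 := by
    intro a b
    have l1 := (dyadProb_pos Θ i t 1 1).le
    have l2 := dyadProb_le_one Θ i t 1 1
    rw [abs_le]
    fin_cases a <;> fin_cases b <;> simp <;> first | linarith | constructor <;> linarith
  rw [h1]
  have hs : ∀ s ∈ (Finset.univ : Finset (Fin 2 × Fin 2)), ((F s.1 s.2 - m)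
      * rhoDeriv Θ i t s.1 s.2) ^ 2 ≤ dyadProb Θ i t s.1 s.2 *
        (dyadProb Θ i t s.1 s.2 * (F s.1 s.2 - m) ^ 2) := by
    intro s _
    have h3 : ((((s.1 : ℕ) : ℝ) * ((s.2 : ℕ) : ℝ) - dyadProb Θ i t 1 1) ^ 2) ≤ 1 := by
      rw [sq_le_one_iff_abs_le_one]; exact h2 s.1 s.2
    rw [rhoDeriv]
    calc _ = (dyadProb Θ i t s.1 s.2 * (F s.1 s.2 - m)) ^ 2 *
          ((((s.1 : ℕ) : ℝ) * ((s.2 : ℕ) : ℝ) - dyadProb Θ i t 1 1) ^ 2) := by ring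
      _ ≤ (dyadProb Θ i t s.1 s.2 * (F s.1 s.2 - m)) ^ 2 * 1 :=
          mul_le_mul_of_nonneg_left h3 (sq_nonneg _)
      _ = _ := by ring
  refine (Finset.sum_sq_le_sum_mul_sum_of_sq_le_mul _
    (fun s _ => (dyadProb_pos Θ i t s.1 s.2).le)
    (fun s _ => mul_nonneg (dyadProb_pos Θ i t s.1 s.2).le (sq_nonneg _)) hs).trans ?_
  rw [Fintype.sum_prod_type, sum_dyadProb, one_mul, dyadVar_eq, Fintype.sum_prod_type]

lemma card_dyads_le (n : ℕ) : ((dyads n).card : ℝ) ≤ (n : ℝ) ^ 2 := by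
  have : (dyads n).card ≤ n ^ 2 := by
    refine (Finset.card_le_univ _).trans ?_
    simp [sq]
  exact_mod_cast this

/-- The asymptotic variance is at least of order `n⁻²`. -/
lemma one_le_sq_mul_sigmaRhoSq (Θ : Param n) (hn : 0 < n) (h0 : ∀ c t, mu Θ 0 1 c t ≠ 0) :
    1 ≤ (n : ℝ) ^ 2 * sigmaRhoSq Θ := by
  have hn' : (0 : ℝ) < n := by exact_mod_cast hn
  have h := sum_coef_mul_rhoDeriv Θ hn h0
  -- At most n² terms add up to n², so their squares add up to at least n²; each square is at most a
  -- dyad variance.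
  have hcs := sq_sum_le_card_mul_sum_sq (s := dyads n)
    (f := fun p => ∑ a, ∑ b, coef Θ p.2 p.1 a b * rhoDeriv Θ p.2 p.1 a b)
  rw [h] at hcs
  have hv : ∑ p ∈ dyads n, (∑ a, ∑ b, coef Θ p.2 p.1 a b * rhoDeriv Θ p.2 p.1 a b) ^ 2
      ≤ ∑ p ∈ dyads n, dyadVar Θ p.2 p.1 (coef Θ p.2 p.1) :=
    Finset.sum_le_sum fun p _ => sq_sum_mul_rhoDeriv_le Θ p.2 p.1 _
  set S := ∑ p ∈ dyads n, dyadVar Θ p.2 p.1 (coef Θ p.2 p.1) with hS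
  set Q := ∑ p ∈ dyads n, (∑ a, ∑ b, coef Θ p.2 p.1 a b * rhoDeriv Θ p.2 p.1 a b) ^ 2 with hQ
  have hQ0 : 0 ≤ Q := Finset.sum_nonneg fun _ _ => sq_nonneg _
  have h1 : ((n : ℝ) ^ 2) ^ 2 ≤ (n : ℝ) ^ 2 * S :=
    hcs.trans (mul_le_mul (card_dyads_le n) hv hQ0 (by positivity))
  rw [sigmaRhoSq_eq, ← hS]
  have h2 : (n : ℝ) ^ 2 ≤ S := by
    rw [sq ((n : ℝ) ^ 2)] at h1
    exact le_of_mul_le_mul_left h1 (by positivity)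
  have : (n : ℝ) ^ 2 * (1 / (n : ℝ) ^ 4 * S) = S / (n : ℝ) ^ 2 := by field_simp
  rw [this, le_div_iff₀ (by positivity)]
  linarith

end Algebra

section Moments

variable {n : ℕ} (Θ : Param n)

/-! ### Triangle monomials in functions of single dyads -/

/-- `A i j` is a function of the dyad of `i` and `j`. -/
def DyadFun (A : Fin n → Fin n → AdjArray n → ℝ) : Prop :=
  ∀ i j u v, ¬ (i = u ∧ j = v) → ¬ (i = v ∧ j = u) → Free (A i j) u v

/-- `A i j` has mean zero under the law of the dyad of `i` and `j`. -/
def Centred (A : Fin n → Fin n → AdjArray n → ℝ) : Prop :=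
  ∀ i j, i ≠ j → resample Θ i j (A i j) = 0

lemma DyadFun.free {A : Fin n → Fin n → AdjArray n → ℝ} (hA : DyadFun A) {i j u : Fin n}
    (v : Fin n) (hi : u ≠ i) (hj : u ≠ j) : Free (A i j) u v :=
  hA i j u v (fun e => hi e.1.symm) (fun e => hj e.2.symm)

lemma resample_mul_eq_zero {i j : Fin n} {f h : AdjArray n → ℝ} (hf : resample Θ i j f = 0)
    (hh : Free h i j) : resample Θ i j (fun g => f g * h g) = 0 := by
  rw [resample_mul_free Θ hh, hf]
  funext g; simp

variable {Θ} {A B D : Fin n → Fin n → AdjArray n → ℝ}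

lemma free_triangle (hA : DyadFun A) (hB : DyadFun B) (hD : DyadFun D) (x : ℝ) {t i j u : Fin n}
    (v : Fin n) (ht : u ≠ t) (hi : u ≠ i) (hj : u ≠ j) :
    Free (fun g => x * (A i t g * B i j g * D t j g)) u v :=
  ((((hA.free v hi ht).comp₂ (· * ·) (hB.free v hi hj)).comp₂ (· * ·)
    (hD.free v ht hj))).comp (x * ·)

/-- The edges of a triangle are three different dyads, so a centred factor on one edge makes the
whole monomial centred there. The next two lemmas do the same for the other edges. -/
lemma resample_triangle_first (hB : DyadFun B) (hD : DyadFun D)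
    (h : Centred Θ A) (x : ℝ) {t i j : Fin n} (hit : i ≠ t) (hjt : j ≠ t) (hji : j ≠ i) :
    resample Θ i t (fun g => x * (A i t g * B i j g * D t j g)) = 0 := by
  have e : (fun g => x * (A i t g * B i j g * D t j g))
      = fun g => A i t g * (x * (B i j g * D t j g)) := by funext g; ring
  rw [e]
  refine resample_mul_eq_zero Θ (h i t hit) (Free.comp (x * ·) (Free.comp₂ (· * ·) ?_ ?_))
  · exact hB i j i t (fun e => hjt e.2) (fun e => hit e.1)
  · exact hD t j i t (fun e => hit e.1.symm) (fun e => hji e.2)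

lemma resample_triangle_second (hA : DyadFun A) (hD : DyadFun D)
    (h : Centred Θ B) (x : ℝ) {t i j : Fin n} (hit : i ≠ t) (hjt : j ≠ t) (hji : j ≠ i) :
    resample Θ i j (fun g => x * (A i t g * B i j g * D t j g)) = 0 := by
  have e : (fun g => x * (A i t g * B i j g * D t j g))
      = fun g => B i j g * (x * (A i t g * D t j g)) := by funext g; ring
  rw [e]
  refine resample_mul_eq_zero Θ (h i j hji.symm) (Free.comp (x * ·) (Free.comp₂ (· * ·) ?_ ?_))
  · exact hA i t i j (fun e => hjt e.2.symm) (fun e => hji e.1.symm)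
  · exact hD t j i j (fun e => hit e.1.symm) (fun e => hjt e.1.symm)

lemma resample_triangle_third (hA : DyadFun A) (hB : DyadFun B)
    (h : Centred Θ D) (x : ℝ) {t i j : Fin n} (hit : i ≠ t) (hjt : j ≠ t) (hji : j ≠ i) :
    resample Θ t j (fun g => x * (A i t g * B i j g * D t j g)) = 0 := by
  have e : (fun g => x * (A i t g * B i j g * D t j g))
      = fun g => D t j g * (x * (A i t g * B i j g)) := by funext g; ring
  rw [e]
  refine resample_mul_eq_zero Θ (h t j hjt.symm) (Free.comp (x * ·) (Free.comp₂ (· * ·) ?_ ?_))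
  · exact hA i t t j (fun e => hit e.1) (fun e => hji e.1.symm)
  · exact hB i j t j (fun e => hit e.1) (fun e => hji e.1.symm)

lemma sum_pairs_eq (t : Fin n) (f : Fin n → Fin n → ℝ) :
    ∑ i ∈ ({t}ᶜ : Finset (Fin n)), ∑ j ∈ ({t, i}ᶜ : Finset (Fin n)), f i j
      = ∑ p : Fin n × Fin n, if p.1 ≠ t ∧ p.2 ≠ t ∧ p.2 ≠ p.1 then f p.1 p.2 else 0 := by
  rw [Fintype.sum_prod_type, ← Finset.sum_subset (Finset.subset_univ ({t}ᶜ : Finset (Fin n)))]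
  · refine Finset.sum_congr rfl fun i hi => ?_
    simp only [Finset.mem_compl, Finset.mem_singleton] at hi
    rw [← Finset.sum_filter]
    refine Finset.sum_congr ?_ fun _ _ => rfl
    ext j; simp [hi]
  · intro i _ hi
    simp only [Finset.mem_compl, Finset.mem_singleton, not_not] at hi
    simp [hi]

lemma sumTriples_eq (f : Fin n → Fin n → Fin n → ℝ) :
    sumTriples f = ∑ τ : Fin n × Fin n × Fin n,
      if τ.2.1 ≠ τ.1 ∧ τ.2.2 ≠ τ.1 ∧ τ.2.2 ≠ τ.2.1 then f τ.1 τ.2.1 τ.2.2 else 0 := by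
  rw [Fintype.sum_prod_type, sumTriples]
  exact Finset.sum_congr rfl fun t _ => sum_pairs_eq t _

/-- The hypotheses `hi`, `hj`, `ht` say that each vertex meets a centred edge. Two monomials then
correlate only if the vertices of one lie among those of the other, which leaves at most 3³
partners. -/
lemma expect_sq_sumTriples_le (hA : DyadFun A) (hB : DyadFun B) (hD : DyadFun D)
    (hi : Centred Θ A ∨ Centred Θ B) (hj : Centred Θ B ∨ Centred Θ D)
    (ht : Centred Θ A ∨ Centred Θ D) (w : Fin n → Fin n → Fin n → ℝ) {c : ℝ} (hc : 0 ≤ c)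
    (hb : ∀ t i j g, |w t i j * (A i t g * B i j g * D t j g)| ≤ c) :
    expect Θ (fun g => (sumTriples fun t i j => w t i j * (A i t g * B i j g * D t j g)) ^ 2)
      ≤ 27 * c ^ 2 * (n : ℝ) ^ 3 := by
  have key := expect_sq_sum_le Θ (T := Fin n × Fin n × Fin n)
    (fun τ g => if τ.2.1 ≠ τ.1 ∧ τ.2.2 ≠ τ.1 ∧ τ.2.2 ≠ τ.2.1 then
      w τ.1 τ.2.1 τ.2.2 * (A τ.2.1 τ.1 g * B τ.2.1 τ.2.2 g * D τ.1 τ.2.2 g) else 0)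
    (fun τ => {τ.1, τ.2.1, τ.2.2}) ∅ hc (K := 27) ?_ ?_ ?_ ?_
  · simp only [sumTriples_eq]
    refine key.trans (le_of_eq ?_)
    simp only [Fintype.card_prod, Fintype.card_fin]
    push_cast; ring
  · rintro ⟨t, i, j⟩ u v _ hu _
    simp only [Finset.mem_insert, Finset.mem_singleton, not_or] at hu
    by_cases hd : i ≠ t ∧ j ≠ t ∧ j ≠ i
    · simp only [if_pos hd]; exact free_triangle hA hB hD _ v hu.1 hu.2.1 hu.2.2
    · simp only [if_neg hd]; exact free_const _ _ _
  · rintro ⟨t, i, j⟩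
    by_cases hd : i ≠ t ∧ j ≠ t ∧ j ≠ i
    · right
      simp only [if_pos hd]
      obtain ⟨hit, hjt, hji⟩ := hd
      intro u hu _
      simp only [Finset.mem_insert, Finset.mem_singleton] at hu
      rcases hu with rfl | rfl | rfl
      · rcases ht with h | h
        · refine ⟨i, hit, ?_⟩
          rw [resample_comm_nodes Θ hit.symm]
          exact resample_triangle_first hB hD h _ hit hjt hji
        · exact ⟨j, hjt, resample_triangle_third hA hB h _ hit hjt hji⟩
      · rcases hi with h | h
        · exact ⟨t, hit.symm, resample_triangle_first hB hD h _ hit hjt hji⟩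
        · exact ⟨j, hji, resample_triangle_second hA hD h _ hit hjt hji⟩
      · rcases hj with h | h
        · refine ⟨i, hji.symm, ?_⟩
          rw [resample_comm_nodes Θ hji]
          exact resample_triangle_second hA hD h _ hit hjt hji
        · refine ⟨t, hjt.symm, ?_⟩
          rw [resample_comm_nodes Θ hjt]
          exact resample_triangle_third hA hB h _ hit hjt hji
    · left; funext g; simp only [if_neg hd]; rfl
  · rintro ⟨t, i, j⟩ g
    simp only
    split_ifs
    · exact hb t i j g
    · simpa using hc
  · rintro ⟨t, i, j⟩
    refine (Finset.card_le_card (t := ({t, i, j} : Finset (Fin n)) ×ˢ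
      (({t, i, j} : Finset (Fin n)) ×ˢ ({t, i, j} : Finset (Fin n)))) ?_).trans ?_
    · rintro ⟨t', i', j'⟩ h
      simp only [Finset.mem_filter, Finset.mem_univ, true_and, Finset.union_empty,
        Finset.insert_subset_iff, Finset.singleton_subset_iff] at h
      simp only [Finset.mem_product]
      exact h
    · rw [Finset.card_product, Finset.card_product]
      have := Finset.card_le_three (a := t) (b := i) (c := j)
      calc _ ≤ 3 * (3 * 3) := Nat.mul_le_mul this (Nat.mul_le_mul this this)
        _ = 27 := rfl

/-- With the apex t fixed, only i and j must meet a centred edge, so the middle edge alone can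
suffice. Partners are pairs from {i, j, t}, hence 3². -/
lemma expect_sq_sum_pairs_le (hA : DyadFun A) (hB : DyadFun B) (hD : DyadFun D)
    (hi : Centred Θ A ∨ Centred Θ B) (hj : Centred Θ B ∨ Centred Θ D)
    (t : Fin n) (w : Fin n → Fin n → ℝ) {c : ℝ} (hc : 0 ≤ c)
    (hb : ∀ i j g, |w i j * (A i t g * B i j g * D t j g)| ≤ c) :
    expect Θ (fun g => (∑ i ∈ ({t}ᶜ : Finset (Fin n)), ∑ j ∈ ({t, i}ᶜ : Finset (Fin n)),
      w i j * (A i t g * B i j g * D t j g)) ^ 2) ≤ 9 * c ^ 2 * (n : ℝ) ^ 2 := by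
  have key := expect_sq_sum_le Θ (T := Fin n × Fin n)
    (fun τ g => if τ.1 ≠ t ∧ τ.2 ≠ t ∧ τ.2 ≠ τ.1 then
      w τ.1 τ.2 * (A τ.1 t g * B τ.1 τ.2 g * D t τ.2 g) else 0)
    (fun τ => {τ.1, τ.2}) {t} hc (K := 9) ?_ ?_ ?_ ?_
  · simp only [sum_pairs_eq]
    refine key.trans (le_of_eq ?_)
    simp only [Fintype.card_prod, Fintype.card_fin]
    push_cast; ring
  · rintro ⟨i, j⟩ u v _ hu hut
    simp only [Finset.mem_insert, Finset.mem_singleton, not_or] at hu hut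
    by_cases hd : i ≠ t ∧ j ≠ t ∧ j ≠ i
    · simp only [if_pos hd]; exact free_triangle hA hB hD _ v hut hu.1 hu.2
    · simp only [if_neg hd]; exact free_const _ _ _
  · rintro ⟨i, j⟩
    by_cases hd : i ≠ t ∧ j ≠ t ∧ j ≠ i
    · right
      simp only [if_pos hd]
      obtain ⟨hit, hjt, hji⟩ := hd
      intro u hu _
      simp only [Finset.mem_insert, Finset.mem_singleton] at hu
      rcases hu with rfl | rfl
      · rcases hi with h | h
        · exact ⟨t, hit.symm, resample_triangle_first hB hD h _ hit hjt hji⟩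
        · exact ⟨j, hji, resample_triangle_second hA hD h _ hit hjt hji⟩
      · rcases hj with h | h
        · refine ⟨i, hji.symm, ?_⟩
          rw [resample_comm_nodes Θ hji]
          exact resample_triangle_second hA hD h _ hit hjt hji
        · refine ⟨t, hjt.symm, ?_⟩
          rw [resample_comm_nodes Θ hjt]
          exact resample_triangle_third hA hB h _ hit hjt hji
    · left; funext g; simp only [if_neg hd]; rfl
  · rintro ⟨i, j⟩ g
    simp only
    split_ifs
    · exact hb i j g
    · simpa using hc
  · rintro ⟨i, j⟩
    refine (Finset.card_le_card (t := ({i, j, t} : Finset (Fin n)) ×ˢ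
      ({i, j, t} : Finset (Fin n))) ?_).trans ?_
    · rintro ⟨i', j'⟩ h
      simp only [Finset.mem_filter, Finset.mem_univ, true_and,
        Finset.insert_subset_iff, Finset.singleton_subset_iff, Finset.mem_union,
        Finset.mem_insert, Finset.mem_singleton] at h
      simp only [Finset.mem_product, Finset.mem_insert, Finset.mem_singleton]
      exact ⟨or_assoc.1 h.1, or_assoc.1 h.2⟩
    · rw [Finset.card_product]
      have := Finset.card_le_three (a := i) (b := j) (c := t)
      calc _ ≤ 3 * 3 := Nat.mul_le_mul this this
        _ = 9 := rfl

lemma expect_sq_sum_dyadFun_le (hA : DyadFun A) (hA0 : Centred Θ A) {c : ℝ} (hc : 0 ≤ c)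
    (hb : ∀ i t g, |A i t g| ≤ c) :
    expect Θ (fun g => (∑ t, ∑ i ∈ ({t}ᶜ : Finset (Fin n)), A i t g) ^ 2)
      ≤ 4 * c ^ 2 * (n : ℝ) ^ 2 := by
  have hsum : ∀ g, ∑ t, ∑ i ∈ ({t}ᶜ : Finset (Fin n)), A i t g
      = ∑ τ : Fin n × Fin n, if τ.2 ≠ τ.1 then A τ.2 τ.1 g else 0 := by
    intro g
    rw [Fintype.sum_prod_type]
    refine Finset.sum_congr rfl fun t _ => ?_
    rw [← Finset.sum_filter]
    refine Finset.sum_congr ?_ fun _ _ => rfl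
    ext j; simp
  have key := expect_sq_sum_le Θ (T := Fin n × Fin n)
    (fun τ g => if τ.2 ≠ τ.1 then A τ.2 τ.1 g else 0)
    (fun τ => {τ.1, τ.2}) ∅ hc (K := 4) ?_ ?_ ?_ ?_
  · simp only [hsum]
    refine key.trans (le_of_eq ?_)
    simp only [Fintype.card_prod, Fintype.card_fin]
    push_cast; ring
  · rintro ⟨t, i⟩ u v _ hu _
    simp only [Finset.mem_insert, Finset.mem_singleton, not_or] at hu
    by_cases hd : i ≠ t
    · simp only [if_pos hd]; exact hA.free v hu.2 hu.1
    · simp only [if_neg hd]; exact free_const _ _ _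
  · rintro ⟨t, i⟩
    by_cases hd : i ≠ t
    · right
      simp only [if_pos hd]
      intro u hu _
      simp only [Finset.mem_insert, Finset.mem_singleton] at hu
      rcases hu with rfl | rfl
      · refine ⟨i, hd, ?_⟩
        rw [resample_comm_nodes Θ hd.symm]
        exact hA0 i _ hd
      · exact ⟨t, hd.symm, hA0 _ t hd⟩
    · left; funext g; simp only [if_neg hd]; rfl
  · rintro ⟨t, i⟩ g
    simp only
    split_ifs
    · exact hb i t g
    · simpa using hc
  · rintro ⟨t, i⟩
    refine (Finset.card_le_card (t := ({t, i} : Finset (Fin n)) ×ˢ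
      ({t, i} : Finset (Fin n))) ?_).trans ?_
    · rintro ⟨t', i'⟩ h
      simp only [Finset.mem_filter, Finset.mem_univ, true_and, Finset.union_empty,
        Finset.insert_subset_iff, Finset.singleton_subset_iff] at h
      simp only [Finset.mem_product]
      exact h
    · rw [Finset.card_product]
      have := Finset.card_le_two (a := t) (b := i)
      calc _ ≤ 2 * 2 := Nat.mul_le_mul this this
        _ = 4 := rfl

/-- Functions of the distinct dyads at a fixed node are orthogonal. -/
lemma expect_sq_sum_star (hA : DyadFun A) (hA0 : Centred Θ A) (t : Fin n) :
    expect Θ (fun g => (∑ i ∈ ({t}ᶜ : Finset (Fin n)), A i t g) ^ 2)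
      = ∑ i ∈ ({t}ᶜ : Finset (Fin n)), expect Θ (fun g => A i t g ^ 2) := by
  simp_rw [sq, Finset.sum_mul_sum, expect_sum]
  refine Finset.sum_congr rfl fun i hi => ?_
  simp only [Finset.mem_compl, Finset.mem_singleton] at hi
  rw [Finset.sum_eq_single i]
  · intro j hj hji
    simp only [Finset.mem_compl, Finset.mem_singleton] at hj
    exact expect_mul_eq_zero Θ hi (hA0 i t hi)
      (hA j t i t (fun e => hji e.1) (fun e => hj e.1))
  · intro h; simp [hi] at h

end Moments

section Expansion

variable {n : ℕ} (Θ : Param n)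

/-! ### Second-order expansion of the relative error of a triple-dyad average -/

/-- The centred dyad indicator. -/
def centInd (g : AdjArray n) (i j : Fin n) (a b : Fin 2) : ℝ := ind g i j a b - dyadProb Θ i j a b

lemma centInd_comm (g : AdjArray n) (i j : Fin n) (a b : Fin 2) :
    centInd Θ g i j a b = centInd Θ g j i b a := by
  rw [centInd, centInd, ind_comm, dyadProb_comm]

lemma abs_centInd_le_one (g : AdjArray n) (i j : Fin n) (a b : Fin 2) :
    |centInd Θ g i j a b| ≤ 1 := by
  have h1 := ind_nonneg g i j a b
  have h2 := ind_le_one g i j a b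
  have h3 := (dyadProb_pos Θ i j a b).le
  have h4 := dyadProb_le_one Θ i j a b
  rw [centInd, abs_le]
  constructor <;> linarith

lemma abs_dyadProb_le_one (i j : Fin n) (a b : Fin 2) : |dyadProb Θ i j a b| ≤ 1 := by
  rw [abs_of_pos (dyadProb_pos Θ i j a b)]; exact dyadProb_le_one Θ i j a b

lemma dyadFun_ind (a b : Fin 2) : DyadFun (n := n) fun i j g => ind g i j a b :=
  fun _ _ _ _ h h' => free_ind a b h h'

lemma dyadFun_const (f : Fin n → Fin n → ℝ) : DyadFun (n := n) fun i j _ => f i j :=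
  fun _ _ u v _ _ => free_const _ u v

lemma dyadFun_centInd (a b : Fin 2) : DyadFun fun i j g => centInd Θ g i j a b :=
  fun i j _ _ h h' => (free_ind a b h h').comp (· - dyadProb Θ i j a b)

lemma centred_centInd (a b : Fin 2) : Centred Θ fun i j g => centInd Θ g i j a b := by
  intro i j h
  have h1 := resample_ind Θ h a b
  funext g
  have h2 := congrFun h1 g
  have h3 := sum_dyadProb Θ i j
  simp only [resample, centInd, smul_eq_mul, Fin.sum_univ_two, Pi.zero_apply] at h2 h3 ⊢
  linear_combination h2 - dyadProb Θ i j a b * h3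

/-- The relative error of the triple-dyad average at `t`. -/
def relErr (a b c : Fin 2) (t : Fin n) (g : AdjArray n) : ℝ :=
  pathAvg (ind g) a b c t t / mu Θ a b c t - 1

/-- The part of the relative error that is of degree two or three in the centred indicators. -/
def quadRem (a b c : Fin 2) (t : Fin n) (g : AdjArray n) : ℝ :=
  1 / mu Θ a b c t * (1 / (n : ℝ) ^ 2 *
    ∑ i ∈ ({t}ᶜ : Finset (Fin n)), ∑ j ∈ ({t, i}ᶜ : Finset (Fin n)),
      (centInd Θ g i t c a * centInd Θ g i j c b * dyadProb Θ t j c a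
        + centInd Θ g i t c a * dyadProb Θ i j c b * centInd Θ g t j c a
        + ind g i t c a * centInd Θ g i j c b * centInd Θ g t j c a))

/-- Each product of three indicators is expanded about its mean. The cubic term is absorbed into one
quadratic term by leaving its first factor as the uncentred indicator, so that `quadRem` has only
three kinds of monomial. -/
lemma relErr_eq {a b c : Fin 2} {t : Fin n} (h : mu Θ a b c t ≠ 0) (g : AdjArray n) :
    relErr Θ a b c t g = linForm Θ (centInd Θ g) a b c t + quadRem Θ a b c t g := by
  have e : pathAvg (ind g) a b c t t - mu Θ a b c t = 1 / (n : ℝ) ^ 2 *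
      ∑ i ∈ ({t}ᶜ : Finset (Fin n)), ∑ j ∈ ({t, i}ᶜ : Finset (Fin n)),
        (ind g i t c a * ind g i j c b * ind g t j c a
          - dyadProb Θ i t c a * dyadProb Θ i j c b * dyadProb Θ t j c a) := by
    rw [pathAvg, mu, pathSum_self, ← mul_sub, tripleSum, tripleSum]
    simp only [Finset.sum_sub_distrib]
  have e' : relErr Θ a b c t g = 1 / mu Θ a b c t * (pathAvg (ind g) a b c t t - mu Θ a b c t) := by
    rw [relErr]; field_simp
  rw [e', e, linForm, quadRem, ← mul_add, ← mul_add]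
  congr 2
  simp only [← Finset.sum_add_distrib]
  refine Finset.sum_congr rfl fun i _ => Finset.sum_congr rfl fun j _ => ?_
  simp only [centInd]
  ring

/-- The weight of the dyad of `i` and `t` as first arm of the triangles at `t`. -/
def armLeft (a b c : Fin 2) (t i : Fin n) : ℝ :=
  ∑ j ∈ ({i, t}ᶜ : Finset (Fin n)), dyadProb Θ t j c a * dyadProb Θ i j c b

/-- The weight of the dyad of `i` and `t` as last arm of the triangles at `t`. -/
def armRight (a b c : Fin 2) (t i : Fin n) : ℝ :=
  ∑ j ∈ ({i, t}ᶜ : Finset (Fin n)), dyadProb Θ j t c a * dyadProb Θ j i c b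

/-- The contribution of the dyad of `i` and `t` to the relative error at `t`. -/
def starTerm (a b c : Fin 2) (i t : Fin n) (g : AdjArray n) : ℝ :=
  1 / mu Θ a b c t * (1 / (n : ℝ) ^ 2 *
    (centInd Θ g i t c a * armLeft Θ a b c t i + centInd Θ g t i c a * armRight Θ a b c t i))

/-- The contribution of the dyads at `t` to the relative error at `t`. -/
def starSum (a b c : Fin 2) (t : Fin n) (g : AdjArray n) : ℝ :=
  ∑ i ∈ ({t}ᶜ : Finset (Fin n)), starTerm Θ a b c i t g

/-- The linear contribution of the dyads not at `t` to the relative error at `t`. -/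
def midSum (a b c : Fin 2) (t : Fin n) (g : AdjArray n) : ℝ :=
  1 / mu Θ a b c t * (1 / (n : ℝ) ^ 2 *
    ∑ i ∈ ({t}ᶜ : Finset (Fin n)), ∑ j ∈ ({t, i}ᶜ : Finset (Fin n)),
      dyadProb Θ i t c a * centInd Θ g i j c b * dyadProb Θ t j c a)

lemma linForm_centInd (a b c : Fin 2) (t : Fin n) (g : AdjArray n) :
    linForm Θ (centInd Θ g) a b c t = starSum Θ a b c t g + midSum Θ a b c t g := by
  -- Exchanging i and j attaches the last arm to the dyad {i,t} as well, so both arms enter the same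
  -- `starTerm`.
  have e : ∑ i ∈ ({t}ᶜ : Finset (Fin n)), ∑ j ∈ ({t, i}ᶜ : Finset (Fin n)),
      dyadProb Θ i t c a * dyadProb Θ i j c b * centInd Θ g t j c a
      = ∑ i ∈ ({t}ᶜ : Finset (Fin n)), ∑ j ∈ ({t, i}ᶜ : Finset (Fin n)),
      dyadProb Θ j t c a * dyadProb Θ j i c b * centInd Θ g t i c a := by
    refine Finset.sum_comm' ?_
    intro i j
    simp only [Finset.mem_compl, Finset.mem_insert, Finset.mem_singleton, not_or]
    grind
  rw [linForm, starSum, midSum]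
  simp only [starTerm, ← Finset.mul_sum]
  rw [← mul_add, ← mul_add]
  congr 2
  simp only [Finset.sum_add_distrib]
  rw [e]
  simp only [armLeft, armRight, Finset.mul_sum]
  have e1 : ∀ i, ({i, t}ᶜ : Finset (Fin n)) = {t, i}ᶜ := fun i => by rw [Finset.pair_comm]
  simp only [e1]
  have e2 : ∀ x y z x' z' : ℝ, x = x' → z = z' → x + y + z = x' + z' + y := by
    intro x y z x' z' h h'; rw [h, h']; ring
  refine e2 _ _ _ _ _ ?_ ?_
  · exact Finset.sum_congr rfl fun i _ => Finset.sum_congr rfl fun j _ => by ring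
  · exact Finset.sum_congr rfl fun i _ => Finset.sum_congr rfl fun j _ => by ring

lemma dyadFun_starTerm (a b c : Fin 2) : DyadFun (starTerm Θ a b c) := by
  intro i t u v h h'
  have h1 := dyadFun_centInd Θ c a i t u v h h'
  have h2 := dyadFun_centInd Θ c a t i u v (fun e => h' ⟨e.2, e.1⟩) (fun e => h ⟨e.2, e.1⟩)
  exact h1.comp₂ (fun x y => 1 / mu Θ a b c t * (1 / (n : ℝ) ^ 2 *
    (x * armLeft Θ a b c t i + y * armRight Θ a b c t i))) h2

lemma centred_starTerm (a b c : Fin 2) : Centred Θ (starTerm Θ a b c) := by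
  intro i t h
  have h1 := centred_centInd Θ c a i t h
  have h2 := centred_centInd Θ a c i t h
  funext g
  have h3 := congrFun h1 g
  have h4 := congrFun h2 g
  simp only [resample, starTerm, centInd_comm Θ _ t i, smul_eq_mul, Fin.sum_univ_two,
    Pi.zero_apply] at h3 h4 ⊢
  linear_combination (1 / mu Θ a b c t * (1 / (n : ℝ) ^ 2) * armLeft Θ a b c t i) * h3
    + (1 / mu Θ a b c t * (1 / (n : ℝ) ^ 2) * armRight Θ a b c t i) * h4

variable {Θ} {m : ℝ} {a b c : Fin 2}

lemma abs_armLeft_le (t i : Fin n) : |armLeft Θ a b c t i| ≤ n := by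
  have := abs_sum_le_mul ({i, t}ᶜ : Finset (Fin n))
    (fun j => dyadProb Θ t j c a * dyadProb Θ i j c b) zero_le_one (fun j _ => by
      rw [abs_mul]
      exact mul_le_one₀ (abs_dyadProb_le_one Θ _ _ _ _) (abs_nonneg _)
        (abs_dyadProb_le_one Θ _ _ _ _))
  rwa [Fintype.card_fin, mul_one] at this

lemma abs_armRight_le (t i : Fin n) : |armRight Θ a b c t i| ≤ n := by
  have := abs_sum_le_mul ({i, t}ᶜ : Finset (Fin n))
    (fun j => dyadProb Θ j t c a * dyadProb Θ j i c b) zero_le_one (fun j _ => by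
      rw [abs_mul]
      exact mul_le_one₀ (abs_dyadProb_le_one Θ _ _ _ _) (abs_nonneg _)
        (abs_dyadProb_le_one Θ _ _ _ _))
  rwa [Fintype.card_fin, mul_one] at this

lemma abs_one_div_mu_le (hm : 0 < m) (hmu : ∀ t, m ≤ mu Θ a b c t) (t : Fin n) :
    |1 / mu Θ a b c t| ≤ 1 / m := by
  have h := hmu t
  rw [abs_of_pos (one_div_pos.2 (hm.trans_le h))]
  exact one_div_le_one_div_of_le hm h

lemma abs_starTerm_le (hn : 0 < n) (hm : 0 < m) (hmu : ∀ t, m ≤ mu Θ a b c t) (i t : Fin n)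
    (g : AdjArray n) : |starTerm Θ a b c i t g| ≤ 2 / (m * n) := by
  have hn' : (0 : ℝ) < n := by exact_mod_cast hn
  have h1 : |centInd Θ g i t c a * armLeft Θ a b c t i
      + centInd Θ g t i c a * armRight Θ a b c t i| ≤ 2 * n := by
    refine (abs_add_le _ _).trans ?_
    rw [abs_mul, abs_mul]
    have h2 := mul_le_mul (abs_centInd_le_one Θ g i t c a) (abs_armLeft_le (Θ := Θ) (a := a)
      (b := b) (c := c) t i) (abs_nonneg _) zero_le_one
    have h3 := mul_le_mul (abs_centInd_le_one Θ g t i c a) (abs_armRight_le (Θ := Θ) (a := a)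
      (b := b) (c := c) t i) (abs_nonneg _) zero_le_one
    linarith
  rw [starTerm, abs_mul, abs_mul, abs_of_nonneg (by positivity : (0 : ℝ) ≤ 1 / (n : ℝ) ^ 2)]
  calc _ ≤ 1 / m * (1 / (n : ℝ) ^ 2 * (2 * n)) :=
        mul_le_mul (abs_one_div_mu_le hm hmu t)
          (mul_le_mul_of_nonneg_left h1 (by positivity)) (by positivity) (by positivity)
    _ = 2 / (m * n) := by field_simp

lemma abs_triangle_le (hm : 0 < m) (hmu : ∀ t, m ≤ mu Θ a b c t) (t : Fin n)
    {x y z : ℝ} (hx : |x| ≤ 1) (hy : |y| ≤ 1) (hz : |z| ≤ 1) :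
    |1 / mu Θ a b c t * (1 / (n : ℝ) ^ 2) * (x * y * z)| ≤ 1 / m * (1 / (n : ℝ) ^ 2) := by
  rw [abs_mul, abs_mul, abs_mul, abs_mul, abs_of_nonneg (by positivity : (0 : ℝ) ≤ 1 / (n : ℝ) ^ 2)]
  have h1 : |x| * |y| * |z| ≤ 1 := mul_le_one₀ (mul_le_one₀ hx (abs_nonneg _) hy) (abs_nonneg _) hz
  calc _ ≤ 1 / m * (1 / (n : ℝ) ^ 2) * 1 :=
        mul_le_mul (mul_le_mul_of_nonneg_right (abs_one_div_mu_le hm hmu t) (by positivity)) h1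
          (by positivity) (by positivity)
    _ = _ := mul_one _

lemma expect_sq_add_three_le (f₁ f₂ f₃ : AdjArray n → ℝ) {x : ℝ}
    (h₁ : expect Θ (fun g => f₁ g ^ 2) ≤ x) (h₂ : expect Θ (fun g => f₂ g ^ 2) ≤ x)
    (h₃ : expect Θ (fun g => f₃ g ^ 2) ≤ x) :
    expect Θ (fun g => (f₁ g + f₂ g + f₃ g) ^ 2) ≤ 9 * x := by
  have : expect Θ (fun g => (f₁ g + f₂ g + f₃ g) ^ 2)
      ≤ expect Θ (fun g => 3 * ((f₁ g ^ 2 + f₂ g ^ 2) + f₃ g ^ 2)) := by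
    refine expect_mono Θ fun g _ => ?_
    nlinarith [sq_nonneg (f₁ g - f₂ g), sq_nonneg (f₁ g - f₃ g), sq_nonneg (f₂ g - f₃ g)]
  rw [expect_mul_left, expect_add, expect_add] at this
  linarith

/-- Every monomial has two centred edges, and these cover all three vertices, so there is
cancellation over t too. The constant is 9 · 27, for three sums of n³ monomials of size 1/(m n²). -/
lemma expect_sq_sum_quadRem_le (hn : 0 < n) (hm : 0 < m) (hmu : ∀ t, m ≤ mu Θ a b c t) :
    expect Θ (fun g => (∑ t, quadRem Θ a b c t g) ^ 2) ≤ 243 / (m ^ 2 * n) := by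
  have hn' : (0 : ℝ) < n := by exact_mod_cast hn
  set w : Fin n → Fin n → Fin n → ℝ := fun t _ _ => 1 / mu Θ a b c t * (1 / (n : ℝ) ^ 2) with hw
  have h0 : ∀ g, ∑ t, quadRem Θ a b c t g
      = sumTriples (fun t i j => w t i j *
          (centInd Θ g i t c a * centInd Θ g i j c b * dyadProb Θ t j c a))
        + sumTriples (fun t i j => w t i j *
          (centInd Θ g i t c a * dyadProb Θ i j c b * centInd Θ g t j c a))
        + sumTriples (fun t i j => w t i j *
          (ind g i t c a * centInd Θ g i j c b * centInd Θ g t j c a)) := by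
    intro g
    simp only [quadRem, sumTriples, hw, ← Finset.sum_add_distrib, Finset.mul_sum]
    refine Finset.sum_congr rfl fun t _ => Finset.sum_congr rfl fun i _ =>
        Finset.sum_congr rfl fun j _ => ?_
    ring
  have hc : (0 : ℝ) ≤ 1 / m * (1 / (n : ℝ) ^ 2) := by positivity
  simp only [h0]
  refine (expect_sq_add_three_le (Θ := Θ) _ _ _
    (expect_sq_sumTriples_le (Θ := Θ) (dyadFun_centInd Θ c a) (dyadFun_centInd Θ c b)
      (dyadFun_const (fun i j => dyadProb Θ i j c a)) (.inl (centred_centInd Θ c a))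
      (.inl (centred_centInd Θ c b)) (.inl (centred_centInd Θ c a)) w hc ?_)
    (expect_sq_sumTriples_le (Θ := Θ) (dyadFun_centInd Θ c a)
      (dyadFun_const (fun i j => dyadProb Θ i j c b)) (dyadFun_centInd Θ c a)
      (.inl (centred_centInd Θ c a))
      (.inr (centred_centInd Θ c a)) (.inl (centred_centInd Θ c a)) w hc ?_)
    (expect_sq_sumTriples_le (Θ := Θ) (dyadFun_ind c a) (dyadFun_centInd Θ c b)
      (dyadFun_centInd Θ c a) (.inr (centred_centInd Θ c b))
      (.inl (centred_centInd Θ c b)) (.inr (centred_centInd Θ c a)) w hc ?_)).trans ?_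
  · intro t i j g
    exact abs_triangle_le hm hmu t (abs_centInd_le_one _ _ _ _ _ _) (abs_centInd_le_one _ _ _ _ _ _)
      (abs_dyadProb_le_one _ _ _ _ _)
  · intro t i j g
    exact abs_triangle_le hm hmu t (abs_centInd_le_one _ _ _ _ _ _) (abs_dyadProb_le_one _ _ _ _ _)
      (abs_centInd_le_one _ _ _ _ _ _)
  · intro t i j g
    exact abs_triangle_le hm hmu t (abs_ind_le_one _ _ _ _ _) (abs_centInd_le_one _ _ _ _ _ _)
      (abs_centInd_le_one _ _ _ _ _ _)
  · refine le_of_eq ?_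
    field_simp
    ring

lemma expect_sq_quadRem_le (hn : 0 < n) (hm : 0 < m) (hmu : ∀ t, m ≤ mu Θ a b c t) (t : Fin n) :
    expect Θ (fun g => quadRem Θ a b c t g ^ 2) ≤ 81 / (m ^ 2 * (n : ℝ) ^ 2) := by
  have hn' : (0 : ℝ) < n := by exact_mod_cast hn
  set w : Fin n → Fin n → ℝ := fun _ _ => 1 / mu Θ a b c t * (1 / (n : ℝ) ^ 2) with hw
  have h0 : ∀ g, quadRem Θ a b c t g
      = (∑ i ∈ ({t}ᶜ : Finset (Fin n)), ∑ j ∈ ({t, i}ᶜ : Finset (Fin n)), w i j *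
          (centInd Θ g i t c a * centInd Θ g i j c b * dyadProb Θ t j c a))
        + (∑ i ∈ ({t}ᶜ : Finset (Fin n)), ∑ j ∈ ({t, i}ᶜ : Finset (Fin n)), w i j *
          (centInd Θ g i t c a * dyadProb Θ i j c b * centInd Θ g t j c a))
        + (∑ i ∈ ({t}ᶜ : Finset (Fin n)), ∑ j ∈ ({t, i}ᶜ : Finset (Fin n)), w i j *
          (ind g i t c a * centInd Θ g i j c b * centInd Θ g t j c a)) := by
    intro g
    simp only [quadRem, hw, ← Finset.sum_add_distrib, Finset.mul_sum]
    refine Finset.sum_congr rfl fun i _ => Finset.sum_congr rfl fun j _ => ?_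
    ring
  have hc : (0 : ℝ) ≤ 1 / m * (1 / (n : ℝ) ^ 2) := by positivity
  simp only [h0]
  refine (expect_sq_add_three_le (Θ := Θ) _ _ _
    (expect_sq_sum_pairs_le (Θ := Θ) (dyadFun_centInd Θ c a) (dyadFun_centInd Θ c b)
      (dyadFun_const (fun i j => dyadProb Θ i j c a)) (.inl (centred_centInd Θ c a))
      (.inl (centred_centInd Θ c b)) t w hc ?_)
    (expect_sq_sum_pairs_le (Θ := Θ) (dyadFun_centInd Θ c a)
      (dyadFun_const (fun i j => dyadProb Θ i j c b)) (dyadFun_centInd Θ c a)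
      (.inl (centred_centInd Θ c a))
      (.inr (centred_centInd Θ c a)) t w hc ?_)
    (expect_sq_sum_pairs_le (Θ := Θ) (dyadFun_ind c a) (dyadFun_centInd Θ c b)
      (dyadFun_centInd Θ c a) (.inr (centred_centInd Θ c b))
      (.inl (centred_centInd Θ c b)) t w hc ?_)).trans ?_
  · intro i j g
    exact abs_triangle_le hm hmu t (abs_centInd_le_one _ _ _ _ _ _) (abs_centInd_le_one _ _ _ _ _ _)
      (abs_dyadProb_le_one _ _ _ _ _)
  · intro i j g
    exact abs_triangle_le hm hmu t (abs_centInd_le_one _ _ _ _ _ _) (abs_dyadProb_le_one _ _ _ _ _)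
      (abs_centInd_le_one _ _ _ _ _ _)
  · intro i j g
    exact abs_triangle_le hm hmu t (abs_ind_le_one _ _ _ _ _) (abs_centInd_le_one _ _ _ _ _ _)
      (abs_centInd_le_one _ _ _ _ _ _)
  · refine le_of_eq ?_
    field_simp
    ring

/-- The centred middle edge covers both free nodes, which makes `midSum` of order 1/n, against
n^(-1/2) for `starSum`. It therefore does not contribute to the bias. -/
lemma expect_sq_midSum_le (hn : 0 < n) (hm : 0 < m) (hmu : ∀ t, m ≤ mu Θ a b c t) (t : Fin n) :
    expect Θ (fun g => midSum Θ a b c t g ^ 2) ≤ 9 / (m ^ 2 * (n : ℝ) ^ 2) := by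
  have hn' : (0 : ℝ) < n := by exact_mod_cast hn
  have h0 : ∀ g, midSum Θ a b c t g
      = ∑ i ∈ ({t}ᶜ : Finset (Fin n)), ∑ j ∈ ({t, i}ᶜ : Finset (Fin n)),
        1 / mu Θ a b c t * (1 / (n : ℝ) ^ 2) *
          (dyadProb Θ i t c a * centInd Θ g i j c b * dyadProb Θ t j c a) := by
    intro g
    simp only [midSum, Finset.mul_sum, mul_assoc]
  simp only [h0]
  refine (expect_sq_sum_pairs_le (Θ := Θ) (dyadFun_const (fun i j => dyadProb Θ i j c a))
    (dyadFun_centInd Θ c b) (dyadFun_const (fun i j => dyadProb Θ i j c a))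
    (.inr (centred_centInd Θ c b)) (.inl (centred_centInd Θ c b)) t
    (fun _ _ => 1 / mu Θ a b c t * (1 / (n : ℝ) ^ 2))
    (by positivity : (0 : ℝ) ≤ 1 / m * (1 / (n : ℝ) ^ 2)) ?_).trans ?_
  · intro i j g
    exact abs_triangle_le hm hmu t (abs_dyadProb_le_one _ _ _ _ _) (abs_centInd_le_one _ _ _ _ _ _)
      (abs_dyadProb_le_one _ _ _ _ _)
  · refine le_of_eq ?_
    field_simp

lemma expect_sq_starSum (t : Fin n) :
    expect Θ (fun g => starSum Θ a b c t g ^ 2)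
      = ∑ i ∈ ({t}ᶜ : Finset (Fin n)), expect Θ (fun g => starTerm Θ a b c i t g ^ 2) :=
  expect_sq_sum_star (Θ := Θ) (dyadFun_starTerm Θ a b c) (centred_starTerm Θ a b c) t

lemma sq_starTerm_le (hn : 0 < n) (hm : 0 < m) (hmu : ∀ t, m ≤ mu Θ a b c t) (i t : Fin n)
    (g : AdjArray n) : starTerm Θ a b c i t g ^ 2 ≤ 4 / (m ^ 2 * (n : ℝ) ^ 2) := by
  rw [← sq_abs]
  refine (pow_le_pow_left₀ (abs_nonneg _) (abs_starTerm_le hn hm hmu i t g) 2).trans (le_of_eq ?_)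
  rw [div_pow, mul_pow]; norm_num

lemma expect_sq_starSum_le (hn : 0 < n) (hm : 0 < m) (hmu : ∀ t, m ≤ mu Θ a b c t) (t : Fin n) :
    expect Θ (fun g => starSum Θ a b c t g ^ 2) ≤ 4 / (m ^ 2 * n) := by
  have hn' : (0 : ℝ) < n := by exact_mod_cast hn
  rw [expect_sq_starSum]
  calc _ ≤ ∑ i ∈ ({t}ᶜ : Finset (Fin n)), 4 / (m ^ 2 * (n : ℝ) ^ 2) := by
        refine Finset.sum_le_sum fun i _ => ?_
        rw [← expect_const Θ (4 / (m ^ 2 * (n : ℝ) ^ 2))]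
        exact expect_mono Θ fun g _ => sq_starTerm_le hn hm hmu i t g
    _ ≤ ∑ i : Fin n, 4 / (m ^ 2 * (n : ℝ) ^ 2) :=
        Finset.sum_le_sum_of_subset_of_nonneg (Finset.subset_univ _) fun _ _ _ => by positivity
    _ = _ := by
        rw [Finset.sum_const, Finset.card_univ, Fintype.card_fin, nsmul_eq_mul]
        field_simp

/-- With y = `starSum` and z the rest, the cross term obeys |2yz| ≤ y²/s + s z². The choice s = √n
balances y² of order 1/n against z² of order 1/n², and the sum over t is still O(n^(-1/2)). -/
lemma expect_abs_sq_relErr_sub_le (hn : 0 < n) (hm : 0 < m) (hmu : ∀ t, m ≤ mu Θ a b c t)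
    (t : Fin n) :
    expect Θ (fun g => |relErr Θ a b c t g ^ 2 - starSum Θ a b c t g ^ 2|)
      ≤ 364 / (m ^ 2 * (n * √n)) := by
  have hn' : (1 : ℝ) ≤ n := by exact_mod_cast hn
  set s := √(n : ℝ) with hs
  have hs1 : 1 ≤ s := Real.one_le_sqrt.2 hn'
  have hs2 : s ^ 2 = n := Real.sq_sqrt (by positivity)
  have hs0 : 0 < s := by linarith
  have hmu0 : mu Θ a b c t ≠ 0 := (hm.trans_le (hmu t)).ne'
  have h1 : ∀ g, |relErr Θ a b c t g ^ 2 - starSum Θ a b c t g ^ 2|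
      ≤ 1 / s * starSum Θ a b c t g ^ 2
        + (s + 1) * (2 * (midSum Θ a b c t g ^ 2 + quadRem Θ a b c t g ^ 2)) := by
    intro g
    rw [relErr_eq Θ hmu0, linForm_centInd]
    set y := starSum Θ a b c t g
    set u := midSum Θ a b c t g
    set v := quadRem Θ a b c t g
    have e : (y + u + v) ^ 2 - y ^ 2 = 2 * (y * (u + v)) + (u + v) ^ 2 := by ring
    have k0 : (u + v) ^ 2 ≤ 2 * (u ^ 2 + v ^ 2) := by nlinarith [sq_nonneg (u - v)]
    have k1 : |2 * (y * (u + v))| ≤ 1 / s * y ^ 2 + s * (u + v) ^ 2 := by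
      rw [abs_le]
      have i1 := sq_nonneg (y + s * (u + v))
      have i2 := sq_nonneg (y - s * (u + v))
      have e1 : 1 / s * y ^ 2 + s * (u + v) ^ 2 + 2 * (y * (u + v))
          = 1 / s * (y + s * (u + v)) ^ 2 := by field_simp; ring
      have e2 : 1 / s * y ^ 2 + s * (u + v) ^ 2 - 2 * (y * (u + v))
          = 1 / s * (y - s * (u + v)) ^ 2 := by field_simp; ring
      have p1 : 0 ≤ 1 / s * (y + s * (u + v)) ^ 2 := by positivity
      have p2 : 0 ≤ 1 / s * (y - s * (u + v)) ^ 2 := by positivity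
      constructor <;> linarith
    rw [e]
    refine (abs_add_le _ _).trans ?_
    rw [abs_of_nonneg (sq_nonneg (u + v))]
    have k2 := mul_le_mul_of_nonneg_left k0 (by linarith : 0 ≤ s + 1)
    linarith
  refine (expect_mono Θ fun g _ => h1 g).trans ?_
  rw [expect_add, expect_mul_left, expect_mul_left, expect_mul_left, expect_add]
  have a1 := expect_sq_starSum_le hn hm hmu t
  have a2 := expect_sq_midSum_le hn hm hmu t
  have a3 := expect_sq_quadRem_le hn hm hmu t
  have b1 : 1 / s * expect Θ (fun g => starSum Θ a b c t g ^ 2) ≤ 1 / s * (4 / (m ^ 2 * n)) :=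
    mul_le_mul_of_nonneg_left a1 (by positivity)
  have b2 : (s + 1) * (2 * (expect Θ (fun g => midSum Θ a b c t g ^ 2)
      + expect Θ (fun g => quadRem Θ a b c t g ^ 2)))
      ≤ (2 * s) * (2 * (9 / (m ^ 2 * (n : ℝ) ^ 2) + 81 / (m ^ 2 * (n : ℝ) ^ 2))) := by
    have hnn : 0 ≤ expect Θ (fun g => midSum Θ a b c t g ^ 2)
        + expect Θ (fun g => quadRem Θ a b c t g ^ 2) :=
      add_nonneg (expect_nonneg Θ fun _ => sq_nonneg _) (expect_nonneg Θ fun _ => sq_nonneg _)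
    exact mul_le_mul (by linarith) (by linarith) (by positivity) (by positivity)
  refine (add_le_add b1 b2).trans (le_of_eq ?_)
  rw [← hs2]
  field_simp
  ring

/-- The square of a star splits into centred squares of single dyads (`B`) and products of two
different arms (`D`). The latter are triangle monomials with trivial middle edge and two centred
edges, so the general moment bounds apply to both. -/
lemma expect_sq_sum_starSum_sq_sub_le (hn : 0 < n) (hm : 0 < m) (hmu : ∀ t, m ≤ mu Θ a b c t) :
    expect Θ (fun g => (∑ t, (starSum Θ a b c t g ^ 2
        - expect Θ (fun g => starSum Θ a b c t g ^ 2))) ^ 2) ≤ 992 / (m ^ 4 * n) := by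
  have hn' : (1 : ℝ) ≤ n := by exact_mod_cast hn
  set A : Fin n → Fin n → AdjArray n → ℝ := fun i t g => starTerm Θ a b c i t g ^ 2
    - expect Θ (fun g => starTerm Θ a b c i t g ^ 2) with hA
  set B : AdjArray n → ℝ := fun g => ∑ t, ∑ i ∈ ({t}ᶜ : Finset (Fin n)), A i t g with hB
  set D : AdjArray n → ℝ := fun g => sumTriples fun t i j =>
    (fun _ _ _ => (1 : ℝ)) t i j * (starTerm Θ a b c i t g * 1 * starTerm Θ a b c j t g) with hD
  have h0 : ∀ g, ∑ t, (starSum Θ a b c t g ^ 2 - expect Θ (fun g => starSum Θ a b c t g ^ 2))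
      = B g + D g := by
    intro g
    simp only [hB, hD, sumTriples, ← Finset.sum_add_distrib]
    refine Finset.sum_congr rfl fun t _ => ?_
    rw [expect_sq_starSum, starSum, sq, Finset.sum_mul_sum, ← Finset.sum_sub_distrib]
    refine Finset.sum_congr rfl fun i hi => ?_
    have e : ({t}ᶜ : Finset (Fin n)) = insert i ({t, i}ᶜ) := by
      simp only [Finset.mem_compl, Finset.mem_singleton] at hi
      ext j
      simp only [Finset.mem_compl, Finset.mem_singleton, Finset.mem_insert, not_or]
      by_cases hj : j = i
      · simp [hj, hi]
      · simp [hj]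
    conv_lhs => rw [e]
    rw [Finset.sum_insert (by simp)]
    simp only [hA, one_mul, mul_one]
    ring
  have hbd : ∀ i t, 0 ≤ expect Θ (fun g => starTerm Θ a b c i t g ^ 2) ∧
      expect Θ (fun g => starTerm Θ a b c i t g ^ 2) ≤ 4 / (m ^ 2 * (n : ℝ) ^ 2) := by
    intro i t
    refine ⟨expect_nonneg Θ fun _ => sq_nonneg _, ?_⟩
    rw [← expect_const Θ (4 / (m ^ 2 * (n : ℝ) ^ 2))]
    exact expect_mono Θ fun g _ => sq_starTerm_le hn hm hmu i t g
  have h1 : expect Θ (fun g => B g ^ 2) ≤ 4 * (4 / (m ^ 2 * (n : ℝ) ^ 2)) ^ 2 * (n : ℝ) ^ 2 := by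
    refine expect_sq_sum_dyadFun_le (Θ := Θ) ?_ ?_ (by positivity) ?_
    · intro i t u v h h'
      exact (dyadFun_starTerm Θ a b c i t u v h h').comp
        (fun x => x ^ 2 - expect Θ (fun g => starTerm Θ a b c i t g ^ 2))
    · intro i t hit
      -- Writing the term as a function of the two entries of its dyad makes its expectation and its
      -- resampled value the same finite sum.
      have hF : ∃ F : Fin 2 → Fin 2 → ℝ, starTerm Θ a b c i t = fun g => F (g i t) (g t i) := by
        refine ⟨fun x y => 1 / mu Θ a b c t * (1 / (n : ℝ) ^ 2 *
          (((if x = c ∧ y = a then 1 else 0) - dyadProb Θ i t c a) * armLeft Θ a b c t i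
          + ((if y = c ∧ x = a then 1 else 0) - dyadProb Θ t i c a) * armRight Θ a b c t i)), ?_⟩
        rfl
      obtain ⟨F, hF⟩ := hF
      simp only [hA, hF]
      have e1 := expect_apply Θ (fun x y => F x y ^ 2) hit
      have e2 := resample_apply Θ (fun x y => F x y ^ 2
        - ∑ a, ∑ b, dyadProb Θ i t a b • F a b ^ 2) hit
      rw [e1, e2]
      funext g
      have e3 := sum_dyadProb Θ i t
      simp only [smul_eq_mul, Fin.sum_univ_two, Pi.zero_apply] at e3 ⊢
      linear_combination (-(dyadProb Θ i t 0 0 * F 0 0 ^ 2 + dyadProb Θ i t 0 1 * F 0 1 ^ 2 +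
        (dyadProb Θ i t 1 0 * F 1 0 ^ 2 + dyadProb Θ i t 1 1 * F 1 1 ^ 2))) * e3
    · intro i t g
      have h1 := sq_starTerm_le hn hm hmu i t g
      have h2 := sq_nonneg (starTerm Θ a b c i t g)
      obtain ⟨h3, h4⟩ := hbd i t
      rw [abs_le]
      constructor <;> simp only [hA] <;> linarith
  have h2 : expect Θ (fun g => D g ^ 2) ≤ 27 * (4 / (m ^ 2 * (n : ℝ) ^ 2)) ^ 2 * (n : ℝ) ^ 3 := by
    refine expect_sq_sumTriples_le (Θ := Θ) (A := starTerm Θ a b c) (B := fun _ _ _ => 1)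
      (D := fun t j g => starTerm Θ a b c j t g) (dyadFun_starTerm Θ a b c)
      (dyadFun_const fun _ _ => 1) ?_ (.inl (centred_starTerm Θ a b c)) (.inr ?_)
      (.inl (centred_starTerm Θ a b c)) (fun _ _ _ => 1) (by positivity) ?_
    · intro t j u v h h'
      exact dyadFun_starTerm Θ a b c j t u v (fun e => h' ⟨e.2, e.1⟩) (fun e => h ⟨e.2, e.1⟩)
    · intro t j htj
      rw [resample_comm_nodes Θ htj]
      exact centred_starTerm Θ a b c j t htj.symm
    · intro t i j g
      rw [one_mul, mul_one, abs_mul]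
      refine (mul_le_mul (abs_starTerm_le hn hm hmu i t g) (abs_starTerm_le hn hm hmu j t g)
        (abs_nonneg _) (by positivity)).trans (le_of_eq ?_)
      field_simp; norm_num
  simp only [h0]
  have h3 : expect Θ (fun g => (B g + D g) ^ 2)
      ≤ expect Θ (fun g => 2 * (B g ^ 2 + D g ^ 2)) :=
    expect_mono Θ fun g _ => by nlinarith [sq_nonneg (B g - D g)]
  rw [expect_mul_left, expect_add] at h3
  refine h3.trans ((mul_le_mul_of_nonneg_left (add_le_add h1 h2) (by norm_num)).trans ?_)
  have h4 : 4 * (4 / (m ^ 2 * (n : ℝ) ^ 2)) ^ 2 * (n : ℝ) ^ 2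
      ≤ 4 * (4 / (m ^ 2 * (n : ℝ) ^ 2)) ^ 2 * (n : ℝ) ^ 3 :=
    mul_le_mul_of_nonneg_left (pow_le_pow_right₀ hn' (by norm_num)) (by positivity)
  calc 2 * (4 * (4 / (m ^ 2 * (n : ℝ) ^ 2)) ^ 2 * (n : ℝ) ^ 2
        + 27 * (4 / (m ^ 2 * (n : ℝ) ^ 2)) ^ 2 * (n : ℝ) ^ 3)
      ≤ 2 * (4 * (4 / (m ^ 2 * (n : ℝ) ^ 2)) ^ 2 * (n : ℝ) ^ 3
        + 27 * (4 / (m ^ 2 * (n : ℝ) ^ 2)) ^ 2 * (n : ℝ) ^ 3) := by linarith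
    _ = 992 / (m ^ 4 * n) := by field_simp; ring

end Expansion

section Bias

variable {n : ℕ} (Θ : Param n)

/-! ### The bias -/

lemma expect_centInd_sq {i t : Fin n} (h : i ≠ t) (a b : Fin 2) :
    expect Θ (fun g => centInd Θ g i t a b ^ 2)
      = dyadProb Θ i t a b * (1 - dyadProb Θ i t a b) := by
  have e : ∀ g, centInd Θ g i t a b ^ 2
      = (1 - 2 * dyadProb Θ i t a b) * ind g i t a b + dyadProb Θ i t a b ^ 2 := by
    intro g
    have : ind g i t a b ^ 2 = ind g i t a b := by unfold ind; split_ifs <;> norm_num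
    rw [centInd]; linear_combination this
  simp only [e]
  rw [expect_add, expect_mul_left, expect_ind Θ h, expect_const]
  ring

lemma expect_centInd_mul {i t : Fin n} (h : i ≠ t) {a b a' b' : Fin 2}
    (hab : ¬ (a = a' ∧ b = b')) :
    expect Θ (fun g => centInd Θ g i t a b * centInd Θ g i t a' b')
      = -(dyadProb Θ i t a b * dyadProb Θ i t a' b') := by
  have e : ∀ g, centInd Θ g i t a b * centInd Θ g i t a' b'
      = (-dyadProb Θ i t a b) * ind g i t a' b' + ((-dyadProb Θ i t a' b') * ind g i t a b
        + dyadProb Θ i t a b * dyadProb Θ i t a' b') := by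
    intro g
    have : ind g i t a b * ind g i t a' b' = 0 := by
      unfold ind
      split_ifs with h1 h2
      · exact absurd ⟨h1.1.symm.trans h2.1, h1.2.symm.trans h2.2⟩ hab
      all_goals norm_num
    simp only [centInd]; linear_combination this
  simp only [e]
  rw [expect_add, expect_add, expect_mul_left, expect_mul_left, expect_ind Θ h, expect_ind Θ h,
    expect_const]
  ring

lemma expect_sq_starTerm (a b c : Fin 2) (i t : Fin n) :
    expect Θ (fun g => starTerm Θ a b c i t g ^ 2) = (1 / mu Θ a b c t * (1 / (n : ℝ) ^ 2)) ^ 2 *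
      (armLeft Θ a b c t i ^ 2 * expect Θ (fun g => centInd Θ g i t c a ^ 2)
        + armRight Θ a b c t i ^ 2 * expect Θ (fun g => centInd Θ g i t a c ^ 2)
        + 2 * armLeft Θ a b c t i * armRight Θ a b c t i *
          expect Θ (fun g => centInd Θ g i t c a * centInd Θ g i t a c)) := by
  rw [← expect_mul_left, ← expect_mul_left, ← expect_mul_left, ← expect_add, ← expect_add,
    ← expect_mul_left]
  refine expect_congr Θ fun g _ => ?_
  rw [starTerm, centInd_comm Θ g t i]
  ring

lemma zeta1_eq (a b c : Fin 2) (i t : Fin n) :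
    zeta1 Θ a b c i t = 1 / (2 * (n : ℝ) ^ 3) * ((1 / mu Θ a b c t * armLeft Θ a b c t i) ^ 2
      + (1 / mu Θ a b c i * armRight Θ a b c i t) ^ 2) := by
  rw [zeta1, armLeft, armRight, Finset.pair_comm t i]

lemma zeta2_eq (a b c : Fin 2) (i t : Fin n) :
    zeta2 Θ a b c i t = 1 / (n : ℝ) ^ 3 * (1 / mu Θ a b c t * armLeft Θ a b c t i)
      * (1 / mu Θ a b c t * armRight Θ a b c t i) := rfl

/-- The asymptotic bias is the mean of the quadratic terms of the expansion. -/
lemma rhoStar_eq (hn : 0 < n) :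
    (n : ℝ) * rhoStar Θ = ∑ t, (-(1 / 2)) *
      ((expect Θ (fun g => starSum Θ 1 0 1 t g ^ 2) - expect Θ (fun g => starSum Θ 0 1 1 t g ^ 2))
      - (expect Θ (fun g => starSum Θ 1 0 0 t g ^ 2)
        - expect Θ (fun g => starSum Θ 0 1 0 t g ^ 2))) := by
  have hn' : (n : ℝ) ≠ 0 := by exact_mod_cast hn.ne'
  simp only [expect_sq_starSum, ← Finset.sum_sub_distrib, Finset.mul_sum]
  rw [sum_sum_compl_singleton, rhoStar, ← sum_dyads, Finset.mul_sum, Finset.mul_sum]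
  refine Finset.sum_congr rfl fun p hp => ?_
  have h1 : p.1 ≠ p.2 := (mem_dyads.1 hp).ne
  simp only [expect_sq_starTerm]
  have h01 : ¬ ((0 : Fin 2) = 1 ∧ (1 : Fin 2) = 0) := by simp
  have h10 : ¬ ((1 : Fin 2) = 0 ∧ (0 : Fin 2) = 1) := by simp
  simp only [← sq]
  rw [expect_centInd_mul Θ h1 h01, expect_centInd_mul Θ h1 h10, expect_centInd_mul Θ h1.symm h01,
    expect_centInd_mul Θ h1.symm h10]
  simp only [expect_centInd_sq Θ h1, expect_centInd_sq Θ h1.symm]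
  rw [dyadProb_comm Θ p.1 p.2 1 1, dyadProb_comm Θ p.1 p.2 0 1, dyadProb_comm Θ p.1 p.2 1 0,
    dyadProb_comm Θ p.1 p.2 0 0]
  simp only [zeta1_eq, zeta2_eq]
  generalize mu Θ 1 0 0 p.1 = m1
  generalize mu Θ 1 0 0 p.2 = m2
  generalize mu Θ 0 1 0 p.1 = m3
  generalize mu Θ 0 1 0 p.2 = m4
  generalize mu Θ 1 0 1 p.1 = m5
  generalize mu Θ 1 0 1 p.2 = m6
  generalize mu Θ 0 1 1 p.1 = m7
  generalize mu Θ 0 1 1 p.2 = m8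
  simp only [one_div]
  -- The only relation between the powers of n that the comparison needs; everything else is a
  -- polynomial identity in independent symbols.
  have e1 : (n : ℝ) * ((n : ℝ) ^ 2)⁻¹ * ((n : ℝ) ^ 3)⁻¹ = (((n : ℝ) ^ 2)⁻¹) ^ 2 := by
    field_simp
  rw [mul_inv]
  generalize ((n : ℝ) ^ 2)⁻¹ = k2 at e1 ⊢
  generalize ((n : ℝ) ^ 3)⁻¹ = k3 at e1 ⊢
  simp only [mul_add, mul_sub, mul_pow, ← e1]
  ring

/-! ### The linear-quadratic expansion in mean -/

/-- The linear part of `n (ρ̂ - ρ)`. -/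
def linPart (g : AdjArray n) : ℝ :=
  1 / (n : ℝ) * ∑ p ∈ dyads n, ∑ a, ∑ b, coef Θ p.2 p.1 a b * centInd Θ g p.2 p.1 a b

/-- The contrast of the four triple-dyad averages that defines `ρ̂`. -/
def contrast (f : Fin 2 → Fin 2 → Fin 2 → Fin n → ℝ) : ℝ :=
  ∑ t, ((f 1 0 1 t - f 0 1 1 t) - (f 1 0 0 t - f 0 1 0 t))

variable {Θ}

/-- The pointwise bound |f| ≤ s f² + 1/s takes the place of Cauchy–Schwarz. -/
lemma expect_abs_le {f : AdjArray n → ℝ} {K s : ℝ} (hs : 0 < s)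
    (h : expect Θ (fun g => f g ^ 2) ≤ K / s ^ 2) : expect Θ (fun g => |f g|) ≤ (1 + K) / s := by
  have h1 : expect Θ (fun g => |f g|) ≤ expect Θ (fun g => s * f g ^ 2 + 1 / s) := by
    refine expect_mono Θ fun g _ => ?_
    have e : s * |f g| ^ 2 + 1 / s - |f g| = 1 / s * ((s * |f g| - 1 / 2) ^ 2 + 3 / 4) := by
      field_simp; ring
    have p : 0 ≤ 1 / s * ((s * |f g| - 1 / 2) ^ 2 + 3 / 4) := by positivity
    rw [sq_abs] at e
    linarith
  rw [expect_add, expect_mul_left, expect_const] at h1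
  have h2 := mul_le_mul_of_nonneg_left h hs.le
  have e : s * (K / s ^ 2) + 1 / s = (1 + K) / s := by field_simp; ring
  linarith

/-- The error of the linear-quadratic expansion of a single type of average. -/
def typeError (Θ : Param n) (a b c : Fin 2) (g : AdjArray n) : ℝ :=
  ∑ t, (relErr Θ a b c t g - relErr Θ a b c t g ^ 2 / 2 - linForm Θ (centInd Θ g) a b c t
    + expect Θ (fun g => starSum Θ a b c t g ^ 2) / 2)

/-- Three errors add up: the quadratic remainder, the replacement of `relErr`² by `starSum`², and
the replacement of `starSum`² by its mean. In the constant, 425 = 243 + 364/2 and 496 = 992/2. -/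
lemma expect_abs_typeError_le {a b c : Fin 2} {m : ℝ} (hn : 0 < n) (hm : 0 < m)
    (hmu : ∀ t, m ≤ mu Θ a b c t) :
    expect Θ (fun g => |typeError Θ a b c g|)
      ≤ (2 + 425 / m ^ 2 + 496 / m ^ 4) / √n := by
  have hn' : (0 : ℝ) < n := by exact_mod_cast hn
  have hs0 : 0 < √(n : ℝ) := Real.sqrt_pos.2 hn'
  have hs2 : √(n : ℝ) ^ 2 = n := Real.sq_sqrt hn'.le
  have h1 : ∀ g, |typeError Θ a b c g| ≤ |∑ t, quadRem Θ a b c t g|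
      + 1 / 2 * ∑ t, |relErr Θ a b c t g ^ 2 - starSum Θ a b c t g ^ 2|
      + 1 / 2 * |∑ t, (starSum Θ a b c t g ^ 2 - expect Θ (fun g => starSum Θ a b c t g ^ 2))| := by
    intro g
    have e : typeError Θ a b c g = ∑ t, quadRem Θ a b c t g
        + (-(1 / 2)) * ∑ t, (relErr Θ a b c t g ^ 2 - starSum Θ a b c t g ^ 2)
        + (-(1 / 2)) * ∑ t, (starSum Θ a b c t g ^ 2
          - expect Θ (fun g => starSum Θ a b c t g ^ 2)) := by
      rw [typeError, Finset.mul_sum, Finset.mul_sum, ← Finset.sum_add_distrib,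
        ← Finset.sum_add_distrib]
      refine Finset.sum_congr rfl fun t _ => ?_
      have := relErr_eq Θ (hm.trans_le (hmu t)).ne' g
      linear_combination this
    rw [e]
    refine (abs_add_three _ _ _).trans ?_
    rw [abs_mul, abs_mul, abs_neg, abs_of_pos (by norm_num : (0 : ℝ) < 1 / 2)]
    gcongr
    exact Finset.abs_sum_le_sum_abs _ _
  refine (expect_mono Θ fun g _ => h1 g).trans ?_
  rw [expect_add, expect_add, expect_mul_left, expect_mul_left, expect_sum]
  have b1 : expect Θ (fun g => |∑ t, quadRem Θ a b c t g|) ≤ (1 + 243 / m ^ 2) / √n := by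
    refine expect_abs_le hs0 ((expect_sq_sum_quadRem_le hn hm hmu).trans (le_of_eq ?_))
    rw [hs2, div_div]
  have b2 : expect Θ (fun g => |∑ t, (starSum Θ a b c t g ^ 2
      - expect Θ (fun g => starSum Θ a b c t g ^ 2))|) ≤ (1 + 992 / m ^ 4) / √n := by
    refine expect_abs_le hs0 ((expect_sq_sum_starSum_sq_sub_le hn hm hmu).trans (le_of_eq ?_))
    rw [hs2, div_div]
  have b3 : ∑ t, expect Θ (fun g => |relErr Θ a b c t g ^ 2 - starSum Θ a b c t g ^ 2|)
      ≤ 364 / m ^ 2 / √n := by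
    refine (Finset.sum_le_sum fun t _ => expect_abs_sq_relErr_sub_le hn hm hmu t).trans
      (le_of_eq ?_)
    rw [Finset.sum_const, Finset.card_univ, Fintype.card_fin, nsmul_eq_mul]
    field_simp
  have e : (2 + 425 / m ^ 2 + 496 / m ^ 4) / √n = (1 + 243 / m ^ 2) / √n
      + 1 / 2 * (364 / m ^ 2 / √n) + 1 / 2 * ((1 + 992 / m ^ 4) / √n) + 1 / 2 / √n := by
    field_simp; ring
  have p : 0 ≤ 1 / 2 / √(n : ℝ) := by positivity
  linarith

/-- The contrast of the relative errors, to second order, is close in mean to its linear part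
plus the bias. -/
lemma expect_abs_contrast_sub_le {m : ℝ} (hn : 0 < n) (hm : 0 < m)
    (hmu : ∀ a b c t, m ≤ mu Θ a b c t) :
    expect Θ (fun g => |contrast (fun a b c t => relErr Θ a b c t g - relErr Θ a b c t g ^ 2 / 2)
        - linPart Θ g - n * rhoStar Θ|) ≤ 4 * (2 + 425 / m ^ 2 + 496 / m ^ 4) / √n := by
  have h1 : ∀ g, |contrast (fun a b c t => relErr Θ a b c t g - relErr Θ a b c t g ^ 2 / 2)
        - linPart Θ g - n * rhoStar Θ| ≤ |typeError Θ 1 0 1 g| + |typeError Θ 0 1 1 g|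
          + (|typeError Θ 1 0 0 g| + |typeError Θ 0 1 0 g|) := by
    intro g
    have hl := sum_linForm_eq_coef Θ (centInd Θ g) (centInd_comm Θ g)
    have e : contrast (fun a b c t => relErr Θ a b c t g - relErr Θ a b c t g ^ 2 / 2)
        - linPart Θ g - n * rhoStar Θ = (typeError Θ 1 0 1 g - typeError Θ 0 1 1 g)
          - (typeError Θ 1 0 0 g - typeError Θ 0 1 0 g) := by
      rw [rhoStar_eq Θ hn, linPart, ← hl, contrast]
      simp only [typeError, ← Finset.sum_sub_distrib]
      refine Finset.sum_congr rfl fun t _ => ?_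
      ring
    rw [e]
    exact (abs_sub _ _).trans (add_le_add (abs_sub _ _) (abs_sub _ _))
  refine (expect_mono Θ fun g _ => h1 g).trans ?_
  rw [expect_add, expect_add, expect_add]
  have t1 := expect_abs_typeError_le (Θ := Θ) hn hm (hmu 1 0 1)
  have t2 := expect_abs_typeError_le (Θ := Θ) hn hm (hmu 0 1 1)
  have t3 := expect_abs_typeError_le (Θ := Θ) hn hm (hmu 1 0 0)
  have t4 := expect_abs_typeError_le (Θ := Θ) hn hm (hmu 0 1 0)
  have e : 4 * (2 + 425 / m ^ 2 + 496 / m ^ 4) / √(n : ℝ)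
    = 4 * ((2 + 425 / m ^ 2 + 496 / m ^ 4) / √n) := by ring
  rw [e]
  linarith

end Bias

section Estimators

variable {n : ℕ} {Θ : Param n} {m δ : ℝ} {g : AdjArray n}

/-! ### The estimators on the concentration event -/

lemma abs_log_one_add_sub_le {x : ℝ} (hx : |x| ≤ 1 / 2) :
    |Real.log (1 + x) - (x - x ^ 2 / 2)| ≤ 2 * |x| ^ 3 := by
  have h := Real.abs_log_sub_add_sum_range_le (x := -x) (by rw [abs_neg]; linarith) 2
  rw [abs_neg] at h
  simp only [Finset.sum_range_succ, Finset.sum_range_zero] at h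
  have e : (0 + (-x) ^ (0 + 1) / ((0 : ℕ) + 1 : ℝ) + (-x) ^ (1 + 1) / ((1 : ℕ) + 1 : ℝ)
      + Real.log (1 - -x)) = Real.log (1 + x) - (x - x ^ 2 / 2) := by
    rw [sub_neg_eq_add]; push_cast; ring
  rw [e] at h
  refine h.trans ?_
  rw [div_le_iff₀ (by linarith)]
  have := pow_nonneg (abs_nonneg x) 3
  norm_num only
  nlinarith

lemma abs_log_one_add_le {x : ℝ} (hx : |x| ≤ 1 / 2) : |Real.log (1 + x)| ≤ 2 * |x| := by
  have h := Real.abs_log_sub_add_sum_range_le (x := -x) (by rw [abs_neg]; linarith) 0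
  rw [abs_neg] at h
  simp only [Finset.sum_range_zero, zero_add, sub_neg_eq_add, pow_one] at h
  refine h.trans ?_
  rw [div_le_iff₀ (by linarith)]
  have := abs_nonneg x
  nlinarith

/-- The relative error of a path average. -/
def pathErr (Θ : Param n) (a b c : Fin 2) (i t : Fin n) (g : AdjArray n) : ℝ :=
  pathAvg (ind g) a b c i t / pathAvg (dyadProb Θ) a b c i t - 1

lemma relErr_eq_pathErr (a b c : Fin 2) (t : Fin n) :
    relErr Θ a b c t g = pathErr Θ a b c t t g := by
  rw [relErr, pathErr, mu_eq_pathAvg]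

lemma abs_pathErr_le (hm : 0 < m) (hp : ∀ a b c i t, m ≤ pathAvg (dyadProb Θ) a b c i t)
    (hg : Concentrated Θ δ g) (a b c : Fin 2) (i t : Fin n) :
    |pathErr Θ a b c i t g| ≤ δ / m := by
  have h1 := hp a b c i t
  have h2 := (hg a b c i t).le
  have h0 : 0 < pathAvg (dyadProb Θ) a b c i t := hm.trans_le h1
  rw [pathErr, div_sub_one h0.ne', abs_div, abs_of_pos h0]
  exact div_le_div₀ ((abs_nonneg _).trans h2) h2 hm h1

/-- The condition δ ≤ m/2 keeps relative errors at most 1/2, so all counts are positive and the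
conventions for log 0 and division by 0 never enter. -/
lemma log_pathSum_div (hn : 0 < n) (hm : 0 < m) (hδ : δ ≤ m / 2)
    (hp : ∀ a b c i t, m ≤ pathAvg (dyadProb Θ) a b c i t) (hg : Concentrated Θ δ g)
    (c : Fin 2) (i t : Fin n) :
    Real.log (pathSum (ind g) 1 0 c i t / pathSum (ind g) 0 1 c i t)
      = Θ.theta + Θ.alpha i + Θ.beta t + ((c : ℕ) : ℝ) * Θ.rho
        + (Real.log (1 + pathErr Θ 1 0 c i t g) - Real.log (1 + pathErr Θ 0 1 c i t g)) := by
  have hn' : (n : ℝ) ≠ 0 := by exact_mod_cast hn.ne'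
  have h0 : ∀ a b, 0 < pathAvg (dyadProb Θ) a b c i t := fun a b => hm.trans_le (hp a b c i t)
  have herr : ∀ a b, 0 < 1 + pathErr Θ a b c i t g := by
    intro a b
    have h1 := abs_pathErr_le hm hp hg a b c i t
    have h2 : δ / m ≤ 1 / 2 := by rw [div_le_div_iff₀ hm two_pos]; linarith
    linarith [neg_le_of_abs_le (h1.trans h2)]
  have e : ∀ a b, pathSum (ind g) a b c i t
      = (n : ℝ) ^ 2 * (pathAvg (dyadProb Θ) a b c i t * (1 + pathErr Θ a b c i t g)) := by
    intro a b
    have := (h0 a b).ne'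
    rw [pathErr, add_sub_cancel, mul_div_cancel₀ _ this, pathAvg]
    field_simp
  rw [e 1 0, e 0 1, mul_div_mul_left _ _ (pow_ne_zero 2 hn'),
    Real.log_div (mul_pos (h0 1 0) (herr 1 0)).ne' (mul_pos (h0 0 1) (herr 0 1)).ne',
    Real.log_mul (h0 1 0).ne' (herr 1 0).ne', Real.log_mul (h0 0 1).ne' (herr 0 1).ne',
    pathAvg_ratio, Real.log_mul (Real.exp_pos _).ne' (h0 0 1).ne', Real.log_exp]
  ring

lemma abs_average_le (hn : 0 < n) {f : Fin n → ℝ} {x : ℝ} (hf : ∀ t, |f t| ≤ x) :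
    |1 / (n : ℝ) * ∑ t, f t| ≤ x := by
  have hn' : (0 : ℝ) < n := by exact_mod_cast hn
  have hx : 0 ≤ x := (abs_nonneg _).trans (hf ⟨0, hn⟩)
  have h := abs_sum_le_mul Finset.univ f hx (fun t _ => hf t)
  rw [Fintype.card_fin] at h
  rw [abs_mul, abs_of_pos (by positivity : (0 : ℝ) < 1 / n), one_div_mul_eq_div,
    div_le_iff₀ hn', mul_comm x]
  exact h

/-- `Θ'` is within `ε` of `Θ`. -/
def ParamNear (ε : ℝ) (Θ Θ' : Param n) : Prop :=
  |Θ'.rho - Θ.rho| ≤ ε ∧ |Θ'.theta - Θ.theta| ≤ ε ∧ (∀ i, |Θ'.alpha i - Θ.alpha i| ≤ ε)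
    ∧ ∀ j, |Θ'.beta j - Θ.beta j| ≤ ε

lemma abs_log_pathErr_sub_le (hm : 0 < m) (hδ : δ ≤ m / 2)
    (hp : ∀ a b c i t, m ≤ pathAvg (dyadProb Θ) a b c i t) (hg : Concentrated Θ δ g)
    (c : Fin 2) (i t : Fin n) :
    |Real.log (1 + pathErr Θ 1 0 c i t g) - Real.log (1 + pathErr Θ 0 1 c i t g)|
      ≤ 4 * (δ / m) := by
  have h2 : δ / m ≤ 1 / 2 := by rw [div_le_div_iff₀ hm two_pos]; linarith
  have h3 := fun a b => abs_pathErr_le hm hp hg a b c i t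
  have h4 := fun a b => abs_log_one_add_le ((h3 a b).trans h2)
  refine (abs_sub _ _).trans ?_
  linarith [h4 1 0, h4 0 1, h3 1 0, h3 0 1]

lemma average_log_eq (hn : 0 < n) (F : Fin n → ℝ) (x : ℝ) (h : ∑ t, F t = n * x) (G : Fin n → ℝ) :
    1 / (n : ℝ) * ∑ t, (F t + G t) - x = 1 / (n : ℝ) * ∑ t, G t := by
  have hn' : (n : ℝ) ≠ 0 := by exact_mod_cast hn.ne'
  rw [Finset.sum_add_distrib, h]
  field_simp
  ring

/-- Averaging over t removes α_t + β_t by the identification constraint. -/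
lemma average_triple_sub
    (hn : 0 < n) (hm : 0 < m) (hδ : δ ≤ m / 2)
    (hp : ∀ a b c i t, m ≤ pathAvg (dyadProb Θ) a b c i t) (hg : Concentrated Θ δ g)
    (hid : Θ.Identified) (c : Fin 2) :
    1 / (n : ℝ) * ∑ t, Real.log (tripleSum (ind g) 1 0 c t / tripleSum (ind g) 0 1 c t)
        - (Θ.theta + ((c : ℕ) : ℝ) * Θ.rho)
      = 1 / (n : ℝ) * ∑ t, (Real.log (1 + pathErr Θ 1 0 c t t g)
        - Real.log (1 + pathErr Θ 0 1 c t t g)) := by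
  simp only [← pathSum_self, log_pathSum_div hn hm hδ hp hg]
  refine average_log_eq hn _ _ ?_ _
  simp only [Finset.sum_add_distrib, hid.1, hid.2, Finset.sum_const, Finset.card_univ,
    Fintype.card_fin, nsmul_eq_mul]
  ring

/-- Each average of logarithms errs by at most 4δ/m, and all components but θ̂ subtract a second
such average. For α̂ and β̂ the constraint removes only the effect of the averaged node. -/
lemma paramNear_estimator
    (hn : 0 < n) (hm : 0 < m) (hδ : δ ≤ m / 2)
    (hp : ∀ a b c i t, m ≤ pathAvg (dyadProb Θ) a b c i t) (hg : Concentrated Θ δ g)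
    (hid : Θ.Identified) : ParamNear (8 * (δ / m)) Θ (estimator g) := by
  have hlog := abs_log_pathErr_sub_le hm hδ hp hg
  have hθ : |thetaHat g - Θ.theta| ≤ 4 * (δ / m) := by
    have h := average_triple_sub hn hm hδ hp hg hid 0
    simp only [Fin.val_zero, Nat.cast_zero, zero_mul, add_zero] at h
    rw [thetaHat, h]
    exact abs_average_le hn fun t => hlog 0 t t
  have h0 : 0 ≤ 4 * (δ / m) := (abs_nonneg _).trans hθ
  have comb : ∀ {x y : ℝ}, |x| ≤ 4 * (δ / m) → |y| ≤ 4 * (δ / m) → |x - y| ≤ 8 * (δ / m) := by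
    intro x y hx hy
    refine (abs_sub _ _).trans ?_
    linarith
  refine ⟨?_, ?_, ?_, ?_⟩
  · have h := average_triple_sub hn hm hδ hp hg hid 1
    simp only [Fin.val_one, Nat.cast_one, one_mul] at h
    have e : (estimator g).rho - Θ.rho
        = 1 / (n : ℝ) * ∑ t, (Real.log (1 + pathErr Θ 1 0 1 t t g)
        - Real.log (1 + pathErr Θ 0 1 1 t t g)) - (thetaHat g - Θ.theta) := by
      rw [← h]; simp only [estimator, rhoHat]; ring
    rw [e]
    exact comb (abs_average_le hn fun t => hlog 1 t t) hθ
  · exact hθ.trans (by linarith)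
  · intro i
    have h := average_log_eq hn (fun t => Θ.theta + Θ.alpha i + Θ.beta t
      + (((0 : Fin 2) : ℕ) : ℝ) * Θ.rho) (Θ.theta + Θ.alpha i) (by
        simp only [Finset.sum_add_distrib, hid.2, Finset.sum_const, Finset.card_univ,
          Fintype.card_fin, nsmul_eq_mul, Fin.val_zero, Nat.cast_zero]
        ring) (fun t => Real.log (1 + pathErr Θ 1 0 0 i t g) - Real.log (1 + pathErr Θ 0 1 0 i t g))
    have e : (estimator g).alpha i - Θ.alpha i
        = 1 / (n : ℝ) * ∑ t, (Real.log (1 + pathErr Θ 1 0 0 i t g)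
        - Real.log (1 + pathErr Θ 0 1 0 i t g)) - (thetaHat g - Θ.theta) := by
      rw [← h]
      simp only [estimator, alphaHat, log_pathSum_div hn hm hδ hp hg]; ring
    rw [e]
    exact comb (abs_average_le hn fun t => hlog 0 i t) hθ
  · intro j
    have h := average_log_eq hn (fun t => Θ.theta + Θ.alpha t + Θ.beta j
      + (((0 : Fin 2) : ℕ) : ℝ) * Θ.rho) (Θ.theta + Θ.beta j) (by
        simp only [Finset.sum_add_distrib, hid.1, Finset.sum_const, Finset.card_univ,
          Fintype.card_fin, nsmul_eq_mul, Fin.val_zero, Nat.cast_zero]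
        ring) (fun t => Real.log (1 + pathErr Θ 1 0 0 t j g) - Real.log (1 + pathErr Θ 0 1 0 t j g))
    have e : (estimator g).beta j - Θ.beta j
        = 1 / (n : ℝ) * ∑ t, (Real.log (1 + pathErr Θ 1 0 0 t j g)
        - Real.log (1 + pathErr Θ 0 1 0 t j g)) - (thetaHat g - Θ.theta) := by
      rw [← h]
      simp only [estimator, betaHat, log_pathSum_div hn hm hδ hp hg]; ring
    rw [e]
    exact comb (abs_average_le hn fun t => hlog 0 t j) hθ

/-- On the concentration event the estimation error is the second-order contrast, up to a cubic
term. -/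
lemma abs_rhoHat_sub_le
    (hn : 0 < n) (hm : 0 < m) (hδ : δ ≤ m / 2)
    (hp : ∀ a b c i t, m ≤ pathAvg (dyadProb Θ) a b c i t) (hg : Concentrated Θ δ g)
    (hid : Θ.Identified) :
    |n * (rhoHat g - Θ.rho)
        - contrast (fun a b c t => relErr Θ a b c t g - relErr Θ a b c t g ^ 2 / 2)|
      ≤ n * (8 * (δ / m) ^ 3) := by
  have hn' : (n : ℝ) ≠ 0 := by exact_mod_cast hn.ne'
  have h0 := average_triple_sub hn hm hδ hp hg hid 0
  have h1 := average_triple_sub hn hm hδ hp hg hid 1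
  simp only [Fin.val_one, Nat.cast_one, one_mul, Fin.val_zero, Nat.cast_zero, zero_mul,
    add_zero] at h0 h1
  have e : n * (rhoHat g - Θ.rho) = ∑ t, ((Real.log (1 + pathErr Θ 1 0 1 t t g)
        - Real.log (1 + pathErr Θ 0 1 1 t t g)) - (Real.log (1 + pathErr Θ 1 0 0 t t g)
        - Real.log (1 + pathErr Θ 0 1 0 t t g))) := by
    have e1 : rhoHat g - Θ.rho = 1 / (n : ℝ) * ∑ t, (Real.log (1 + pathErr Θ 1 0 1 t t g)
        - Real.log (1 + pathErr Θ 0 1 1 t t g)) - 1 / (n : ℝ) *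
          ∑ t, (Real.log (1 + pathErr Θ 1 0 0 t t g) - Real.log (1 + pathErr Θ 0 1 0 t t g)) := by
      rw [← h0, ← h1, rhoHat, thetaHat]; ring
    rw [e1, ← mul_sub, ← Finset.sum_sub_distrib]
    field_simp
  have h2 : δ / m ≤ 1 / 2 := by rw [div_le_div_iff₀ hm two_pos]; linarith
  have h3 : ∀ a b c t, |Real.log (1 + pathErr Θ a b c t t g)
      - (relErr Θ a b c t g - relErr Θ a b c t g ^ 2 / 2)| ≤ 2 * (δ / m) ^ 3 := by
    intro a b c t
    rw [relErr_eq_pathErr]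
    have h4 := abs_pathErr_le hm hp hg a b c t t
    refine (abs_log_one_add_sub_le (h4.trans h2)).trans ?_
    exact mul_le_mul_of_nonneg_left (pow_le_pow_left₀ (abs_nonneg _) h4 3) (by norm_num)
  rw [e, contrast, ← Finset.sum_sub_distrib]
  refine (Finset.abs_sum_le_sum_abs _ _).trans ?_
  calc _ ≤ ∑ t : Fin n, 8 * (δ / m) ^ 3 := by
        refine Finset.sum_le_sum fun t _ => ?_
        have a1 := abs_le.1 (h3 1 0 1 t)
        have a2 := abs_le.1 (h3 0 1 1 t)
        have a3 := abs_le.1 (h3 1 0 0 t)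
        have a4 := abs_le.1 (h3 0 1 0 t)
        rw [abs_le]
        constructor <;> linarith
    _ = _ := by rw [Finset.sum_const, Finset.card_univ, Fintype.card_fin, nsmul_eq_mul]

end Estimators

/-! ### Bounded quantities with Lipschitz dependence on the parameter -/

/-- `x` and `y` are bounded by `K` and differ by at most `K * ε`. -/
def Near (ε K x y : ℝ) : Prop := |x| ≤ K ∧ |y| ≤ K ∧ |x - y| ≤ K * ε

section Near

variable {ε K L x y x' y' : ℝ}

lemma Near.nonneg (h : Near ε K x y) : 0 ≤ K := (abs_nonneg _).trans h.1

lemma Near.add (h : Near ε K x y) (h' : Near ε L x' y') : Near ε (K + L) (x + x') (y + y') := by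
  refine ⟨(abs_add_le _ _).trans (add_le_add h.1 h'.1), (abs_add_le _ _).trans
    (add_le_add h.2.1 h'.2.1), ?_⟩
  rw [show x + x' - (y + y') = (x - y) + (x' - y') by ring, add_mul]
  exact (abs_add_le _ _).trans (add_le_add h.2.2 h'.2.2)

lemma Near.neg (h : Near ε K x y) : Near ε K (-x) (-y) := by
  refine ⟨by rw [abs_neg]; exact h.1, by rw [abs_neg]; exact h.2.1, ?_⟩
  rw [show -x - -y = -(x - y) by ring, abs_neg]; exact h.2.2

lemma Near.sub (h : Near ε K x y) (h' : Near ε L x' y') : Near ε (K + L) (x - x') (y - y') := by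
  rw [sub_eq_add_neg, sub_eq_add_neg]; exact h.add h'.neg

/-- One constant serves as size bound and as Lipschitz constant; the factor two pays for the two
terms of the product rule. -/
lemma Near.mul (h : Near ε K x y) (h' : Near ε L x' y') :
    Near ε (2 * (K * L)) (x * x') (y * y') := by
  have hK := h.nonneg
  have hL := h'.nonneg
  have hKL : 0 ≤ K * L := mul_nonneg hK hL
  refine ⟨?_, ?_, ?_⟩
  · rw [abs_mul]
    have := mul_le_mul h.1 h'.1 (abs_nonneg _) hK
    linarith
  · rw [abs_mul]
    have := mul_le_mul h.2.1 h'.2.1 (abs_nonneg _) hK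
    linarith
  · rw [show x * x' - y * y' = (x - y) * x' + y * (x' - y') by ring]
    refine (abs_add_le _ _).trans ?_
    rw [abs_mul, abs_mul]
    have h1 := mul_le_mul h.2.2 h'.1 (abs_nonneg _) ((abs_nonneg _).trans h.2.2)
    have h2 := mul_le_mul h.2.1 h'.2.2 (abs_nonneg _) hK
    linarith

lemma Near.sq (h : Near ε K x y) : Near ε (2 * (K * K)) (x ^ 2) (y ^ 2) := by
  rw [pow_two, pow_two]; exact h.mul h

lemma near_const (hε : 0 ≤ ε) (c : ℝ) : Near ε |c| c c := by
  refine ⟨le_rfl, le_rfl, ?_⟩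
  rw [sub_self, abs_zero]; positivity

lemma Near.mono (h : Near ε K x y) (hε : 0 ≤ ε) (hKL : K ≤ L) : Near ε L x y :=
  ⟨h.1.trans hKL, h.2.1.trans hKL, h.2.2.trans (mul_le_mul_of_nonneg_right hKL hε)⟩

lemma Near.one_div {m : ℝ} (h : Near ε K x y) (hε : 0 ≤ ε) (hm : 0 < m) (hx : m ≤ x)
    (hy : m ≤ y) : Near ε (1 / m + K / m ^ 2) (1 / x) (1 / y) := by
  have hK := h.nonneg
  have hx0 := hm.trans_le hx
  have hy0 := hm.trans_le hy
  have b1 : 1 / x ≤ 1 / m := one_div_le_one_div_of_le hm hx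
  have b2 : 1 / y ≤ 1 / m := one_div_le_one_div_of_le hm hy
  have p : 0 ≤ K / m ^ 2 := by positivity
  refine ⟨?_, ?_, ?_⟩
  · rw [abs_of_pos (by positivity)]; linarith
  · rw [abs_of_pos (by positivity)]; linarith
  · have e : 1 / x - 1 / y = (1 / x) * (1 / y) * (y - x) := by field_simp
    rw [e, abs_mul, abs_of_pos (by positivity), abs_sub_comm y x]
    have h1 : 1 / x * (1 / y) ≤ 1 / m * (1 / m) :=
      mul_le_mul b1 b2 (by positivity) (by positivity)
    have h2 := mul_le_mul h1 h.2.2 (abs_nonneg _) (by positivity)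
    refine h2.trans ?_
    have e2 : 1 / m * (1 / m) * (K * ε) = K / m ^ 2 * ε := by field_simp
    rw [e2]
    have : 0 ≤ 1 / m * ε := by positivity
    linarith

lemma Near.exp (h : Near ε K x y) (hε : 0 ≤ ε) :
    Near ε (Real.exp K * (1 + K)) (Real.exp x) (Real.exp y) := by
  have hK := h.nonneg
  have b : ∀ {z : ℝ}, |z| ≤ K → Real.exp z ≤ Real.exp K := fun hz =>
    Real.exp_le_exp.2 ((le_abs_self _).trans hz)
  have e1 : Real.exp K ≤ Real.exp K * (1 + K) :=
    le_mul_of_one_le_right (Real.exp_pos _).le (by linarith)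
  have key : ∀ {u v : ℝ}, |u| ≤ K → |u - v| ≤ K * ε →
      Real.exp u - Real.exp v ≤ Real.exp K * (1 + K) * ε := by
    intro u v hu huv
    have h1 := Real.add_one_le_exp (v - u)
    have h2 : Real.exp v = Real.exp u * Real.exp (v - u) := by rw [← Real.exp_add]; ring_nf
    have h3 : Real.exp u - Real.exp v ≤ Real.exp u * |u - v| := by
      rw [h2]
      have := mul_le_mul_of_nonneg_left h1 (Real.exp_pos u).le
      have h4 := mul_le_mul_of_nonneg_left (le_abs_self (u - v)) (Real.exp_pos u).le
      linarith
    have h5 := mul_le_mul (b hu) huv (abs_nonneg _) (Real.exp_pos K).le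
    have h6 : 0 ≤ Real.exp K * ε := by positivity
    linarith
  refine ⟨?_, ?_, ?_⟩
  · rw [Real.abs_exp]; exact (b h.1).trans e1
  · rw [Real.abs_exp]; exact (b h.2.1).trans e1
  · have h' : |y - x| ≤ K * ε := by rw [abs_sub_comm]; exact h.2.2
    rw [abs_le]
    constructor
    · linarith [key h.2.1 h']
    · exact key h.1 h.2.2

/-- Normalised sums keep the constant, which is why the constants below do not depend on n. -/
lemma Near.average {ι : Type*} {s : Finset ι} {f f' : ι → ℝ} {N : ℝ} (hN : 0 < N)
    (hs : (s.card : ℝ) ≤ N) (hε : 0 ≤ ε) (hK : 0 ≤ K) (h : ∀ i ∈ s, Near ε K (f i) (f' i)) :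
    Near ε K (1 / N * ∑ i ∈ s, f i) (1 / N * ∑ i ∈ s, f' i) := by
  have key : ∀ {u : ι → ℝ} {c : ℝ}, 0 ≤ c → (∀ i ∈ s, |u i| ≤ c) → |1 / N * ∑ i ∈ s, u i| ≤ c := by
    intro u c hc hu
    rw [abs_mul, abs_of_pos (by positivity), one_div_mul_eq_div, div_le_iff₀ hN]
    refine (Finset.abs_sum_le_sum_abs _ _).trans ((Finset.sum_le_card_nsmul s _ c hu).trans ?_)
    rw [nsmul_eq_mul, mul_comm c]
    exact mul_le_mul_of_nonneg_right hs hc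
  refine ⟨key hK fun i hi => (h i hi).1, key hK fun i hi => (h i hi).2.1, ?_⟩
  rw [← mul_sub, ← Finset.sum_sub_distrib]
  exact key (by positivity) fun i hi => (h i hi).2.2

end Near

/-! ### Lipschitz dependence of the variance and the bias on the parameter, uniformly in n -/

section Lipschitz

variable {n : ℕ} {C ε : ℝ}

/-- The comparison of two bounded parameter vectors. -/
structure Comparable (C ε : ℝ) (Θ Θ' : Param n) : Prop where
  four_le : 4 ≤ n
  nonneg : 0 ≤ ε
  left : Θ.BoundedBy C
  right : Θ'.BoundedBy C
  -- The order of the arguments makes the differences Θ - Θ', as in `Near`.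
  near : ParamNear ε Θ' Θ

lemma dyadNorm_eq (Θ : Param n) (i j : Fin n) :
    dyadNorm Θ i j = ∑ a, ∑ b, Real.exp (dyadExponent Θ i j a b) := by
  have h1 := sum_dyadProb Θ i j
  simp only [dyadProb_eq, ← Finset.mul_sum] at h1
  rw [one_div_mul_eq_div, div_eq_one_iff_eq (dyadNorm_pos Θ i j).ne'] at h1
  exact h1.symm

lemma Comparable.dyadExponent {Θ Θ' : Param n} (h : Comparable C ε Θ Θ') (i j : Fin n)
    (a b : Fin 2) :
    Near ε (7 * C + 7) (dyadExponent Θ i j a b) (dyadExponent Θ' i j a b) := by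
  have hC : 0 ≤ C := (abs_nonneg _).trans h.left.1
  refine ⟨(abs_dyadExponent_le h.left i j a b).trans (by linarith),
    (abs_dyadExponent_le h.right i j a b).trans (by linarith), ?_⟩
  have hε := h.nonneg
  obtain ⟨h1, h2, h3, h4⟩ := h.near
  have h1 := abs_le.1 h1
  have h2 := abs_le.1 h2
  have a1 := abs_le.1 (h3 i)
  have a2 := abs_le.1 (h3 j)
  have b1 := abs_le.1 (h4 i)
  have b2 := abs_le.1 (h4 j)
  have hCε : 0 ≤ C * ε := mul_nonneg hC hε
  unfold P1.dyadExponent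
  rw [abs_le]
  fin_cases a <;> fin_cases b <;>
    simp only [Nat.cast_zero, Nat.cast_one, zero_mul, one_mul] <;> constructor <;> linarith

lemma exists_near_dyadProb (C : ℝ) : ∃ K, ∀ {n : ℕ} {ε : ℝ} {Θ Θ' : Param n},
    Comparable C ε Θ Θ' → ∀ i j a b, Near ε K (dyadProb Θ i j a b) (dyadProb Θ' i j a b) := by
  set E := Real.exp (7 * C + 7) * (1 + (7 * C + 7))
  refine ⟨2 * ((1 / 1 + (E + E + (E + E)) / 1 ^ 2) * E), fun h i j a b => ?_⟩
  rw [dyadProb_eq, dyadProb_eq]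
  have hk : ∀ Θ : Param _, 1 ≤ dyadNorm Θ i j := fun Θ => by
    unfold dyadNorm
    have h1 := Real.exp_pos (Θ.theta + Θ.alpha i + Θ.beta j)
    have h2 := Real.exp_pos (Θ.theta + Θ.alpha j + Θ.beta i)
    have h3 := Real.exp_pos (Θ.rho + 2 * Θ.theta + Θ.alpha i + Θ.alpha j + Θ.beta i + Θ.beta j)
    linarith
  have hE := fun a b => (h.dyadExponent i j a b).exp h.nonneg
  refine Near.mul (Near.one_div ?_ h.nonneg one_pos (hk _) (hk _)) (hE a b)
  rw [dyadNorm_eq, dyadNorm_eq]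
  simp only [Fin.sum_univ_two]
  exact ((hE 0 0).add (hE 0 1)).add ((hE 1 0).add (hE 1 1))

/-- Two nested averages, in the form required by `Near.average`. -/
lemma tripleSum_scaled (F : Fin n → Fin n → Fin 2 → Fin 2 → ℝ) (a b c : Fin 2) (t : Fin n) :
    1 / (n : ℝ) ^ 2 * tripleSum F a b c t = 1 / (n : ℝ) * ∑ i ∈ ({t}ᶜ : Finset (Fin n)),
      (1 / (n : ℝ) * ∑ j ∈ ({t, i}ᶜ : Finset (Fin n)), F i t c a * F i j c b * F t j c a) := by
  rw [tripleSum, ← Finset.mul_sum, ← mul_assoc]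
  congr 1; field_simp

lemma card_finset_le (s : Finset (Fin n)) : (s.card : ℝ) ≤ n := by
  have := Finset.card_le_univ s
  rw [Fintype.card_fin] at this
  exact_mod_cast this

lemma Comparable.pos {Θ Θ' : Param n} (h : Comparable C ε Θ Θ') : (0 : ℝ) < n := by
  have := h.four_le
  exact_mod_cast (by omega : 0 < n)

lemma exists_near_one_div_mu (C : ℝ) : ∃ K, ∀ {n : ℕ} {ε : ℝ} {Θ Θ' : Param n},
    Comparable C ε Θ Θ' → ∀ a b c t, Near ε K (1 / mu Θ a b c t) (1 / mu Θ' a b c t) := by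
  obtain ⟨K, hK⟩ := exists_near_dyadProb C
  refine ⟨1 / minAvg C + 2 * (2 * (K * K) * K) / minAvg C ^ 2, fun h a b c t => ?_⟩
  have hp := hK h
  refine Near.one_div ?_ h.nonneg (minAvg_pos C) (minAvg_le_mu h.left h.four_le a b c t)
    (minAvg_le_mu h.right h.four_le a b c t)
  have hM : 0 ≤ 2 * (2 * (K * K) * K) := (((hp t t a a).mul (hp t t a a)).mul (hp t t a a)).nonneg
  rw [mu, mu, tripleSum_scaled, tripleSum_scaled]
  refine Near.average h.pos (card_finset_le _) h.nonneg hM fun i _ => ?_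
  refine Near.average h.pos (card_finset_le _) h.nonneg hM fun j _ => ?_
  exact ((hp _ _ _ _).mul (hp _ _ _ _)).mul (hp _ _ _ _)

lemma exists_near_eta (C : ℝ) : ∃ K, ∀ {n : ℕ} {ε : ℝ} {Θ Θ' : Param n},
    Comparable C ε Θ Θ' → ∀ a b c i t, Near ε K (eta Θ a b c i t) (eta Θ' a b c i t) := by
  obtain ⟨K, hK⟩ := exists_near_dyadProb C
  obtain ⟨M, hM⟩ := exists_near_one_div_mu C
  refine ⟨2 * (2 * (M * K) * K) + 2 * (2 * (M * K) * K) + 2 * (2 * (M * K) * K),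
    fun h a b c i t => ?_⟩
  have hp := hK h
  have hm := hM h
  have key : ∀ j, Near _ (2 * (2 * (M * K) * K) + 2 * (2 * (M * K) * K) + 2 * (2 * (M * K) * K))
      _ _ := fun j =>
    ((((hm a b c t).mul (hp t j c a)).mul (hp i j c b)).add
      (((hm a b c i).mul (hp j i c a)).mul (hp j t c b))).sub
      (((hm b a c j).mul (hp i j c b)).mul (hp j t c b))
  exact Near.average h.pos (card_finset_le _) h.nonneg (key i).nonneg fun j _ => key j

lemma exists_near_coef (C : ℝ) : ∃ K, ∀ {n : ℕ} {ε : ℝ} {Θ Θ' : Param n},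
    Comparable C ε Θ Θ' → ∀ i t a b, Near ε K (coef Θ i t a b) (coef Θ' i t a b) := by
  obtain ⟨K, hK⟩ := exists_near_eta C
  refine ⟨K + K, fun h i t a b => ?_⟩
  have he := hK h
  fin_cases a <;> fin_cases b
  · exact (he 0 1 0 i t).add (he 0 1 0 t i)
  · exact ((he 1 0 0 i t).add (he 0 1 1 t i)).neg
  · exact ((he 0 1 1 i t).add (he 1 0 0 t i)).neg
  · exact (he 1 0 1 i t).add (he 1 0 1 t i)

/-- `n² σ_ρ²` is Lipschitz in the parameter. -/
lemma exists_near_sigmaRhoSq (C : ℝ) : ∃ K, ∀ {n : ℕ} {ε : ℝ} {Θ Θ' : Param n},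
    Comparable C ε Θ Θ' →
      Near ε K ((n : ℝ) ^ 2 * sigmaRhoSq Θ) ((n : ℝ) ^ 2 * sigmaRhoSq Θ') := by
  obtain ⟨K, hK⟩ := exists_near_dyadProb C
  obtain ⟨M, hM⟩ := exists_near_coef C
  set A := 2 * (K * (2 * (M * M)))
  set B := 2 * (K * M)
  refine ⟨A + A + (A + A) + 2 * ((B + B + (B + B)) * (B + B + (B + B))), ?_⟩
  intro n ε Θ Θ' h
  have hp := hK h
  have hm := hM h
  have hn := h.pos
  have e : ∀ Θ : Param n, (n : ℝ) ^ 2 * sigmaRhoSq Θ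
      = 1 / (n : ℝ) ^ 2 * ∑ p ∈ dyads n, dyadVar Θ p.2 p.1 (coef Θ p.2 p.1) := by
    intro Θ; rw [sigmaRhoSq_eq, ← mul_assoc]; congr 1; field_simp
  have hv : ∀ i t, Near ε (A + A + (A + A) + 2 * ((B + B + (B + B)) * (B + B + (B + B))))
      (dyadVar Θ i t (coef Θ i t)) (dyadVar Θ' i t (coef Θ' i t)) := by
    intro i t
    simp only [dyadVar, Fin.sum_univ_two]
    have h2 := fun a b => (hp i t a b).mul (hm i t a b).sq
    have h1 := fun a b => (hp i t a b).mul (hm i t a b)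
    exact (((h2 0 0).add (h2 0 1)).add ((h2 1 0).add (h2 1 1))).sub
      (((h1 0 0).add (h1 0 1)).add ((h1 1 0).add (h1 1 1))).sq
  rw [e, e]
  have h0 : 0 < n := by have := h.four_le; omega
  exact Near.average (by positivity) (card_dyads_le n) h.nonneg (hv ⟨0, h0⟩ ⟨0, h0⟩).nonneg
    fun p _ => hv p.2 p.1

/-- Each ζ is n⁻³ times products of two arm sums of order n, so nζ is of order one: the remaining
n⁻² turns the two arms into averages. -/
lemma exists_near_zeta (C : ℝ) : ∃ K, ∀ {n : ℕ} {ε : ℝ} {Θ Θ' : Param n},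
    Comparable C ε Θ Θ' → ∀ a b c i t,
      Near ε K ((n : ℝ) * zeta1 Θ a b c i t) ((n : ℝ) * zeta1 Θ' a b c i t) ∧
      Near ε K ((n : ℝ) * zeta2 Θ a b c i t) ((n : ℝ) * zeta2 Θ' a b c i t) := by
  obtain ⟨K, hK⟩ := exists_near_dyadProb C
  obtain ⟨M, hM⟩ := exists_near_one_div_mu C
  set A := 2 * (M * (2 * (K * K))) with hA
  refine ⟨2 * (|1 / 2| * (2 * (A * A) + 2 * (A * A))) + 2 * (A * A), fun {n ε Θ Θ'} h a b c i t => ?_⟩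
  have hp := hK h
  have hm := hM h
  have hn := h.pos
  have hε := h.nonneg
  have hKK : 0 ≤ 2 * (K * K) := ((hp i i a a).mul (hp i i a a)).nonneg
  have hl : ∀ i t, Near ε A (1 / mu Θ a b c t * (1 / n * armLeft Θ a b c t i))
      (1 / mu Θ' a b c t * (1 / n * armLeft Θ' a b c t i)) := fun i t =>
    (hm a b c t).mul (Near.average hn (card_finset_le _) hε hKK
      fun j _ => (hp t j c a).mul (hp i j c b))
  have hr : ∀ i t, Near ε A (1 / mu Θ a b c t * (1 / n * armRight Θ a b c t i))
      (1 / mu Θ' a b c t * (1 / n * armRight Θ' a b c t i)) := fun i t =>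
    (hm a b c t).mul (Near.average hn (card_finset_le _) hε hKK
      fun j _ => (hp j t c a).mul (hp j i c b))
  have e1 : ∀ Θ : Param n, (n : ℝ) * zeta1 Θ a b c i t
      = 1 / 2 * ((1 / mu Θ a b c t * (1 / n * armLeft Θ a b c t i)) ^ 2
        + (1 / mu Θ a b c i * (1 / n * armRight Θ a b c i t)) ^ 2) := by
    intro Θ; rw [zeta1_eq]; field_simp
  have e2 : ∀ Θ : Param n, (n : ℝ) * zeta2 Θ a b c i t
      = (1 / mu Θ a b c t * (1 / n * armLeft Θ a b c t i))
        * (1 / mu Θ a b c t * (1 / n * armRight Θ a b c t i)) := by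
    intro Θ; rw [zeta2_eq]; field_simp
  have hA0 : 0 ≤ A := (hl i t).nonneg
  constructor
  · rw [e1, e1]
    refine ((near_const hε (1 / 2)).mul ((hl i t).sq.add (hr t i).sq)).mono hε ?_
    have : 0 ≤ 2 * (A * A) := by positivity
    linarith
  · rw [e2, e2]
    refine ((hl i t).mul (hr i t)).mono hε ?_
    have : 0 ≤ 2 * (|1 / 2| * (2 * (A * A) + 2 * (A * A))) := by positivity
    linarith

/-- `n ρ*` is Lipschitz in the parameter. -/
lemma exists_near_rhoStar (C : ℝ) : ∃ K, ∀ {n : ℕ} {ε : ℝ} {Θ Θ' : Param n},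
    Comparable C ε Θ Θ' → Near ε K ((n : ℝ) * rhoStar Θ) ((n : ℝ) * rhoStar Θ') := by
  obtain ⟨K, hK⟩ := exists_near_dyadProb C
  obtain ⟨M, hM⟩ := exists_near_zeta C
  -- The summand of nρ*, with the factor n moved onto each ζ.
  have hex : ∃ B, ∀ {n : ℕ} {ε : ℝ} {Θ Θ' : Param n}, Comparable C ε Θ Θ' → ∀ i t,
      Near ε B
      (((n : ℝ) * zeta1 Θ 1 0 0 i t + n * zeta1 Θ 0 1 1 t i) * dyadProb Θ i t 0 1
          * (1 - dyadProb Θ i t 0 1)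
      + (n * zeta1 Θ 1 0 0 t i + n * zeta1 Θ 0 1 1 i t) * dyadProb Θ i t 1 0
          * (1 - dyadProb Θ i t 1 0)
      - (n * zeta1 Θ 1 0 1 i t + n * zeta1 Θ 1 0 1 t i + n * zeta2 Θ 1 0 1 i t
          + n * zeta2 Θ 1 0 1 t i) * dyadProb Θ i t 1 1 * (1 - dyadProb Θ i t 1 1)
      - (n * zeta1 Θ 0 1 0 i t + n * zeta1 Θ 0 1 0 t i + n * zeta2 Θ 0 1 0 i t
          + n * zeta2 Θ 0 1 0 t i) * dyadProb Θ i t 0 0 * (1 - dyadProb Θ i t 0 0)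
      - (n * zeta2 Θ 1 0 0 i t + n * zeta2 Θ 1 0 0 t i + n * zeta2 Θ 0 1 1 i t
          + n * zeta2 Θ 0 1 1 t i) * dyadProb Θ i t 0 1 * dyadProb Θ i t 1 0)
      (((n : ℝ) * zeta1 Θ' 1 0 0 i t + n * zeta1 Θ' 0 1 1 t i) * dyadProb Θ' i t 0 1
          * (1 - dyadProb Θ' i t 0 1)
      + (n * zeta1 Θ' 1 0 0 t i + n * zeta1 Θ' 0 1 1 i t) * dyadProb Θ' i t 1 0
          * (1 - dyadProb Θ' i t 1 0)
      - (n * zeta1 Θ' 1 0 1 i t + n * zeta1 Θ' 1 0 1 t i + n * zeta2 Θ' 1 0 1 i t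
          + n * zeta2 Θ' 1 0 1 t i) * dyadProb Θ' i t 1 1 * (1 - dyadProb Θ' i t 1 1)
      - (n * zeta1 Θ' 0 1 0 i t + n * zeta1 Θ' 0 1 0 t i + n * zeta2 Θ' 0 1 0 i t
          + n * zeta2 Θ' 0 1 0 t i) * dyadProb Θ' i t 0 0 * (1 - dyadProb Θ' i t 0 0)
      - (n * zeta2 Θ' 1 0 0 i t + n * zeta2 Θ' 1 0 0 t i + n * zeta2 Θ' 0 1 1 i t
          + n * zeta2 Θ' 0 1 1 t i) * dyadProb Θ' i t 0 1 * dyadProb Θ' i t 1 0) := by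
    refine ⟨2 * (2 * ((M + M) * K) * (|1| + K)) + 2 * (2 * ((M + M) * K) * (|1| + K))
      + 2 * (2 * ((M + M + M + M) * K) * (|1| + K)) + 2 * (2 * ((M + M + M + M) * K) * (|1| + K))
      + 2 * (2 * ((M + M + M + M) * K) * K), fun h i t => ?_⟩
    have hp := hK h i t
    have hq := fun a b => (near_const h.nonneg 1).sub (hp a b)
    have z1 := fun a b c i t => (hM h a b c i t).1
    have z2 := fun a b c i t => (hM h a b c i t).2
    have four := fun a b c => (((z1 a b c i t).add (z1 a b c t i)).add (z2 a b c i t)).add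
      (z2 a b c t i)
    exact ((((((z1 1 0 0 i t).add (z1 0 1 1 t i)).mul (hp 0 1)).mul (hq 0 1)).add
      ((((z1 1 0 0 t i).add (z1 0 1 1 i t)).mul (hp 1 0)).mul (hq 1 0))).sub
      (((four 1 0 1).mul (hp 1 1)).mul (hq 1 1))).sub
      (((four 0 1 0).mul (hp 0 0)).mul (hq 0 0)) |>.sub
      ((((((z2 1 0 0 i t).add (z2 1 0 0 t i)).add (z2 0 1 1 i t)).add (z2 0 1 1 t i)).mul
        (hp 0 1)).mul (hp 1 0))
  obtain ⟨B, hB⟩ := hex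
  refine ⟨B, fun {n ε Θ Θ'} h => ?_⟩
  have h0 : 0 < n := by have := h.four_le; omega
  have hn := h.pos
  have key := Near.average (N := (n : ℝ) ^ 2) (s := dyads n) (by positivity) (card_dyads_le n)
    h.nonneg (hB h ⟨0, h0⟩ ⟨0, h0⟩).nonneg fun p _ => hB h p.2 p.1
  have e : ∀ Θ : Param n, (n : ℝ) * rhoStar Θ = 1 / (n : ℝ) ^ 2 * ((n : ℝ) *
      ((n : ℝ) ^ 2 * rhoStar Θ)) := by intro Θ; field_simp
  rw [e Θ, e Θ']
  convert key using 2
  all_goals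
    rw [rhoStar, ← sum_dyads, ← mul_assoc ((n : ℝ) ^ 2), mul_one_div_cancel (by positivity), one_mul,
      Finset.mul_sum]
    refine Finset.sum_congr rfl fun p _ => ?_
    ring

end Lipschitz

/-! ### Characteristic functions -/

/-- Both quantities are compared with 1 - v/2: the Taylor remainder of the characteristic function
is at most r³, and that of the Gaussian factor at most v² ≤ r⁴ ≤ r³. -/
lemma norm_sum_mul_cexp_sub_le {ι : Type*} (s : Finset ι) (w x : ι → ℝ) (hw : ∀ k ∈ s, 0 ≤ w k)
    (hw1 : ∑ k ∈ s, w k = 1) (hx0 : ∑ k ∈ s, w k * x k = 0) {r : ℝ} (hr : r ≤ 1)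
    (hx : ∀ k ∈ s, |x k| ≤ r) :
    ‖∑ k ∈ s, w k • Complex.exp (x k * Complex.I)
      - Complex.exp (((-(∑ k ∈ s, w k * x k ^ 2) / 2 : ℝ)) : ℂ)‖ ≤ 2 * r ^ 3 := by
  have hs : s.Nonempty := by
    rw [Finset.nonempty_iff_ne_empty]; rintro rfl; simp at hw1
  obtain ⟨k0, hk0⟩ := hs
  have hr0 : 0 ≤ r := (abs_nonneg _).trans (hx k0 hk0)
  set v := ∑ k ∈ s, w k * x k ^ 2 with hv
  have hv0 : 0 ≤ v := Finset.sum_nonneg fun k hk => mul_nonneg (hw k hk) (sq_nonneg _)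
  have hvr : v ≤ r ^ 2 := by
    calc v ≤ ∑ k ∈ s, w k * r ^ 2 := Finset.sum_le_sum fun k hk =>
          mul_le_mul_of_nonneg_left (by rw [← sq_abs]; exact pow_le_pow_left₀ (abs_nonneg _) (hx k hk) 2)
            (hw k hk)
      _ = r ^ 2 := by rw [← Finset.sum_mul, hw1, one_mul]
  have h1 : ‖∑ k ∈ s, w k • Complex.exp (x k * Complex.I) - ((1 - v / 2 : ℝ) : ℂ)‖ ≤ r ^ 3 := by
    have e : ∑ k ∈ s, w k • Complex.exp (x k * Complex.I) - ((1 - v / 2 : ℝ) : ℂ)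
        = ∑ k ∈ s, w k • (Complex.exp (x k * Complex.I)
          - ∑ m ∈ Finset.range 3, (x k * Complex.I) ^ m / (m.factorial : ℂ)) := by
      simp only [smul_sub, Finset.sum_sub_distrib]
      congr 1
      have e1 : ∀ k, w k • ∑ m ∈ Finset.range 3, (x k * Complex.I) ^ m / (m.factorial : ℂ)
          = ((w k : ℝ) : ℂ) + ((w k * x k : ℝ) : ℂ) * Complex.I
            - ((w k * x k ^ 2 : ℝ) : ℂ) / 2 := by
        intro k
        simp only [Finset.sum_range_succ, Finset.sum_range_zero, Complex.real_smul]
        rw [show ((x k : ℂ) * Complex.I) ^ 2 = -(x k : ℂ) ^ 2 by rw [mul_pow, Complex.I_sq]; ring]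
        simp [Nat.factorial]
        ring
      simp only [e1, Finset.sum_sub_distrib, Finset.sum_add_distrib, ← Finset.sum_mul,
        ← Finset.sum_div, ← Complex.ofReal_sum, hw1, hx0, ← hv]
      push_cast; ring
    rw [e]
    calc _ ≤ ∑ k ∈ s, w k * r ^ 3 := by
          refine (norm_sum_le _ _).trans (Finset.sum_le_sum fun k hk => ?_)
          rw [norm_smul, Real.norm_of_nonneg (hw k hk)]
          refine mul_le_mul_of_nonneg_left ?_ (hw k hk)
          have hn : ‖(x k : ℂ) * Complex.I‖ = |x k| := by simp
          have hb := Complex.exp_bound (x := x k * Complex.I) (by rw [hn]; exact (hx k hk).trans hr)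
            (n := 3) (by norm_num)
          refine hb.trans ?_
          rw [hn]
          have h3 := pow_le_pow_left₀ (abs_nonneg _) (hx k hk) 3
          have h4 : ((Nat.succ 3 : ℕ) : ℝ) * (((3 : ℕ).factorial : ℝ) * ((3 : ℕ) : ℝ))⁻¹ ≤ 1 := by
            norm_num [Nat.factorial]
          calc _ ≤ |x k| ^ 3 * 1 := mul_le_mul_of_nonneg_left h4 (by positivity)
            _ ≤ _ := by rw [mul_one]; exact h3
      _ = r ^ 3 := by rw [← Finset.sum_mul, hw1, one_mul]
  have h2 : ‖((1 - v / 2 : ℝ) : ℂ) - Complex.exp (((-v / 2 : ℝ)) : ℂ)‖ ≤ r ^ 3 := by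
    rw [← Complex.ofReal_exp, ← Complex.ofReal_sub, Complex.norm_real, Real.norm_eq_abs,
      abs_sub_comm]
    have hr2 : r ^ 2 ≤ 1 := pow_le_one₀ hr0 hr
    have hb := Real.abs_exp_sub_one_sub_id_le (x := -v / 2) (by
      rw [abs_le]; constructor <;> linarith)
    have e : Real.exp (-v / 2) - (1 - v / 2) = Real.exp (-v / 2) - 1 - -v / 2 := by ring
    rw [e]
    refine hb.trans ?_
    have h5 : v ^ 2 ≤ (r ^ 2) ^ 2 := pow_le_pow_left₀ hv0 hvr 2
    have h6 : r ^ 4 ≤ r ^ 3 := pow_le_pow_of_le_one hr0 hr (by norm_num)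
    nlinarith [pow_nonneg hr0 3]
  have e3 : ∀ z1 z2 z3 : ℂ, z1 - z3 = (z1 - z2) + (z2 - z3) := fun _ _ _ => by ring
  rw [e3 _ ((1 - v / 2 : ℝ) : ℂ)]
  refine (norm_add_le _ _).trans ?_
  linarith

/-- Telescoping: factors are exchanged one at a time while the others have modulus at most one. -/
lemma norm_prod_sub_prod_le {ι : Type*} (s : Finset ι) (a b : ι → ℂ) (ha : ∀ k ∈ s, ‖a k‖ ≤ 1)
    (hb : ∀ k ∈ s, ‖b k‖ ≤ 1) : ‖∏ k ∈ s, a k - ∏ k ∈ s, b k‖ ≤ ∑ k ∈ s, ‖a k - b k‖ := by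
  classical
  induction s using Finset.induction_on with
  | empty => simp
  | insert k s hk ih =>
    rw [Finset.prod_insert hk, Finset.prod_insert hk, Finset.sum_insert hk]
    have e : a k * ∏ i ∈ s, a i - b k * ∏ i ∈ s, b i
        = (a k - b k) * ∏ i ∈ s, a i + b k * (∏ i ∈ s, a i - ∏ i ∈ s, b i) := by ring
    rw [e]
    refine (norm_add_le _ _).trans ?_
    rw [norm_mul, norm_mul, norm_prod]
    have h1 : ∏ i ∈ s, ‖a i‖ ≤ 1 := Finset.prod_le_one (fun _ _ => norm_nonneg _)
      fun i hi => ha i (Finset.mem_insert_of_mem hi)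
    have h2 := ih (fun i hi => ha i (Finset.mem_insert_of_mem hi))
      (fun i hi => hb i (Finset.mem_insert_of_mem hi))
    have h3 := mul_le_mul_of_nonneg_left h1 (norm_nonneg (a k - b k))
    have h4 := mul_le_mul (hb k (Finset.mem_insert_self k s)) h2 (norm_nonneg _) zero_le_one
    linarith

/-! ### Central limit theorem for the linear part -/

section LinPart

variable {n : ℕ} {Θ : Param n} {K : ℝ}

lemma sum_mul_centInd (F : Fin 2 → Fin 2 → ℝ) (g : AdjArray n) (i t : Fin n) :
    ∑ a, ∑ b, F a b * centInd Θ g i t a b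
      = F (g i t) (g t i) - ∑ a, ∑ b, dyadProb Θ i t a b * F a b := by
  have h : ∑ a, ∑ b, F a b * ind g i t a b = F (g i t) (g t i) := by
    rw [Finset.sum_eq_single (g i t), Finset.sum_eq_single (g t i)]
    · simp [ind]
    · intro b _ hb; simp [ind, hb.symm]
    · simp
    · intro a _ ha; simp [ind, ha.symm]
    · simp
  rw [← h]
  simp only [centInd, mul_sub, Finset.sum_sub_distrib, mul_comm]

/-- The law of the normalised linear part is close to the standard normal law in terms of
characteristic functions. -/
lemma norm_charFun_linPart_sub_le (hn : 0 < n) (hK : ∀ i t a b, |coef Θ i t a b| ≤ K)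
    (hσ : 1 ≤ (n : ℝ) ^ 2 * sigmaRhoSq Θ) (u : ℝ) (hu : 2 * K * |u| ≤ n) :
    ‖expect Θ (fun g => Complex.exp
        (((u * (linPart Θ g / √((n : ℝ) ^ 2 * sigmaRhoSq Θ)) : ℝ) : ℂ) * Complex.I))
      - Complex.exp (((-u ^ 2 / 2 : ℝ)) : ℂ)‖ ≤ 16 * K ^ 3 * |u| ^ 3 / n := by
  have hn' : (0 : ℝ) < n := by exact_mod_cast hn
  set s := √((n : ℝ) ^ 2 * sigmaRhoSq Θ) with hs
  have hs1 : 1 ≤ s := Real.one_le_sqrt.2 hσ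
  have hs0 : 0 < s := by linarith
  have hs2 : s ^ 2 = (n : ℝ) ^ 2 * sigmaRhoSq Θ := Real.sq_sqrt (by linarith)
  set h := u / (n * s) with hh
  set y : Fin n × Fin n → Fin 2 → Fin 2 → ℝ := fun p a b => coef Θ p.2 p.1 a b
    - ∑ a, ∑ b, dyadProb Θ p.2 p.1 a b * coef Θ p.2 p.1 a b with hy
  have hsum1 : ∀ p : Fin n × Fin n, ∑ k : Fin 2 × Fin 2, dyadProb Θ p.2 p.1 k.1 k.2 = 1 := by
    intro p; rw [Fintype.sum_prod_type, sum_dyadProb]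
  have hy0 : ∀ p, ∑ k : Fin 2 × Fin 2, dyadProb Θ p.2 p.1 k.1 k.2 * y p k.1 k.2 = 0 := by
    intro p
    have := hsum1 p
    rw [Fintype.sum_prod_type] at this ⊢
    simp only [hy, Fin.sum_univ_two] at this ⊢
    linear_combination (-(dyadProb Θ p.2 p.1 0 0 * coef Θ p.2 p.1 0 0
      + dyadProb Θ p.2 p.1 0 1 * coef Θ p.2 p.1 0 1 + (dyadProb Θ p.2 p.1 1 0 * coef Θ p.2 p.1 1 0
      + dyadProb Θ p.2 p.1 1 1 * coef Θ p.2 p.1 1 1))) * this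
  have hyK : ∀ p a b, |y p a b| ≤ 2 * K := by
    intro p a b
    refine (abs_sub _ _).trans ?_
    have : |∑ a, ∑ b, dyadProb Θ p.2 p.1 a b * coef Θ p.2 p.1 a b| ≤ K := by
      calc _ ≤ ∑ a, ∑ b, dyadProb Θ p.2 p.1 a b * K := by
            refine (Finset.abs_sum_le_sum_abs _ _).trans (Finset.sum_le_sum fun a _ =>
              (Finset.abs_sum_le_sum_abs _ _).trans (Finset.sum_le_sum fun b _ => ?_))
            rw [abs_mul, abs_of_pos (dyadProb_pos _ _ _ _ _)]
            exact mul_le_mul_of_nonneg_left (hK _ _ _ _) (dyadProb_pos _ _ _ _ _).le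
        _ = K := by simp_rw [← Finset.sum_mul]; rw [sum_dyadProb, one_mul]
    linarith [hK p.2 p.1 a b]
  have hK0 : 0 ≤ K := (abs_nonneg _).trans (hK ⟨0, hn⟩ ⟨0, hn⟩ 0 0)
  -- A uniform bound on the contribution of one dyad; it uses √(n²σ_ρ²) ≥ 1.
  set r := 2 * K * |u| / n with hr
  have hr1 : r ≤ 1 := by rw [hr, div_le_one hn']; exact hu
  have hhy : ∀ p a b, |h * y p a b| ≤ r := by
    intro p a b
    rw [abs_mul, hh, abs_div, abs_of_pos (by positivity : 0 < n * s), hr]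
    have h1 : |u| / (n * s) ≤ |u| / n :=
      div_le_div_of_nonneg_left (abs_nonneg u) hn' (le_mul_of_one_le_right hn'.le hs1)
    calc _ ≤ |u| / n * (2 * K) := mul_le_mul h1 (hyK p a b) (abs_nonneg _) (by positivity)
      _ = _ := by ring
  have hlin : ∀ g, u * (linPart Θ g / s)
      = ∑ p ∈ dyads n, h * y p (g p.2 p.1) (g p.1 p.2) := by
    intro g
    rw [linPart]
    simp only [sum_mul_centInd]
    rw [← Finset.mul_sum, hh]
    field_simp
    rfl
  set φ : Fin n × Fin n → ℂ := fun p => ∑ k : Fin 2 × Fin 2, dyadProb Θ p.2 p.1 k.1 k.2 •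
    Complex.exp (((h * y p k.1 k.2 : ℝ) : ℂ) * Complex.I) with hφ
  have hprod : expect Θ (fun g => Complex.exp (((u * (linPart Θ g / s) : ℝ) : ℂ) * Complex.I))
      = ∏ p ∈ dyads n, φ p := by
    have e1 : ∀ g, Complex.exp (((u * (linPart Θ g / s) : ℝ) : ℂ) * Complex.I)
        = ∏ p ∈ dyads n, (fun p a b => Complex.exp (((h * y p b a : ℝ) : ℂ) * Complex.I))
          p (g p.1 p.2) (g p.2 p.1) := by
      intro g
      rw [hlin, ← Complex.exp_sum, Complex.ofReal_sum, Finset.sum_mul]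
    simp only [e1]
    rw [expect_prod_dyads Θ (fun p a b => Complex.exp (((h * y p b a : ℝ) : ℂ) * Complex.I))
      subset_rfl]
    refine Finset.prod_congr rfl fun p _ => ?_
    rw [hφ]
    simp only
    rw [Fintype.sum_prod_type, Finset.sum_comm]
    refine Finset.sum_congr rfl fun a _ => Finset.sum_congr rfl fun b _ => ?_
    rw [dyadProb_comm]
  set v : Fin n × Fin n → ℝ := fun p => ∑ k : Fin 2 × Fin 2, dyadProb Θ p.2 p.1 k.1 k.2 *
    (h * y p k.1 k.2) ^ 2 with hv
  have hvsum : ∑ p ∈ dyads n, v p = u ^ 2 := by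
    have e : ∀ p, v p = h ^ 2 * dyadVar Θ p.2 p.1 (coef Θ p.2 p.1) := by
      intro p
      rw [dyadVar_eq, hv]
      simp only
      rw [Fintype.sum_prod_type, Finset.mul_sum]
      refine Finset.sum_congr rfl fun a _ => ?_
      rw [Finset.mul_sum]
      refine Finset.sum_congr rfl fun b _ => ?_
      simp only [hy]; ring
    simp only [e, ← Finset.mul_sum]
    have hσ2 : ∑ p ∈ dyads n, dyadVar Θ p.2 p.1 (coef Θ p.2 p.1) = (n : ℝ) ^ 2 * s ^ 2 := by
      rw [hs2, sigmaRhoSq_eq]; field_simp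
    rw [hσ2, hh]
    field_simp
  -- The dyad variances add up to exactly u², so the Gaussian target factors over the same dyads.
  have hgauss : Complex.exp (((-u ^ 2 / 2 : ℝ)) : ℂ)
      = ∏ p ∈ dyads n, Complex.exp (((-(v p) / 2 : ℝ)) : ℂ) := by
    rw [← Complex.exp_sum, ← Complex.ofReal_sum, ← hvsum, ← Finset.sum_div,
      Finset.sum_neg_distrib]
  rw [hprod, hgauss]
  refine (norm_prod_sub_prod_le _ _ _ ?_ ?_).trans ?_
  · intro p _
    calc ‖φ p‖ ≤ ∑ k : Fin 2 × Fin 2, dyadProb Θ p.2 p.1 k.1 k.2 := by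
          refine (norm_sum_le _ _).trans (Finset.sum_le_sum fun k _ => ?_)
          rw [norm_smul, Complex.norm_exp_ofReal_mul_I, mul_one,
            Real.norm_of_nonneg (dyadProb_pos _ _ _ _ _).le]
      _ = 1 := hsum1 p
  · intro p _
    rw [← Complex.ofReal_exp, Complex.norm_real, Real.norm_of_nonneg (Real.exp_pos _).le,
      Real.exp_le_one_iff]
    have : 0 ≤ v p := Finset.sum_nonneg fun k _ =>
      mul_nonneg (dyadProb_pos _ _ _ _ _).le (sq_nonneg _)
    linarith
  · have hr0 : 0 ≤ r := by positivity
    -- At most n² factors, each with an error of order n⁻³.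
    calc _ ≤ ∑ p ∈ dyads n, 2 * r ^ 3 := by
          refine Finset.sum_le_sum fun p _ => ?_
          refine norm_sum_mul_cexp_sub_le Finset.univ
            (fun k : Fin 2 × Fin 2 => dyadProb Θ p.2 p.1 k.1 k.2) (fun k => h * y p k.1 k.2)
            (fun k _ => (dyadProb_pos _ _ _ _ _).le) (hsum1 p) ?_ hr1 fun k _ => hhy p k.1 k.2
          have e : ∀ k : Fin 2 × Fin 2, dyadProb Θ p.2 p.1 k.1 k.2 * (h * y p k.1 k.2)
              = h * (dyadProb Θ p.2 p.1 k.1 k.2 * y p k.1 k.2) := fun k => by ring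
          simp only [e, ← Finset.mul_sum, hy0 p, mul_zero]
      _ ≤ (n : ℝ) ^ 2 * (2 * r ^ 3) := by
          rw [Finset.sum_const, nsmul_eq_mul]
          exact mul_le_mul_of_nonneg_right (card_dyads_le n) (by positivity)
      _ = 16 * K ^ 3 * |u| ^ 3 / n := by rw [hr]; field_simp; ring

lemma coef_comm (i t : Fin n) (a b : Fin 2) : coef Θ i t a b = coef Θ t i b a := by
  fin_cases a <;> fin_cases b <;> simp [coef, add_comm]

/-- Needed because the error in σ̂_ρ multiplies `linPart`. Symmetry of the coefficients turns the
sum over dyads into one over ordered pairs with half the weight, to which `expect_sq_sum_dyadFun_le`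
applies. -/
lemma expect_abs_linPart_le (hn : 0 < n) (hK : ∀ i t a b, |coef Θ i t a b| ≤ K) :
    expect Θ (fun g => |linPart Θ g|) ≤ 1 + 16 * K ^ 2 := by
  have hn' : (0 : ℝ) < n := by exact_mod_cast hn
  have hK0 : 0 ≤ K := (abs_nonneg _).trans (hK ⟨0, hn⟩ ⟨0, hn⟩ 0 0)
  set A : Fin n → Fin n → AdjArray n → ℝ := fun i t g =>
    1 / (2 * n) * ∑ a, ∑ b, coef Θ i t a b * centInd Θ g i t a b with hA
  have hsymm : ∀ i t g, A i t g = A t i g := by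
    intro i t g
    simp only [hA]
    congr 1
    rw [Finset.sum_comm]
    refine Finset.sum_congr rfl fun a _ => Finset.sum_congr rfl fun b _ => ?_
    rw [coef_comm, centInd_comm]
  have e : ∀ g, linPart Θ g = ∑ t, ∑ i ∈ ({t}ᶜ : Finset (Fin n)), A i t g := by
    intro g
    rw [sum_sum_compl_singleton (fun t i => A i t g), linPart, Finset.mul_sum]
    refine Finset.sum_congr rfl fun p _ => ?_
    rw [hsymm p.1 p.2, ← two_mul]
    simp only [hA]
    field_simp
  have hsq : expect Θ (fun g => linPart Θ g ^ 2) ≤ 4 * (2 * K / n) ^ 2 * (n : ℝ) ^ 2 := by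
    simp only [e]
    refine expect_sq_sum_dyadFun_le (Θ := Θ) ?_ ?_ (by positivity) ?_
    · intro i t u v h h'
      simp only [hA, sum_mul_centInd]
      exact free_apply (fun x y => 1 / (2 * (n : ℝ)) * (coef Θ i t x y
        - ∑ a, ∑ b, dyadProb Θ i t a b * coef Θ i t a b)) h h'
    · intro i t hit
      simp only [hA, sum_mul_centInd]
      have h1 := resample_apply Θ (fun x y => 1 / (2 * (n : ℝ)) * (coef Θ i t x y
        - ∑ a, ∑ b, dyadProb Θ i t a b * coef Θ i t a b)) hit
      rw [h1]
      funext g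
      have h2 := sum_dyadProb Θ i t
      simp only [smul_eq_mul, Fin.sum_univ_two, Pi.zero_apply] at h2 ⊢
      linear_combination (-(1 / (2 * (n : ℝ)) * (dyadProb Θ i t 0 0 * coef Θ i t 0 0
        + dyadProb Θ i t 0 1 * coef Θ i t 0 1 + (dyadProb Θ i t 1 0 * coef Θ i t 1 0
        + dyadProb Θ i t 1 1 * coef Θ i t 1 1)))) * h2
    · intro i t g
      simp only [hA]
      rw [abs_mul, abs_of_pos (by positivity : (0 : ℝ) < 1 / (2 * n))]
      have h1 : |∑ a, ∑ b, coef Θ i t a b * centInd Θ g i t a b| ≤ 4 * K := by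
        calc _ ≤ ∑ a : Fin 2, ∑ b : Fin 2, K := by
              refine (Finset.abs_sum_le_sum_abs _ _).trans (Finset.sum_le_sum fun a _ =>
                (Finset.abs_sum_le_sum_abs _ _).trans (Finset.sum_le_sum fun b _ => ?_))
              rw [abs_mul]
              have := mul_le_mul (hK i t a b) (abs_centInd_le_one Θ g i t a b) (abs_nonneg _) hK0
              linarith
          _ = 4 * K := by simp; ring
      calc _ ≤ 1 / (2 * (n : ℝ)) * (4 * K) := mul_le_mul_of_nonneg_left h1 (by positivity)
        _ = 2 * K / n := by field_simp; ring
  have h3 := expect_abs_le (Θ := Θ) (f := linPart Θ) (K := 16 * K ^ 2) one_pos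
    (hsq.trans (le_of_eq (by field_simp; ring)))
  rwa [div_one] at h3

end LinPart

/-! ### The studentized statistic -/

section Studentized

variable {n : ℕ} {Θ : Param n}

/-- `(ρ̂ - ρ - ρ̂*) / σ̂_ρ`. -/
def studentized (Θ : Param n) (g : AdjArray n) : ℝ :=
  (rhoHat g - Θ.rho - rhoStarHat g) / sigmaRhoHat g

/-- The linear part of `ρ̂ - ρ`, divided by `σ_ρ`. -/
def standardLin (Θ : Param n) (g : AdjArray n) : ℝ :=
  linPart Θ g / √((n : ℝ) ^ 2 * sigmaRhoSq Θ)

/-- The error of the second order expansion of `ρ̂`. -/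
def expansionErr (Θ : Param n) (g : AdjArray n) : ℝ :=
  contrast (fun a b c t => relErr Θ a b c t g - relErr Θ a b c t g ^ 2 / 2) - linPart Θ g
    - n * rhoStar Θ

/-- Here x is the true n²σ_ρ² and y its plug-in version. The bounds give 1/√y ≤ 2 and |√x - √y| ≤ |x
- y|. -/
lemma abs_div_sqrt_sub_div_sqrt_le {x y a b : ℝ} (hx : 1 ≤ x) (hy : 1 / 4 ≤ y) :
    |a / √y - b / √x| ≤ 2 * |a - b| + 2 * |x - y| * |b| := by
  have hsx : 1 ≤ √x := by rw [Real.one_le_sqrt]; exact hx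
  have hsy : 1 / 2 ≤ √y := by apply Real.le_sqrt_of_sq_le; linarith
  have h1 : 1 / √y ≤ 2 := by rw [div_le_iff₀ (by linarith)]; linarith
  have h1' : 0 ≤ 1 / √y := by positivity
  have hd : |√x - √y| ≤ |x - y| := by
    have e : x - y = (√x - √y) * (√x + √y) := by
      have := Real.mul_self_sqrt (show 0 ≤ x by linarith)
      have := Real.mul_self_sqrt (show 0 ≤ y by linarith)
      linarith
    rw [e, abs_mul]
    exact le_mul_of_one_le_right (abs_nonneg _) (by rw [abs_of_nonneg] <;> linarith)
  have e : a / √y - b / √x = (a - b) * (1 / √y) + (√x - √y) * (1 / √y) * (b / √x) := by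
    have : √x ≠ 0 := by linarith
    have : √y ≠ 0 := by linarith
    field_simp; ring
  have h2 : |b / √x| ≤ |b| := by
    rw [abs_div, abs_of_nonneg (by linarith : (0 : ℝ) ≤ √x)]
    exact div_le_self (abs_nonneg _) hsx
  rw [e]
  refine (abs_add_le _ _).trans (add_le_add ?_ ?_)
  · rw [abs_mul, abs_of_nonneg h1', mul_comm]
    exact mul_le_mul_of_nonneg_right h1 (abs_nonneg _)
  · rw [abs_mul, abs_mul, abs_of_nonneg h1']
    refine mul_le_mul ?_ h2 (abs_nonneg _) (by positivity)
    nlinarith [abs_nonneg (√x - √y)]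

lemma sqrt_sq_mul (n : ℕ) (x : ℝ) : √((n : ℝ) ^ 2 * x) = n * √x := by
  rw [Real.sqrt_mul (by positivity), Real.sqrt_sq (by positivity)]

lemma ParamNear.boundedBy {Θ' : Param n} {C ε : ℝ} (hn : ParamNear ε Θ Θ')
    (h : Θ.BoundedBy C) (hε : ε ≤ 1) : Θ'.BoundedBy (C + 1) := by
  have key : ∀ x y : ℝ, |x| ≤ C → |y - x| ≤ ε → |y| ≤ C + 1 := by
    intro x y hx hy
    have := abs_add_le (y - x) x
    rw [sub_add_cancel] at this
    linarith
  exact ⟨key _ _ h.1 hn.1, key _ _ h.2.1 hn.2.1, fun i => key _ _ (h.2.2.1 i) (hn.2.2.1 i),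
    fun i => key _ _ (h.2.2.2 i) (hn.2.2.2 i)⟩

lemma ParamNear.symm {Θ' : Param n} {ε : ℝ} (h : ParamNear ε Θ Θ') : ParamNear ε Θ' Θ :=
  ⟨by rw [abs_sub_comm]; exact h.1, by rw [abs_sub_comm]; exact h.2.1,
    fun i => by rw [abs_sub_comm]; exact h.2.2.1 i, fun i => by rw [abs_sub_comm]; exact h.2.2.2 i⟩

lemma Param.BoundedBy.mono {C D : ℝ} (h : Θ.BoundedBy C) (hCD : C ≤ D) : Θ.BoundedBy D :=
  ⟨h.1.trans hCD, h.2.1.trans hCD, fun i => (h.2.2.1 i).trans hCD, fun i => (h.2.2.2 i).trans hCD⟩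

/-- A deterministic statement on the concentration event. The terms stem from the second order
expansion, the cubic remainder of the logarithm, the plug-in bias, and the plug-in variance, in this
order. -/
lemma exists_abs_studentized_sub_le (C : ℝ) : ∃ δ₀ > 0, ∃ L, 0 ≤ L ∧
    ∀ {n : ℕ} {Θ : Param n} {δ : ℝ} {g : AdjArray n}, 4 ≤ n → Θ.Identified → Θ.BoundedBy C →
      0 ≤ δ → δ ≤ δ₀ → Concentrated Θ δ g →
      0 < sigmaRhoHat g ∧ |studentized Θ g - standardLin Θ g|
        ≤ L * (|expansionErr Θ g| + n * δ ^ 3 + δ + δ * |linPart Θ g|) := by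
  obtain ⟨K₁, hK₁⟩ := exists_near_sigmaRhoSq (C + 1)
  obtain ⟨K₂, hK₂⟩ := exists_near_rhoStar (C + 1)
  set m := minAvg C with hm
  have hm0 : 0 < m := minAvg_pos C
  -- The first bound gives ε = 8δ/m ≤ 1, so the estimate is bounded by C + 1. The second keeps the
  -- change of n²σ_ρ² below 3/4, so its plug-in version stays at least 1/4.
  refine ⟨min (m / 8) (m / 32 / (|K₁| + 1)), by positivity,
    2 + 16 * (1 / m) ^ 3 + 16 * (|K₂| / m) + 16 * (|K₁| / m), by positivity, ?_⟩
  intro n Θ δ g hn hid hb hδ hδ₀ hg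
  have hn0 : 0 < n := by omega
  have hnR : (0 : ℝ) < n := by exact_mod_cast hn0
  have hδ1 : δ ≤ m / 8 := hδ₀.trans (min_le_left _ _)
  have hδ2 : δ * (|K₁| + 1) ≤ m / 32 := by
    rw [← le_div_iff₀ (by positivity)]; exact hδ₀.trans (min_le_right _ _)
  have hδm : δ ≤ m / 2 := by linarith
  have hp := fun a b c i t => minAvg_le_pathAvg hb hn a b c i t
  have hnear := paramNear_estimator hn0 hm0 hδm hp hg hid
  have hrho := abs_rhoHat_sub_le hn0 hm0 hδm hp hg hid
  set ε := 8 * (δ / m) with hε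
  have hε0 : 0 ≤ ε := by positivity
  have hε1 : ε ≤ 1 := by
    have : δ / m ≤ 1 / 8 := by rw [div_le_iff₀ hm0]; linarith
    linarith
  have hcmp : Comparable (C + 1) ε Θ (estimator g) :=
    ⟨hn, hε0, hb.mono (by linarith), hnear.boundedBy hb hε1, hnear.symm⟩
  have hs := (hK₁ hcmp).2.2
  have hr := (hK₂ hcmp).2.2
  have hs1 : 1 ≤ (n : ℝ) ^ 2 * sigmaRhoSq Θ :=
    one_le_sq_mul_sigmaRhoSq _ hn0 fun c t => (hm0.trans_le (minAvg_le_mu hb hn 0 1 c t)).ne'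
  have hK₁ε : K₁ * ε ≤ |K₁| * ε := mul_le_mul_of_nonneg_right (le_abs_self _) hε0
  have hK₂ε : K₂ * ε ≤ |K₂| * ε := mul_le_mul_of_nonneg_right (le_abs_self _) hε0
  have hsmall : |K₁| * ε ≤ 3 / 4 := by
    have : |K₁| * ε = 8 * ((δ * |K₁|) / m) := by rw [hε]; ring
    rw [this]
    have : δ * |K₁| / m ≤ 1 / 32 := by rw [div_le_iff₀ hm0]; nlinarith
    linarith
  have hy : 1 / 4 ≤ (n : ℝ) ^ 2 * sigmaRhoSq (estimator g) := by
    have := (abs_le.mp hs).2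
    linarith
  have hsig : √((n : ℝ) ^ 2 * sigmaRhoSq (estimator g)) = n * sigmaRhoHat g := sqrt_sq_mul _ _
  have hpos : 0 < sigmaRhoHat g := by
    refine Real.sqrt_pos.2 (pos_of_mul_pos_right (b := sigmaRhoSq (estimator g))
      (a := (n : ℝ) ^ 2) (by linarith) (by positivity))
  refine ⟨hpos, ?_⟩
  have e : studentized Θ g = (n * (rhoHat g - Θ.rho) - n * rhoStarHat g)
      / √((n : ℝ) ^ 2 * sigmaRhoSq (estimator g)) := by
    rw [hsig, studentized, ← mul_sub, mul_div_mul_left _ _ hnR.ne']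
  rw [e, standardLin]
  refine (abs_div_sqrt_sub_div_sqrt_le hs1 hy).trans ?_
  have hD : |n * (rhoHat g - Θ.rho) - n * rhoStarHat g - linPart Θ g|
      ≤ |expansionErr Θ g| + n * (8 * (δ / m) ^ 3) + |K₂| * ε := by
    have e : n * (rhoHat g - Θ.rho) - n * rhoStarHat g - linPart Θ g
        = expansionErr Θ g + (n * (rhoHat g - Θ.rho)
          - contrast (fun a b c t => relErr Θ a b c t g - relErr Θ a b c t g ^ 2 / 2))
          + (n * rhoStar Θ - n * rhoStar (estimator g)) := by
      rw [expansionErr, rhoStarHat]; ring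
    rw [e]
    refine (abs_add_three _ _ _).trans ?_
    linarith
  have hl := mul_le_mul_of_nonneg_right (hs.trans hK₁ε) (abs_nonneg (linPart Θ g))
  have e2 : n * (8 * (δ / m) ^ 3) = 8 * (1 / m) ^ 3 * (n * δ ^ 3) := by field_simp
  have e3 : |K₂| * ε = 8 * (|K₂| / m) * δ := by rw [hε]; ring
  have e4 : |K₁| * ε * |linPart Θ g| = 8 * (|K₁| / m) * (δ * |linPart Θ g|) := by rw [hε]; ring
  rw [e2, e3] at hD
  rw [e4] at hl
  have p1 : 0 ≤ (1 / m) ^ 3 := by positivity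
  have p2 : 0 ≤ |K₂| / m := by positivity
  have p3 : 0 ≤ |K₁| / m := by positivity
  have q1 := abs_nonneg (expansionErr Θ g)
  have q2 : 0 ≤ n * δ ^ 3 := by positivity
  have q4 : 0 ≤ δ * |linPart Θ g| := by positivity
  have := mul_nonneg p1 q1
  have := mul_nonneg p1 hδ
  have := mul_nonneg p1 q4
  have := mul_nonneg p2 q1
  have := mul_nonneg p2 q2
  have := mul_nonneg p2 q4
  have := mul_nonneg p3 q1
  have := mul_nonneg p3 q2
  have := mul_nonneg p3 hδ
  nlinarith

lemma norm_exp_mul_I_sub_le (u x y : ℝ) :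
    ‖Complex.exp ((u * x : ℝ) * Complex.I) - Complex.exp ((u * y : ℝ) * Complex.I)‖
      ≤ |u| * |x - y| := by
  have h : Complex.exp ((u * x : ℝ) * Complex.I) - Complex.exp ((u * y : ℝ) * Complex.I)
      = Complex.exp ((u * y : ℝ) * Complex.I)
        * (Complex.exp (Complex.I * (u * (x - y) : ℝ)) - 1) := by
    rw [mul_sub, ← Complex.exp_add, mul_one]; congr 2; push_cast; ring
  rw [h, norm_mul, Complex.norm_exp_ofReal_mul_I, one_mul, ← abs_mul]
  exact Real.norm_exp_I_mul_ofReal_sub_one_le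

-- On G the map x ↦ exp(iux) is |u|-Lipschitz; off G the difference of two unimodular numbers is at
-- most two.
open Classical in
lemma norm_expect_exp_sub_le (u : ℝ) (G : AdjArray n → Prop) (f h B : AdjArray n → ℝ)
    (hB : ∀ g, 0 ≤ B g) (hG : ∀ g, G g → |f g - h g| ≤ B g) :
    ‖expect Θ (fun g => Complex.exp ((u * f g : ℝ) * Complex.I))
        - expect Θ (fun g => Complex.exp ((u * h g : ℝ) * Complex.I))‖
      ≤ |u| * expect Θ B + 2 * expect Θ (fun g => if G g then 0 else 1) := by
  rw [← expect_sub, ← expect_mul_left, ← expect_mul_left, ← expect_add]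
  refine (norm_expect_le _ _).trans (expect_mono _ fun g _ => ?_)
  by_cases hg : G g
  · simp only [hg, if_true, mul_zero, add_zero]
    exact (norm_exp_mul_I_sub_le _ _ _).trans
      (mul_le_mul_of_nonneg_left (hG g hg) (abs_nonneg _))
  · simp only [hg, if_false]
    refine (norm_sub_le _ _).trans ?_
    rw [Complex.norm_exp_ofReal_mul_I, Complex.norm_exp_ofReal_mul_I]
    have := mul_nonneg (abs_nonneg u) (hB g)
    linarith

/-- A bound for all error terms when the triple averages are concentrated up to `δ`. -/
def errorRate (n : ℕ) (δ : ℝ) : ℝ :=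
  1 / √n + n * δ ^ 3 + δ + n ^ 2 * Real.exp (-(n * δ ^ 2 / 80))

lemma exists_norm_charFun_studentized_sub_le (C u : ℝ) : ∃ δ₀ > 0, ∃ L, ∃ N : ℕ,
    ∀ {n : ℕ} {Θ : Param n} {δ : ℝ}, N ≤ n → Θ.Identified → Θ.BoundedBy C →
      0 ≤ δ → δ ≤ δ₀ →
      ‖expect Θ (fun g => Complex.exp ((u * studentized Θ g : ℝ) * Complex.I))
        - Complex.exp ((-u ^ 2 / 2 : ℝ))‖ ≤ L * errorRate n δ := by
  classical
  obtain ⟨δ₀, hδ₀, L, hL, H⟩ := exists_abs_studentized_sub_le C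
  obtain ⟨K', hK'⟩ := exists_near_coef C
  set K := |K'| with hKdef
  set m := minAvg C with hm
  have hm0 : 0 < m := minAvg_pos C
  set M := 4 * (2 + 425 / m ^ 2 + 496 / m ^ 4) with hM
  have hM0 : 0 ≤ M := by positivity
  have hK0 : 0 ≤ K := abs_nonneg _
  refine ⟨δ₀, hδ₀, |u| * (L * (M + 2 + 16 * K ^ 2)) + 32 + 16 * K ^ 3 * |u| ^ 3,
    -- Four nodes are needed for the lower bounds on μ, and n ≥ 2K|u| for the Taylor expansion of
    -- the dyad characteristic functions.
    max 4 ⌈2 * K * |u|⌉₊, ?_⟩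
  intro n Θ δ hN hid hb hδ hδ'
  have hn : 4 ≤ n := (le_max_left _ _).trans hN
  have hn0 : 0 < n := by omega
  have hnR : (1 : ℝ) ≤ n := by exact_mod_cast hn0
  have hu : 2 * K * |u| ≤ n :=
    (Nat.le_ceil _).trans (by exact_mod_cast (le_max_right _ _).trans hN)
  have hcoef : ∀ i t a b, |coef Θ i t a b| ≤ K := fun i t a b =>
    -- The size bound is read off by comparing Θ with itself at ε = 0.
    (hK' ⟨hn, le_rfl, hb, hb, by simp [ParamNear]⟩ i t a b).1.trans (le_abs_self _)
  have hs1 : 1 ≤ (n : ℝ) ^ 2 * sigmaRhoSq Θ :=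
    one_le_sq_mul_sigmaRhoSq _ hn0 fun c t => (hm0.trans_le (minAvg_le_mu hb hn 0 1 c t)).ne'
  have h1 := norm_charFun_linPart_sub_le hn0 hcoef hs1 u hu
  have h2 := norm_expect_exp_sub_le (Θ := Θ) u (Concentrated Θ δ) (studentized Θ) (standardLin Θ)
    (fun g => L * (|expansionErr Θ g| + n * δ ^ 3 + δ + δ * |linPart Θ g|))
    (fun g => by positivity) fun g hg => (H hn hid hb hδ hδ' hg).2
  have h3 := expect_not_concentrated_le Θ hn0 hδ
  have h4 : expect Θ (fun g => |expansionErr Θ g|) ≤ M / √n :=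
    expect_abs_contrast_sub_le hn0 hm0 fun a b c t => minAvg_le_mu hb hn a b c t
  have h5 := expect_abs_linPart_le hn0 hcoef
  have e : expect Θ (fun g => L * (|expansionErr Θ g| + n * δ ^ 3 + δ + δ * |linPart Θ g|))
      = L * (expect Θ (fun g => |expansionErr Θ g|) + n * δ ^ 3 + δ
        + δ * expect Θ (fun g => |linPart Θ g|)) := by
    rw [expect_mul_left, expect_add, expect_add, expect_add, expect_const, expect_const,
      expect_mul_left]
  rw [e] at h2
  have h6 : L * (expect Θ (fun g => |expansionErr Θ g|) + n * δ ^ 3 + δ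
        + δ * expect Θ (fun g => |linPart Θ g|))
      ≤ L * ((M + 2 + 16 * K ^ 2) * (1 / √n + n * δ ^ 3 + δ)) := by
    refine mul_le_mul_of_nonneg_left ?_ hL
    have q1 : 0 ≤ 1 / √(n : ℝ) := by positivity
    have q2 : 0 ≤ n * δ ^ 3 := by positivity
    have := mul_le_mul_of_nonneg_left h5 hδ
    have := mul_nonneg hM0 q2
    have := mul_nonneg hM0 hδ
    have := mul_nonneg (sq_nonneg K) q1
    have := mul_nonneg (sq_nonneg K) q2
    rw [div_eq_mul_one_div] at h4
    nlinarith
  have h7 : 16 * K ^ 3 * |u| ^ 3 / n ≤ 16 * K ^ 3 * |u| ^ 3 * (1 / √n) := by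
    rw [div_eq_mul_one_div]
    refine mul_le_mul_of_nonneg_left ?_ (by positivity)
    refine one_div_le_one_div_of_le (by positivity) ?_
    rw [Real.sqrt_le_left (by positivity)]
    nlinarith
  have h8 := mul_le_mul_of_nonneg_left h6 (abs_nonneg u)
  have tri := norm_sub_le_norm_sub_add_norm_sub
    (expect Θ (fun g => Complex.exp ((u * studentized Θ g : ℝ) * Complex.I)))
    (expect Θ (fun g => Complex.exp ((u * standardLin Θ g : ℝ) * Complex.I)))
    (Complex.exp ((-u ^ 2 / 2 : ℝ)))
  have h1' : ‖expect Θ (fun g => Complex.exp ((u * standardLin Θ g : ℝ) * Complex.I))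
      - Complex.exp ((-u ^ 2 / 2 : ℝ))‖ ≤ 16 * K ^ 3 * |u| ^ 3 / n := h1
  refine tri.trans ((add_le_add h2 h1').trans ?_)
  rw [errorRate]
  set a := 1 / √(n : ℝ) + n * δ ^ 3 + δ with ha
  set b := (n : ℝ) ^ 2 * Real.exp (-(n * δ ^ 2 / 80)) with hb
  have ha1 : 1 / √(n : ℝ) ≤ a := by
    have : 0 ≤ n * δ ^ 3 := by positivity
    linarith
  have ha0 : 0 ≤ a := le_trans (by positivity) ha1
  have hb0 : 0 ≤ b := by positivity
  have h9 : 16 * K ^ 3 * |u| ^ 3 / n ≤ 16 * K ^ 3 * |u| ^ 3 * a :=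
    h7.trans (mul_le_mul_of_nonneg_left ha1 (by positivity))
  have h10 : expect Θ (fun g => if Concentrated Θ δ g then (0 : ℝ) else 1) ≤ 16 * b := by
    rw [hb]; linarith
  have p : 0 ≤ |u| * (L * (M + 2 + 16 * K ^ 2)) * b := by positivity
  have p' : 0 ≤ 16 * K ^ 3 * |u| ^ 3 * b := by positivity
  have h8' : |u| * (L * ((M + 2 + 16 * K ^ 2) * a)) = |u| * (L * (M + 2 + 16 * K ^ 2)) * a := by
    ring
  rw [h8'] at h8
  have : (|u| * (L * (M + 2 + 16 * K ^ 2)) + 32 + 16 * K ^ 3 * |u| ^ 3) * (a + b)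
    = |u| * (L * (M + 2 + 16 * K ^ 2)) * a + |u| * (L * (M + 2 + 16 * K ^ 2)) * b + 32 * a + 32 * b
      + 16 * K ^ 3 * |u| ^ 3 * a + 16 * K ^ 3 * |u| ^ 3 * b := by ring
  rw [this]
  linarith

/-! ### Choice of the radius and passage to the limit -/

/-- The radius of concentration `n^(-2/5)`. -/
def radius (n : ℕ) : ℝ := (n : ℝ) ^ (-(2 / 5 : ℝ))

lemma radius_nonneg (n : ℕ) : 0 ≤ radius n := by unfold radius; positivity

lemma tendsto_radius : Tendsto radius atTop (𝓝 0) :=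
  (tendsto_rpow_neg_atTop (by norm_num)).comp tendsto_natCast_atTop_atTop

lemma tendsto_sq_mul_exp_radius :
    Tendsto (fun n : ℕ => (n : ℝ) ^ 2 * Real.exp (-(n * radius n ^ 2 / 80))) atTop (𝓝 0) := by
  -- In the variable x = n^(1/5) the expression is x¹⁰ exp(-x/80).
  have h := (tendsto_rpow_mul_exp_neg_mul_atTop_nhds_zero 10 (1 / 80) (by norm_num)).comp
    ((tendsto_rpow_atTop (show (0 : ℝ) < 1 / 5 by norm_num)).comp tendsto_natCast_atTop_atTop)
  refine h.congr' ?_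
  filter_upwards [eventually_gt_atTop 0] with n hn
  have hn : (0 : ℝ) < n := by exact_mod_cast hn
  have e : (n : ℝ) * radius n ^ 2 = (n : ℝ) ^ (1 / 5 : ℝ) := by
    rw [radius, ← Real.rpow_natCast, ← Real.rpow_mul hn.le]
    nth_rw 1 [← Real.rpow_one (n : ℝ)]
    rw [← Real.rpow_add hn]; norm_num
  rw [e]
  simp only [Function.comp]
  rw [← Real.rpow_mul hn.le]
  norm_num
  left; ring

/-- Any exponent strictly between -1/2 and -1/3 would do: with -2/5, nδ³ = n^(-1/5) tends to zero
while nδ² = n^(1/5) tends to infinity. -/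
lemma tendsto_errorRate_radius : Tendsto (fun n => errorRate n (radius n)) atTop (𝓝 0) := by
  have h1 : Tendsto (fun n : ℕ => 1 / √(n : ℝ)) atTop (𝓝 0) := by
    refine (Real.tendsto_sqrt_atTop.comp tendsto_natCast_atTop_atTop).inv_tendsto_atTop.congr ?_
    intro n; simp
  have h2 : Tendsto (fun n : ℕ => (n : ℝ) * radius n ^ 3) atTop (𝓝 0) := by
    have h := (tendsto_rpow_neg_atTop (show (0 : ℝ) < 1 / 5 by norm_num)).comp
      tendsto_natCast_atTop_atTop
    refine h.congr' ?_
    filter_upwards [eventually_gt_atTop 0] with n hn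
    have hn : (0 : ℝ) < n := by exact_mod_cast hn
    have e (x : ℝ) : (n : ℝ) * (n : ℝ) ^ x = (n : ℝ) ^ (1 + x) := by
      rw [Real.rpow_add hn, Real.rpow_one]
    rw [radius, ← Real.rpow_natCast, ← Real.rpow_mul hn.le, e]
    norm_num
  have := ((h1.add h2).add tendsto_radius).add tendsto_sq_mul_exp_radius
  simpa [errorRate] using this

lemma tendsto_expect_exp_studentized {C : ℝ} {Θ : ∀ n, Param n} (hid : ∀ n, (Θ n).Identified)
    (hb : ∀ n, (Θ n).BoundedBy C) (u : ℝ) :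
    Tendsto (fun n => expect (Θ n)
        fun g => Complex.exp ((u * studentized (Θ n) g : ℝ) * Complex.I))
      atTop (𝓝 (Complex.exp ((-u ^ 2 / 2 : ℝ)))) := by
  obtain ⟨δ₀, hδ₀, L, N, H⟩ := exists_norm_charFun_studentized_sub_le C u
  rw [tendsto_iff_norm_sub_tendsto_zero]
  have h := tendsto_errorRate_radius.const_mul L
  rw [mul_zero] at h
  refine squeeze_zero' (.of_forall fun n => norm_nonneg _) ?_ h
  filter_upwards [eventually_ge_atTop N, tendsto_radius.eventually_le_const hδ₀] with n hn hr
  exact H hn (hid n) (hb n) (radius_nonneg n) hr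

-- The rejection region is stated without division. It agrees with a condition on the studentized
-- statistic only where σ̂_ρ > 0, since the square root of a nonpositive number is zero.
open Classical in
lemma tendsto_expect_sigmaRhoHat_pos {C : ℝ} {Θ : ∀ n, Param n} (hid : ∀ n, (Θ n).Identified)
    (hb : ∀ n, (Θ n).BoundedBy C) :
    Tendsto (fun n => expect (Θ n) fun g => if 0 < sigmaRhoHat g then (0 : ℝ) else 1)
      atTop (𝓝 0) := by
  obtain ⟨δ₀, hδ₀, L, -, H⟩ := exists_abs_studentized_sub_le C
  have h := tendsto_sq_mul_exp_radius.const_mul 16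
  rw [mul_zero] at h
  refine squeeze_zero' (.of_forall fun n => expect_nonneg _ fun g => by split_ifs <;> norm_num) ?_ h
  filter_upwards [eventually_ge_atTop 4, tendsto_radius.eventually_le_const hδ₀] with n hn hr
  rw [← mul_assoc]
  refine (expect_mono _ fun g _ => ?_).trans
    (expect_not_concentrated_le (Θ n) (by omega) (radius_nonneg n))
  by_cases hg : Concentrated (Θ n) (radius n) g
  · rw [if_pos (H hn (hid n) (hb n) (radius_nonneg n) hr hg).1, if_pos hg]
  · rw [if_neg hg]; split_ifs <;> norm_num

end Studentized

/-! ### Convergence in distribution -/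

section Law

variable {n : ℕ}

lemma integral_law {V : Type*} [NormedAddCommGroup V] [NormedSpace ℝ V] [CompleteSpace V]
    (Θ : Param n) (f : AdjArray n → V) : ∫ g, f g ∂(law Θ) = expect Θ f := by
  rw [law, integral_finsetSum_measure, expect]
  · refine Finset.sum_congr rfl fun g _ => ?_
    rw [integral_smul_measure, integral_dirac, ENNReal.toReal_ofReal (prob_nonneg Θ g)]
  · intro g _
    exact (integrable_dirac (by simp)).smul_measure ENNReal.ofReal_ne_top

open Classical in
lemma law_real_apply (Θ : Param n) (s : Set (AdjArray n)) :
    (law Θ).real s = expect Θ fun g => if g ∈ s then (1 : ℝ) else 0 := by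
  rw [← integral_law, ← integral_indicator_one (Set.toFinite s).measurableSet]
  rfl

lemma charFun_map_law {Θ : Param n} {Ω : Type*} [MeasurableSpace Ω] {P : Measure Ω}
    {X : Ω → AdjArray n} (hX : HasLaw X (law Θ) P) (f : AdjArray n → ℝ) (u : ℝ) :
    charFun (P.map fun ω => f (X ω)) u
      = expect Θ fun g => Complex.exp ((u * f g : ℝ) * Complex.I) := by
  have h : P.map (fun ω => f (X ω)) = (law Θ).map f := by
    rw [← hX.map_eq, AEMeasurable.map_map_of_aemeasurable (Measurable.of_discrete).aemeasurable
      hX.aemeasurable]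
    rfl
  rw [h, charFun_apply_real, integral_map (Measurable.of_discrete).aemeasurable
    (by fun_prop), integral_law]
  simp

open Classical in
lemma abs_law_real_sub_le (Θ : Param n) {z : ℝ} {r v : AdjArray n → ℝ} :
    |(law Θ).real {g | z * v g < |r g|} - (law Θ).real {g | z < |r g / v g|}|
      ≤ expect Θ fun g => if 0 < v g then (0 : ℝ) else 1 := by
  rw [law_real_apply, law_real_apply, ← expect_sub, ← Real.norm_eq_abs]
  refine (norm_expect_le _ _).trans (expect_mono _ fun g _ => ?_)
  by_cases h : 0 < v g
  · have : z * v g < |r g| ↔ z < |r g / v g| := by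
      rw [abs_div, abs_of_pos h, lt_div_iff₀ h]
    simp [h, this]
  · simp only [Set.mem_ofPred_eq, h, if_false]
    split_ifs <;> norm_num

lemma gaussianReal_setOf_lt_abs {a z : ℝ} (ha : a ∈ Set.Ioo (0 : ℝ) 1)
    (hz : gaussianReal 0 1 (Set.Iic z) = ENNReal.ofReal (1 - a / 2)) :
    gaussianReal 0 1 {x | z < |x|} = ENNReal.ofReal a := by
  have hz' : (gaussianReal 0 1).real (Set.Iic z) = 1 - a / 2 := by
    rw [measureReal_def, hz, ENNReal.toReal_ofReal (by linarith [ha.2])]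
  have h1 : (gaussianReal 0 1).real (Set.Ioi z) = a / 2 := by
    have := probReal_compl_eq_one_sub (μ := gaussianReal 0 1) (measurableSet_Iic (a := z))
    rw [Set.compl_Iic] at this
    rw [this, hz']; ring
  have h2 : (gaussianReal 0 1).real (Set.Iio (-z)) = a / 2 := by
    have h := gaussianReal_map_neg (μ := 0) (v := 1)
    rw [neg_zero] at h
    rw [← h1]
    nth_rw 1 [← h]
    rw [map_measureReal_apply measurable_neg measurableSet_Iio]
    congr 1; ext x; simp
  -- For negative z the half-line up to z, of mass 1 - a/2, would lie in the half-line below -z, of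
  -- mass a/2, contradicting a < 1. The sign is needed for the two tails to be disjoint.
  have hz0 : 0 ≤ z := by
    by_contra! hneg
    have := measureReal_mono (μ := gaussianReal 0 1)
      (show Set.Iic z ⊆ Set.Iio (-z) from fun x hx => by
        simp only [Set.mem_Iic, Set.mem_Iio] at *; linarith)
    linarith [ha.2]
  have e : {x : ℝ | z < |x|} = Set.Ioi z ∪ Set.Iio (-z) := by
    ext x
    simp only [Set.mem_ofPred_eq, lt_abs, Set.mem_union, Set.mem_Ioi, Set.mem_Iio, lt_neg]
  have hd : Disjoint (Set.Ioi z) (Set.Iio (-z)) := by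
    rw [Set.disjoint_left]
    intro x hx hx'
    simp only [Set.mem_Ioi, Set.mem_Iio] at *
    linarith
  rw [← ofReal_measureReal (μ := gaussianReal 0 1), e, measureReal_union hd measurableSet_Iio, h1, h2]
  congr 1; ring

lemma gaussianReal_frontier_setOf_lt_abs (z : ℝ) :
    gaussianReal 0 1 (frontier {x : ℝ | z < |x|}) = 0 := by
  have := nullSingletonClass_gaussianReal (μ := 0) (v := 1) one_ne_zero
  refine measure_mono_null (t := {z, -z}) ?_ ((Set.toFinite _).measure_zero _)
  refine (frontier_lt_subset_eq continuous_const continuous_abs).trans fun x hx => ?_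
  rcases abs_choice x with h | h <;> simp only [Set.mem_ofPred_eq] at hx <;>
    simp only [Set.mem_insert_iff, Set.mem_singleton_iff]
  · left; linarith
  · right; linarith

end Law

/-! ### The limit law and the level of the test -/

section Main

variable {C : ℝ} {Θ : ∀ n, Param n} {Ω : ℕ → Type*} [∀ n, MeasurableSpace (Ω n)]
  {P : ∀ n, Measure (Ω n)} [∀ n, IsProbabilityMeasure (P n)] {X : ∀ n, Ω n → AdjArray n}

theorem tendstoInDistribution_studentized
    (hident : ∀ n, (Θ n).Identified) (hbound : ∀ n, (Θ n).BoundedBy C)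
    (hX : ∀ n, HasLaw (X n) (law (Θ n)) (P n)) :
    TendstoInDistribution (fun n ω => studentized (Θ n) (X n ω)) atTop (id : ℝ → ℝ) P
      (gaussianReal 0 1) where
  forall_aemeasurable n := (Measurable.of_discrete (f := studentized (Θ n))).comp_aemeasurable
    (hX n).aemeasurable
  tendsto := by
    refine ProbabilityMeasure.tendsto_iff_tendsto_charFun.2 fun u => ?_
    change Tendsto (fun n => charFun ((P n).map fun ω => studentized (Θ n) (X n ω)) u) atTop
      (𝓝 (charFun ((gaussianReal 0 1).map id) u))
    rw [Measure.map_id, charFun_gaussianReal]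
    simp_rw [charFun_map_law (hX _)]
    convert! tendsto_expect_exp_studentized hident hbound u using 2
    push_cast; congr 1; simp; ring

/-- The portmanteau theorem applies to {|x| > z}, whose boundary is null for the Gaussian law. The
rejection event differs from the corresponding event for the studentized statistic with vanishing
probability. -/
theorem tendsto_level
    (hident : ∀ n, (Θ n).Identified) (hbound : ∀ n, (Θ n).BoundedBy C)
    (hX : ∀ n, HasLaw (X n) (law (Θ n)) (P n)) (hrho : ∀ n, (Θ n).rho = 0)
    {a : ℝ} (ha : a ∈ Set.Ioo (0 : ℝ) 1) {z : ℝ}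
    (hz : gaussianReal 0 1 (Set.Iic z) = ENNReal.ofReal (1 - a / 2)) :
    Tendsto (fun n => P n {ω | z * sigmaRhoHat (X n ω) < |rhoHat (X n ω) - rhoStarHat (X n ω)|})
      atTop (𝓝 (ENNReal.ofReal a)) := by
  classical
  have hD := tendstoInDistribution_studentized hident hbound hX
  have h1 : Tendsto
      (fun n => (P n).map (fun ω => studentized (Θ n) (X n ω)) {x : ℝ | z < |x|}) atTop
      (𝓝 ((gaussianReal 0 1).map id {x : ℝ | z < |x|})) :=
    ProbabilityMeasure.tendsto_measure_of_null_frontier_of_tendsto' hD.tendsto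
      (by simpa using gaussianReal_frontier_setOf_lt_abs z)
  have hprob : ∀ n, IsProbabilityMeasure (law (Θ n)) := fun n => by
    rw [← (hX n).map_eq]; exact Measure.isProbabilityMeasure_map (hX n).aemeasurable
  have hP (n : ℕ) (s : Set (AdjArray n)) : P n (X n ⁻¹' s) = law (Θ n) s := by
    rw [← (hX n).map_eq, Measure.map_apply_of_aemeasurable (hX n).aemeasurable
      (Set.toFinite s).measurableSet]
  have hmap (n : ℕ) : (P n).map (fun ω => studentized (Θ n) (X n ω)) {x | z < |x|}
      = law (Θ n) {g | z < |studentized (Θ n) g|} := by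
    rw [Measure.map_apply_of_aemeasurable (hD.forall_aemeasurable n)
      (measurableSet_lt measurable_const continuous_abs.measurable), ← hP]
    rfl
  simp only [hmap, Measure.map_id, gaussianReal_setOf_lt_abs ha hz] at h1
  have h2 : Tendsto (fun n => (law (Θ n)).real {g | z < |studentized (Θ n) g|}) atTop (𝓝 a) := by
    have := (ENNReal.tendsto_toReal ENNReal.ofReal_ne_top).comp h1
    rwa [ENNReal.toReal_ofReal ha.1.le] at this
  have h3 : Tendsto (fun n =>
      (law (Θ n)).real {g | z * sigmaRhoHat g < |rhoHat g - rhoStarHat g|}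
        - (law (Θ n)).real {g | z < |studentized (Θ n) g|}) atTop (𝓝 0) := by
    refine squeeze_zero_norm (fun n => ?_) (tendsto_expect_sigmaRhoHat_pos hident hbound)
    simp only [studentized, hrho, sub_zero]
    exact abs_law_real_sub_le (Θ n) (z := z) (r := fun g => rhoHat g - rhoStarHat g)
      (v := sigmaRhoHat)
  have h4 := h3.add h2
  simp only [sub_add_cancel, zero_add] at h4
  refine (ENNReal.tendsto_ofReal h4).congr fun n => ?_
  rw [ofReal_measureReal, ← hP]
  rfl

end Main

end P1

end

theorem corollary1 (C : ℝ) (Θ : ∀ n : ℕ, P1.Param n)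
    (hident : ∀ n, (Θ n).Identified) (hbound : ∀ n, (Θ n).BoundedBy C)
    {Ω : ℕ → Type*} [∀ n, MeasurableSpace (Ω n)]
    (P : ∀ n, Measure (Ω n)) [∀ n, IsProbabilityMeasure (P n)]
    (X : ∀ n, Ω n → P1.AdjArray n) (hX : ∀ n, HasLaw (X n) (P1.law (Θ n)) (P n)) :
    TendstoInDistribution
        (fun n ω => (P1.rhoHat (X n ω) - (Θ n).rho - P1.rhoStarHat (X n ω))
          / P1.sigmaRhoHat (X n ω))
        atTop (id : ℝ → ℝ) P (gaussianReal 0 1)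
      ∧ ((∀ n, (Θ n).rho = 0) →
          ∀ a ∈ Set.Ioo (0 : ℝ) 1, ∀ z : ℝ,
            gaussianReal 0 1 (Set.Iic z) = ENNReal.ofReal (1 - a / 2) →
            Tendsto
              (fun n => P n {ω | z * P1.sigmaRhoHat (X n ω)
                < |P1.rhoHat (X n ω) - P1.rhoStarHat (X n ω)|})
              atTop (𝓝 (ENNReal.ofReal a))) := by
  exact ⟨P1.tendstoInDistribution_studentized hident hbound hX,
    fun hrho _ ha _ hz => P1.tendsto_level hident hbound hX hrho ha hz⟩
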